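/- \textbf{Definitions.} Let $L$ be a first-order language all of whose relation symbols have positive arity; $L$-structures may be empty. Let $\mathcal C$ be a class, closed under isomorphism, of $L$-structures $H$, each equipped with a function $\mathrm{cl}_H:\mathcal P(H)\to\mathcal P(H)$. A \emph{partial embedding} $f:H\rightharpoonup H'$ is a partial map which preserves, in both directions, all quantifier-free $L$-formulas of nonempty tuples from its domain (so it is injective; the empty map is a partial embedding). A set $X\subseteq H$ is \emph{closed} if $\mathrm{cl}_H(X)=X$; a set $B$ is \emph{independent} if $b\notin \mathrm{cl}_H(B\setminus\{b\})$ for all $b\in B$; $x$ is independent from $G$ if $x\notin\mathrm{cl}_H(G)$. A basis of $H$ is an independent set $B$ with $\mathrm{cl}_H(B)=H$, and $\dim H$ is its cardinality. A partial embedding is \emph{closed} if the images of closed subsets of its domain are closed; an embedding $H\hookrightarrow H'$ of $L$-structures is \emph{closed} if its image is closed in $H'$. A \emph{crown} in $H$ is a set $\bigcup_{i=1}^n\mathrm{cl}_H(B_i)$ with $B_1,\dots,B_n\subseteq B$ for some independent set $B$. $\mathcal C$ is a \emph{quasiminimal excellent class} if for all $H,H'\in\mathcal C$: (I.1) $\mathrm{cl}_H$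 is a pregeometry (a closure operator of finite character with the exchange property), and the closure of a finite set is countable. (I.2) If $X\subseteq H$, then $\mathrm{cl}_H(X)$ is (the domain of) a substructure of $H$ which belongs to $\mathcal C$. (I.3) If $f:H\rightharpoonup H'$ is a partial embedding, $X\cup\{y\}\subseteq\mathrm{dom} f$ and $y\in\mathrm{cl}_H(X)$, then $f(y)\in\mathrm{cl}_{H'}(f(X))$. (II) Let $G\subseteq H$ and $G'\subseteq H'$ each be countable and closed, or empty, and let $g:G\to G'$ be an isomorphism (the empty map if $G=G'=\emptyset$). (II.1) If $x\in H$, $x'\in H'$ are independent from $G$, $G'$ respectively, then $g\cup\{(x,x')\}$ is a partial embedding. (II.2) If $g\cup f:H\rightharpoonup H'$ is a partial embedding, $f$ has finite domain $X$ and $y\in\mathrm{cl}_H(X\cup G)$, then there is $y'\in H'$ such that $g\cup f\cup\{(y,y')\}$ is a partial embedding. (III) Let $K$ be a countable crown in $H$ and let $g:H\rightharpoonup H'$ be a closed partial embedding with domain $K$. For every finite $X\subseteq\mathrm{cl}_H(K)$ there is a finite $K_0\subseteq K$ such that for all $f:H\rightharpoonup H'$ with domain $X$, if $f\cup g|_{K_0}$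 is a partial embedding, then so is $f\cup g$. $\mathcal C$ satisfies \emph{axiom IV} if (IV.1) for every nonempty well-ordered chain $(H_\mu)_{\mu<\lambda}$ in $\mathcal C$ whose inclusions are closed embeddings, the union $H$ of the chain, with $\mathrm{cl}_H(X)=\bigcup_{\mu<\lambda}\mathrm{cl}_{H_\mu}(X\cap H_\mu)$, is in $\mathcal C$; and (IV.2) $\mathcal C$ contains an infinite-dimensional model. $\mathcal C$ is \emph{uncountably categorical} if it has, up to isomorphism, exactly one model of each uncountable cardinality. $L_{\omega_1,\omega}(Q)$ is the extension of $L_{\omega_1,\omega}$ by the quantifier $Q$, ``there exist uncountably many''. A \emph{Scott sentence} of a countable $L$-structure $M$ is an $L_{\omega_1,\omega}$-sentence (without $Q$) whose countable models are exactly the countable structures isomorphic to $M$. \textbf{Theorem.} Let $L$ be a countable language all of whose relation symbols have positive arity, and let $\mathcal C$ be a quasiminimal excellent class of $L$-structures, closed under isomorphism, with an infinite-dimensional model. For each $n\le\omega$ the class $\mathcal C$ has, up to isomorphism, exactly one model $M_n$ of dimension $n$ ($\aleph_0$ if $n=\omega$), and it has a Scott sentence $\sigma_n$. There are quantifier-free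 $L_{\omega_1,\omega}$-formulas $\pi_n(x,y_1,\dots,y_n)$, $n\in\mathbb N$, such that for all $H\in\mathcal C$ and $a,b_1,\dots,b_n\in H$, $$a\in\mathrm{cl}_H(\{b_1,\dots,b_n\})\iff H\models\pi_n(a,b_1,\dots,b_n).$$ For any choice of such $M_n$, $\sigma_n$ and $\pi_n$, let $\Sigma$ be the $L_{\omega_1,\omega}(Q)$-sentence $$\Sigma=\Big[\bigvee_{n\le\omega}\sigma_n\Big]\wedge\Big[\bigwedge_{n\in\mathbb N}(\forall y_1,\dots,y_n)\,\neg(Qx)\,\pi_n(x,y_1,\dots,y_n)\Big],$$ and let $\mathrm{Mod}(\Sigma)$ be the class of models $H$ of $\Sigma$ with the closure operation $$\mathrm{cl}_H(X)=\{a\in H: H\models\pi_n(a,b_1,\dots,b_n)\text{ for some } n\in\mathbb N\text{ and } b_1,\dots,b_n\in X\}.$$ Then $\mathrm{Mod}(\Sigma)$ is an uncountably categorical quasiminimal excellent class, closed under isomorphism, and $\mathcal C\subseteq\mathrm{Mod}(\Sigma)$ (with the same closure operations). Furthermore, if $\mathcal C$ satisfies axiom IV, then $\mathcal C=\mathrm{Mod}(\Sigma)$.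 -/

import Mathlib

open FirstOrder Cardinal

universe u v w

/-! ## The infinitary language with the quantifier "there exist uncountably many" -/

/-- Formulas of `L_{ω₁,ω}(Q)` with free variables among `x₀, …, x_{n-1}`. Both quantifiers bind the
last variable `xₙ` of a formula in `n + 1` variables. -/
inductive LQFormula (L : FirstOrder.Language.{u, v}) : ℕ → Type (max u v)
  | falsum {n : ℕ} : LQFormula L n
  | equal {n : ℕ} (t₁ t₂ : L.Term (Fin n)) : LQFormula L n
  | rel {n l : ℕ} (R : L.Relations l) (ts : Fin l → L.Term (Fin n)) : LQFormula L n
  | neg {n : ℕ} (φ : LQFormula L n) : LQFormula L n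
  | iAnd {n : ℕ} (φ : ℕ → LQFormula L n) : LQFormula L n
  | ex {n : ℕ} (φ : LQFormula L (n + 1)) : LQFormula L n
  | exUncountable {n : ℕ} (φ : LQFormula L (n + 1)) : LQFormula L n

namespace LQFormula

variable {L : FirstOrder.Language.{u, v}}

/-- Satisfaction of a formula in an `L`-structure. -/
def Realize {M : Type w} [L.Structure M] : {n : ℕ} → LQFormula L n → (Fin n → M) → Prop
  | _, falsum, _ => False
  | _, equal t₁ t₂, b => t₁.realize b = t₂.realize b
  | _, rel R ts, b => FirstOrder.Language.Structure.RelMap R fun i => (ts i).realize b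
  | _, neg φ, b => ¬ φ.Realize b
  | _, iAnd φ, b => ∀ i, (φ i).Realize b
  | _, ex φ, b => ∃ a : M, φ.Realize (Fin.snoc b a : Fin _ → M)
  | _, exUncountable φ, b => ¬ {a : M | φ.Realize (Fin.snoc b a : Fin _ → M)}.Countable

/-- The formula belongs to `L_{ω₁,ω}`: the quantifier `Q` does not occur. -/
def NoQ : {n : ℕ} → LQFormula L n → Prop
  | _, falsum => True
  | _, equal _ _ => True
  | _, rel _ _ => True
  | _, neg φ => φ.NoQ
  | _, iAnd φ => ∀ i, (φ i).NoQ
  | _, ex φ => φ.NoQ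
  | _, exUncountable _ => False

/-- The formula is quantifier-free (neither `∃` nor `Q` occurs). -/
def IsQF : {n : ℕ} → LQFormula L n → Prop
  | _, falsum => True
  | _, equal _ _ => True
  | _, rel _ _ => True
  | _, neg φ => φ.IsQF
  | _, iAnd φ => ∀ i, (φ i).IsQF
  | _, ex _ => False
  | _, exUncountable _ => False

/-- Countable disjunction. -/
def iOr {n : ℕ} (φ : ℕ → LQFormula L n) : LQFormula L n :=
  neg (iAnd fun i => neg (φ i))

/-- Binary conjunction. -/
def and {n : ℕ} (φ ψ : LQFormula L n) : LQFormula L n :=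
  iAnd fun i => if i = 0 then φ else ψ

/-- Binary disjunction. -/
def or {n : ℕ} (φ ψ : LQFormula L n) : LQFormula L n :=
  iOr fun i => if i = 0 then φ else ψ

/-- Universal quantification over the last variable. -/
def all {n : ℕ} (φ : LQFormula L (n + 1)) : LQFormula L n :=
  neg (ex (neg φ))

/-- The sentence `∀ x₀ … x_{n-1}, φ`. -/
def alls : (n : ℕ) → LQFormula L n → LQFormula L 0
  | 0, φ => φ
  | n + 1, φ => alls n (all φ)

end LQFormula

/-- Truth of a sentence in an `L`-structure. -/
def SatisfiesSentence {L : FirstOrder.Language.{u, v}} (M : Type w) [L.Structure M] (σ : LQFormula L 0) : Prop :=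
  σ.Realize (Fin.elim0 : Fin 0 → M)

/-- `σ` is a Scott sentence of the structure `M`: an `L_{ω₁,ω}`-sentence whose countable (possibly
finite) models are exactly the countable structures isomorphic to `M`. -/
def IsScottSentence {L : FirstOrder.Language.{u, v}} (σ : LQFormula L 0) (M : Type w) [L.Structure M] : Prop :=
  σ.NoQ ∧ ∀ (N : Type w) [L.Structure N] [Countable N],
    SatisfiesSentence N σ ↔ Nonempty (N ≃[L] M)

/-! ## Structures with a closure operation -/

/-- An `L`-structure `H` with a function `cl_H` on its power set. -/
structure ClStructure (L : FirstOrder.Language.{u, v}) where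
  carrier : Type w
  [str : L.Structure carrier]
  cl : Set carrier → Set carrier

namespace ClStructure

variable {L : FirstOrder.Language.{u, v}}

instance : CoeSort (ClStructure.{u, v, w} L) (Type w) := ⟨carrier⟩

instance (H : ClStructure.{u, v, w} L) : L.Structure H := H.str

/-- `cl_H` is a pregeometry. -/
structure IsPregeometry (H : ClStructure.{u, v, w} L) : Prop where
  subset_cl : ∀ X : Set H, X ⊆ H.cl X
  mono : ∀ X Y : Set H, X ⊆ Y → H.cl X ⊆ H.cl Y
  idem : ∀ X : Set H, H.cl (H.cl X) = H.cl X
  finite_char : ∀ (X : Set H) (a : H), a ∈ H.cl X → ∃ Y ⊆ X, Y.Finite ∧ a ∈ H.cl Y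
  exchange : ∀ (X : Set H) (a b : H),
    a ∈ H.cl (insert b X) → a ∉ H.cl X → b ∈ H.cl (insert a X)

/-- The closure of every finite set is countable. -/
def CountableClosure (H : ClStructure.{u, v, w} L) : Prop :=
  ∀ X : Set H, X.Finite → (H.cl X).Countable

/-- A closed set. -/
def IsCl (H : ClStructure.{u, v, w} L) (X : Set H) : Prop := H.cl X = X

/-- An independent set. -/
def Indep (H : ClStructure.{u, v, w} L) (B : Set H) : Prop := ∀ b ∈ B, b ∉ H.cl (B \ {b})

/-- `H` has a basis of cardinality `κ`. -/
def HasDim (H : ClStructure.{u, v, w} L) (κ : Cardinal.{w}) : Prop :=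
  ∃ B : Set H, H.Indep B ∧ H.cl B = Set.univ ∧ #B = κ

/-- A crown: the union of the closures of finitely many subsets of an independent set. -/
def IsCrown (H : ClStructure.{u, v, w} L) (C : Set H) : Prop :=
  ∃ (B : Set H) (n : ℕ) (S : Fin n → Set H),
    H.Indep B ∧ (∀ i, S i ⊆ B) ∧ C = ⋃ i, H.cl (S i)

/-- An isomorphism of `L`-structures which respects the closure operations. -/
def IsIso {H H' : ClStructure.{u, v, w} L} (e : H ≃[L] H') : Prop :=
  ∀ X : Set H, H'.cl (e '' X) = e '' H.cl X

/-! Partial maps from `H` to `H'` are represented by their graphs, subsets of `H × H'`. -/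

/-- The domain of definition ("preimage") of a partial map. -/
def pdom {H H' : Type w} (f : Set (H × H')) : Set H := Prod.fst '' f

/-- The image of a set under a partial map. -/
def pimage {H H' : Type w} (f : Set (H × H')) (X : Set H) : Set H' :=
  {y | ∃ x ∈ X, (x, y) ∈ f}

/-- The restriction of a partial map to a set. -/
def prestrict {H H' : Type w} (f : Set (H × H')) (X : Set H) : Set (H × H') :=
  {p ∈ f | p.1 ∈ X}

/-- A partial embedding: quantifier-free formulas of (nonempty) tuples are preserved in both
directions. As equality is such a formula, `f` is then the graph of an injective partial function.
The empty map is always a partial embedding. -/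
def IsPartialEmb (L : FirstOrder.Language.{u, v}) {H H' : Type w} [L.Structure H] [L.Structure H']
    (f : Set (H × H')) : Prop :=
  ∀ (n : ℕ) (φ : L.Formula (Fin (n + 1))), φ.IsQF →
    ∀ p : Fin (n + 1) → H × H', (∀ i, p i ∈ f) →
      (φ.Realize (fun i => (p i).1) ↔ φ.Realize (fun i => (p i).2))

/-- A closed partial embedding: closed sets in the domain have closed images. -/
def IsClosedPartialEmb {H H' : ClStructure.{u, v, w} L} (f : Set (H × H')) : Prop :=
  IsPartialEmb L f ∧ ∀ X ⊆ pdom f, H.IsCl X → H'.IsCl (pimage f X)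

end ClStructure

/-! ## Quasiminimal excellent classes -/

open ClStructure

/-- A quasiminimal excellent class of `L`-structures with closure operations, closed under
isomorphism. By axiom I.3 for the identity map, an `L`-structure carries at most one closure
operation with which it is in the class, so `cl_H` is a function of `H`. -/
structure IsQuasiminimalExcellent {L : FirstOrder.Language.{u, v}} (C : Set (ClStructure.{u, v, w} L)) :
    Prop where
  isoClosed : ∀ H ∈ C, ∀ (H' : ClStructure.{u, v, w} L) (e : H ≃[L] H'), IsIso e → H' ∈ C
  /-- I.1: each `cl_H` is a pregeometry … -/
  pregeometry : ∀ H ∈ C, H.IsPregeometry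
  /-- … with the countable closure property. -/
  ccp : ∀ H ∈ C, H.CountableClosure
  /-- I.2: closures are substructures belonging to the class. -/
  cl_mem : ∀ H ∈ C, ∀ X : Set H, ∃ S : L.Substructure H, (S : Set H) = H.cl X ∧
    ∃ c : Set S → Set S, (⟨S, c⟩ : ClStructure.{u, v, w} L) ∈ C
  /-- I.3: partial embeddings respect the closure operations. -/
  cl_map : ∀ H ∈ C, ∀ H' ∈ C, ∀ f : Set (H × H'), IsPartialEmb L f →
    ∀ (X : Set H) (y : H) (y' : H'), X ⊆ pdom f → (y, y') ∈ f → y ∈ H.cl X →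
      y' ∈ H'.cl (pimage f X)
  /-- II.1 -/
  homogeneity_generic : ∀ H ∈ C, ∀ H' ∈ C, ∀ (G : Set H) (G' : Set H') (g : Set (H × H')),
    (G.Countable ∧ H.IsCl G ∨ G = ∅) → (G'.Countable ∧ H'.IsCl G' ∨ G' = ∅) →
    IsPartialEmb L g → pdom g = G → pimage g G = G' →
    ∀ (x : H) (x' : H'), x ∉ H.cl G → x' ∉ H'.cl G' → IsPartialEmb L (g ∪ {(x, x')})
  /-- II.2 -/
  homogeneity_closure : ∀ H ∈ C, ∀ H' ∈ C, ∀ (G : Set H) (G' : Set H') (g : Set (H × H')),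
    (G.Countable ∧ H.IsCl G ∨ G = ∅) → (G'.Countable ∧ H'.IsCl G' ∨ G' = ∅) →
    IsPartialEmb L g → pdom g = G → pimage g G = G' →
    ∀ f : Set (H × H'), (pdom f).Finite → IsPartialEmb L (g ∪ f) →
    ∀ y ∈ H.cl (pdom f ∪ G), ∃ y' : H', IsPartialEmb L (g ∪ f ∪ {(y, y')})
  /-- III -/
  excellence : ∀ H ∈ C, ∀ H' ∈ C, ∀ K : Set H, K.Countable → H.IsCrown K →
    ∀ g : Set (H × H'), IsClosedPartialEmb g → pdom g = K →
    ∀ X : Set H, X.Finite → X ⊆ H.cl K →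
      ∃ K₀ ⊆ K, K₀.Finite ∧ ∀ f : Set (H × H'), pdom f = X →
        IsPartialEmb L (f ∪ prestrict g K₀) → IsPartialEmb L (f ∪ g)

/-- The class has an infinite-dimensional model. -/
def HasInfiniteDimensionalModel {L : FirstOrder.Language.{u, v}} (C : Set (ClStructure.{u, v, w} L)) : Prop :=
  ∃ H ∈ C, ∃ κ : Cardinal.{w}, ℵ₀ ≤ κ ∧ H.HasDim κ

/-- IV.1: unions of nonempty well-ordered chains. The structure `H` is the union of the chain of
substructures `S i`; each `S i` with its closure operation `c i` is in `C`, and the inclusions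
`S i ⊆ S j` are closed embeddings. -/
def HasUnionsOfChains {L : FirstOrder.Language.{u, v}} (C : Set (ClStructure.{u, v, w} L)) : Prop :=
  ∀ (ι : Type w) [LinearOrder ι] [WellFoundedLT ι] [Nonempty ι] (H : Type w) [L.Structure H]
    (S : ι → L.Substructure H) (c : ∀ i, Set (S i) → Set (S i)),
    Monotone S → (∀ a : H, ∃ i, a ∈ S i) →
    (∀ i, (⟨S i, c i⟩ : ClStructure.{u, v, w} L) ∈ C) →
    (∀ i j, i ≤ j → c j {a : S j | (a : H) ∈ S i} = {a : S j | (a : H) ∈ S i}) →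
    (⟨H, fun X => ⋃ i, (Subtype.val : S i → H) '' c i ((Subtype.val : S i → H) ⁻¹' X)⟩ :
      ClStructure.{u, v, w} L) ∈ C

/-- Axiom IV. -/
def AxiomIV {L : FirstOrder.Language.{u, v}} (C : Set (ClStructure.{u, v, w} L)) : Prop :=
  HasUnionsOfChains C ∧ HasInfiniteDimensionalModel C

/-- Exactly one model, up to isomorphism, of each uncountable cardinality. -/
def UncountablyCategorical {L : FirstOrder.Language.{u, v}} (C : Set (ClStructure.{u, v, w} L)) : Prop :=
  ∀ κ : Cardinal.{w}, ℵ₀ < κ →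
    (∃ H ∈ C, #H = κ) ∧
    ∀ H ∈ C, ∀ H' ∈ C, #H = κ → #H' = κ → ∃ e : H ≃[L] H', IsIso e

/-! ## The sentence and its models -/

/-- The quantifier-free `L_{ω₁,ω}`-formulas `πₙ(x, y₁, …, yₙ)` define the closure operations of the
class. The variables of `π n` are listed as `y₁, …, yₙ, x`. -/
def DefinesClosure {L : FirstOrder.Language.{u, v}} (C : Set (ClStructure.{u, v, w} L))
    (π : ∀ n : ℕ, LQFormula L (n + 1)) : Prop :=
  ∀ n, (π n).IsQF ∧ ∀ H ∈ C, ∀ (b : Fin n → H) (a : H),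
    a ∈ H.cl (Set.range b) ↔ (π n).Realize (Fin.snoc b a : Fin (n + 1) → H)

/-- The sentence `[⋁_{n ≤ ω} σₙ] ∧ [⋀_{n ∈ ℕ} (∀ y₁ … yₙ) ¬ (Q x) πₙ(x, y₁, …, yₙ)]`; here `⊤ : ℕ∞`
stands for `ω`. -/
def classSentence {L : FirstOrder.Language.{u, v}} (σ : ℕ∞ → LQFormula L 0)
    (π : ∀ n : ℕ, LQFormula L (n + 1)) : LQFormula L 0 :=
  LQFormula.and
    (LQFormula.or (σ ⊤) (LQFormula.iOr fun n : ℕ => σ n))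
    (LQFormula.iAnd fun n : ℕ => LQFormula.alls n (LQFormula.neg (LQFormula.exUncountable (π n))))

/-- The class `Mod(τ)` of models of the sentence `τ`, each with the closure operation defined by
the formulas `πₙ`: `a ∈ cl(X)` iff `πₙ(a, b₁, …, bₙ)` holds for some `n` and `b₁, …, bₙ ∈ X`. -/
def modClass {L : FirstOrder.Language.{u, v}} (τ : LQFormula L 0) (π : ∀ n : ℕ, LQFormula L (n + 1)) :
    Set (ClStructure.{u, v, w} L) :=
  {H | SatisfiesSentence H τ ∧ ∀ X : Set H,
    H.cl X = {a | ∃ (n : ℕ) (b : Fin n → H), (∀ i, b i ∈ X) ∧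
      (π n).Realize (Fin.snoc b a : Fin (n + 1) → H)}}

/-! Everything is reduced to countable pieces. Let `locally C` be the class of structures with a
finitary closure operation in which every countable set lies in a countable closed substructure
belonging to `C`. Up to finite character, the axioms concern countably many elements at a time, so
`locally C` is again quasiminimal excellent (`IsQuasiminimalExcellent.locally`). It coincides with
`modClass`. In a model of the sentence some `σ n` holds and closures of finite sets are countable,
so a Löwenheim–Skolem hull that is also closed under `cl` is a countable closed model of `σ n`,
hence a copy of `M n`. Conversely, a countable member of `locally C` lies in `C` and is isomorphic
to some `M n`; an uncountable one is not the closure of a finite set, so finite partial embeddings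
go back and forth between it and `M ⊤`, and it satisfies `σ ⊤`.

Uniqueness in each dimension means that a bijection of bases extends to the closures. For countable
families one adds one element at a time, by `homogeneity_generic` and `homogeneity_closure`. An
infinite family is indexed by `ℕ ⊕ J`, and for finite `X ⊆ J` one builds coherent isomorphisms `f X`
of the closures of the elements indexed by `ℕ` and `X`, by induction on `X`. If the maps on the
faces `X \ {x}` have a union that is a partial embedding, `excellence` extends it from this crown to
its closure. That the union is a partial embedding is shown by adding faces one at a time: a map
extending the earlier faces differs from the map on the new face by an automorphism fixing the
intersections with the earlier faces, and moving `x` to an unused index in `ℕ` shows that this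
automorphism is compatible with the identity of the earlier faces (`isPartialEmb_pid_union`).

A model of uncountable size `κ` comes from Zorn's lemma, applied to infinite-dimensional models
inside a set of size `κ`. A directed union is at first only in `finLocally`, the analogue of
`locally` for finite sets, but a countable infinite-dimensional set spans a copy of `M ⊤`, so
`finLocally C ⊆ locally C`. A model of size less than `κ` is isomorphic to a proper closed
substructure of itself and so is not maximal.

By `cl_map`, applied to a map and its inverse, the atomic type of a tuple decides dependence, and
every finite tuple has a copy in the countable infinite-dimensional model; this makes the closure
quantifier-free definable. Scott sentences exist because finite partial embeddings of a model into
itself extend (`exists_extend_self`). Under axiom IV, induction on the dimension writes an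
uncountable member of `locally C` as a chain of closures of initial segments of a basis, so `locally
C ⊆ C`. -/

/-! ## Partial embeddings -/

namespace ClStructure

open FirstOrder.Language

variable {L : FirstOrder.Language.{u, v}}

/-- Two tuples satisfy the same atomic formulas. -/
def AtEq (L : FirstOrder.Language.{u, v}) {H H' : Type w} [L.Structure H] [L.Structure H']
    {α : Type*} (a : α → H) (b : α → H') : Prop :=
  (∀ t₁ t₂ : L.Term α, t₁.realize a = t₂.realize a ↔ t₁.realize b = t₂.realize b) ∧
  ∀ (l : ℕ) (R : L.Relations l) (ts : Fin l → L.Term α),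
    Structure.RelMap R (fun i => (ts i).realize a) ↔ Structure.RelMap R (fun i => (ts i).realize b)

/-- The image of a partial map. -/
def prange {H H' : Type w} (f : Set (H × H')) : Set H' := Prod.snd '' f

/-- The inverse of a partial map. -/
def pinv {H H' : Type w} (f : Set (H × H')) : Set (H' × H) := {p | (p.2, p.1) ∈ f}

/-- The composition of two partial maps. -/
def pcomp {H H' H'' : Type w} (f : Set (H × H')) (g : Set (H' × H'')) : Set (H × H'') :=
  {p | ∃ y, (p.1, y) ∈ f ∧ (y, p.2) ∈ g}

/-- The identity of a set as a partial map. -/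
def pid {H : Type w} (X : Set H) : Set (H × H) := {p | p.1 = p.2 ∧ p.1 ∈ X}

/-! ### Partial maps as relations -/

section Sets

variable {H H' H'' : Type w} {f g : Set (H × H')} {X Y : Set H} {x : H} {y : H'}

@[simp] theorem mem_pdom : x ∈ pdom f ↔ ∃ y, (x, y) ∈ f := by simp [pdom]

@[simp] theorem mem_prange : y ∈ prange f ↔ ∃ x, (x, y) ∈ f := by simp [prange]

@[simp] theorem mem_pinv : (y, x) ∈ pinv f ↔ (x, y) ∈ f := Iff.rfl

@[simp] theorem mem_pimage : y ∈ pimage f X ↔ ∃ x ∈ X, (x, y) ∈ f := Iff.rfl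

@[simp] theorem mem_pid {x y : H} : (x, y) ∈ pid X ↔ x = y ∧ x ∈ X := Iff.rfl

theorem mem_pcomp {g : Set (H' × H'')} {z : H''} :
    (x, z) ∈ pcomp f g ↔ ∃ y, (x, y) ∈ f ∧ (y, z) ∈ g := Iff.rfl

@[simp] theorem pdom_pinv : pdom (pinv f) = prange f := by ext; simp

@[simp] theorem prange_pinv : prange (pinv f) = pdom f := by ext; simp

@[simp] theorem pinv_pinv : pinv (pinv f) = f := rfl

@[simp] theorem pinv_union : pinv (f ∪ g) = pinv f ∪ pinv g := rfl

@[simp] theorem pinv_singleton : pinv {(x, y)} = {(y, x)} := by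
  ext ⟨a, b⟩; simp [pinv, and_comm]

theorem pinv_eq_image : pinv f = Prod.swap '' f := by
  ext ⟨a, b⟩; simp [pinv]

theorem pinv_subset {g : Set (H × H')} (h : f ⊆ g) : pinv f ⊆ pinv g := fun _ hp => h hp

@[simp] theorem pdom_empty : pdom (∅ : Set (H × H')) = ∅ := by ext; simp

@[simp] theorem prange_empty : prange (∅ : Set (H × H')) = ∅ := by ext; simp

@[simp] theorem pdom_union : pdom (f ∪ g) = pdom f ∪ pdom g := Set.image_union ..

@[simp] theorem prange_union : prange (f ∪ g) = prange f ∪ prange g := Set.image_union ..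

@[simp] theorem pdom_singleton : pdom {(x, y)} = {x} := Set.image_singleton ..

@[simp] theorem prange_singleton : prange {(x, y)} = {y} := Set.image_singleton ..

@[simp] theorem pdom_pid : pdom (pid X) = X := by ext; simp

@[simp] theorem prange_pid : prange (pid X) = X := by ext; simp

@[simp] theorem pimage_pdom : pimage f (pdom f) = prange f := by
  ext y; simp only [mem_pimage, mem_pdom, mem_prange]
  exact ⟨fun ⟨x, _, h⟩ => ⟨x, h⟩, fun ⟨x, h⟩ => ⟨x, ⟨y, h⟩, h⟩⟩

theorem pdom_mono (h : f ⊆ g) : pdom f ⊆ pdom g := Set.image_mono h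

theorem prange_mono (h : f ⊆ g) : prange f ⊆ prange g := Set.image_mono h

theorem pimage_subset_prange : pimage f X ⊆ prange f := fun _ ⟨x, _, h⟩ => mem_prange.2 ⟨x, h⟩

theorem pimage_mono (h : f ⊆ g) (h' : X ⊆ Y) : pimage f X ⊆ pimage g Y :=
  fun _ ⟨x, hx, hf⟩ => ⟨x, h' hx, h hf⟩

end Sets

/-! ### Atomic types of tuples -/

section AtEq

variable {H H' H'' : Type w} [L.Structure H] [L.Structure H'] [L.Structure H'']
variable {α β : Type*}

theorem AtEq.refl (a : α → H) : AtEq L a a := ⟨fun _ _ => Iff.rfl, fun _ _ _ => Iff.rfl⟩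

theorem AtEq.symm {a : α → H} {b : α → H'} (h : AtEq L a b) : AtEq L b a :=
  ⟨fun _ _ => (h.1 _ _).symm, fun _ _ _ => (h.2 _ _ _).symm⟩

theorem AtEq.comp {a : α → H} {b : α → H'} (h : AtEq L a b) (g : β → α) :
    AtEq L (a ∘ g) (b ∘ g) := by
  constructor
  · intro t₁ t₂
    have := h.1 (t₁.relabel g) (t₂.relabel g)
    simpa using this
  · intro l R ts
    have := h.2 l R fun i => (ts i).relabel g
    simpa using this

theorem AtEq.realize_isQF {α : Type} {a : α → H} {b : α → H'} (h : AtEq L a b) {φ : L.Formula α}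
    (hφ : φ.IsQF) : φ.Realize a ↔ φ.Realize b := by
  unfold Formula.Realize
  -- A formula is a bounded formula without bound variables; the summand `Fin 0` of the variables is
  -- relabelled away.
  have key : ∀ t : L.Term (α ⊕ Fin 0), ∃ s : L.Term α, (∀ c : Fin 0 → H,
      t.realize (Sum.elim a c) = s.realize a) ∧ ∀ c : Fin 0 → H',
      t.realize (Sum.elim b c) = s.realize b := by
    intro t
    refine ⟨t.relabel (Sum.elim id Fin.elim0), fun c => ?_, fun c => ?_⟩ <;>
    · rw [Term.realize_relabel]
      congr 1
      funext x
      rcases x with x | x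
      · rfl
      · exact x.elim0
  induction hφ with
  | falsum => exact Iff.rfl
  | of_isAtomic hat =>
    cases hat with
    | equal t₁ t₂ =>
      obtain ⟨s₁, h₁, h₁'⟩ := key t₁
      obtain ⟨s₂, h₂, h₂'⟩ := key t₂
      simp only [BoundedFormula.realize_bdEqual, h₁, h₁', h₂, h₂']
      exact h.1 _ _
    | rel R ts =>
      choose s hs hs' using fun i => key (ts i)
      simp only [BoundedFormula.realize_rel, hs, hs']
      exact h.2 _ _ _
  | imp _ _ ih₁ ih₂ => simp only [BoundedFormula.realize_imp, ih₁, ih₂]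

theorem isPartialEmb_iff {f : Set (H × H')} :
    IsPartialEmb L f ↔ ∀ (n : ℕ) (p : Fin (n + 1) → H × H'), (∀ i, p i ∈ f) →
      AtEq L (fun i => (p i).1) (fun i => (p i).2) := by
  constructor
  · intro h n p hp
    constructor
    · intro t₁ t₂
      have := h n (t₁.equal t₂) (BoundedFormula.IsAtomic.isQF (.equal _ _)) p hp
      simpa using this
    · intro l R ts
      have := h n (R.formula ts) (BoundedFormula.IsAtomic.isQF (.rel _ _)) p hp
      simpa using this
  · intro h n φ hφ p hp
    exact (h n p hp).realize_isQF hφ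

/-- The index type must be nonempty: the empty map is always a partial embedding and carries no
information about closed terms. -/
theorem IsPartialEmb.atEq {f : Set (H × H')} (hf : IsPartialEmb L f) [Finite α] [Nonempty α]
    {a : α → H} {b : α → H'} (h : ∀ i, (a i, b i) ∈ f) : AtEq L a b := by
  obtain ⟨n, ⟨e⟩⟩ := Finite.exists_equiv_fin α
  cases n with
  | zero => exact (e (Classical.arbitrary α)).elim0
  | succ n =>
    have := (isPartialEmb_iff.1 hf n (fun i => (a (e.symm i), b (e.symm i))) fun i => h _).comp e
    simpa [Function.comp_def] using this

theorem AtEq.isPartialEmb {a : α → H} {b : α → H'} (h : AtEq L a b) :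
    IsPartialEmb L (Set.range fun i => (a i, b i)) := by
  refine isPartialEmb_iff.2 fun n p hp => ?_
  choose g hg using hp
  have := h.comp g
  convert this using 2 with i i
  · simp [← hg]
  · simp [← hg]

end AtEq

/-! ### Composition, unions and total partial embeddings -/

section PartialEmb

variable {H H' H'' : Type w} [L.Structure H] [L.Structure H'] [L.Structure H'']
variable {f g : Set (H × H')}

theorem IsPartialEmb.mono (hg : IsPartialEmb L g) (h : f ⊆ g) : IsPartialEmb L f :=
  fun n φ hφ p hp => hg n φ hφ p fun i => h (hp i)

theorem IsPartialEmb.pinv (hf : IsPartialEmb L f) : IsPartialEmb L (pinv f) :=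
  fun n φ hφ p hp => (hf n φ hφ (fun i => (p i).swap) hp).symm

theorem isPartialEmb_pinv : IsPartialEmb L (ClStructure.pinv f) ↔ IsPartialEmb L f :=
  ⟨fun h => h.pinv, fun h => h.pinv⟩

theorem isPartialEmb_empty : IsPartialEmb L (∅ : Set (H × H')) :=
  fun _ _ _ _ hp => (hp 0).elim

theorem isPartialEmb_pid (X : Set H) : IsPartialEmb L (pid X) := by
  intro n φ hφ p hp
  rw [show (fun i => (p i).1) = fun i => (p i).2 from funext fun i => (hp i).1]

theorem IsPartialEmb.pcomp {f' : Set (H' × H'')} (hf : IsPartialEmb L f)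
    (hf' : IsPartialEmb L f') : IsPartialEmb L (pcomp f f') := by
  intro n φ hφ p hp
  choose y hy hy' using hp
  exact (hf n φ hφ (fun i => ((p i).1, y i)) hy).trans (hf' n φ hφ (fun i => (y i, (p i).2)) hy')

theorem isPartialEmb_of_finite (h : ∀ s ⊆ f, s.Finite → IsPartialEmb L s) : IsPartialEmb L f :=
  fun n φ hφ p hp => h (Set.range p) (Set.range_subset_iff.2 hp) (Set.finite_range p) n φ hφ p
    fun i => Set.mem_range_self i

theorem isPartialEmb_sUnion {S : Set (Set (H × H'))} (hS : DirectedOn (· ⊆ ·) S)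
    (h : ∀ s ∈ S, IsPartialEmb L s) : IsPartialEmb L (⋃₀ S) := by
  refine isPartialEmb_of_finite fun s hs hfin => ?_
  rcases s.eq_empty_or_nonempty with rfl | ⟨x, hx⟩
  · exact isPartialEmb_empty
  · obtain ⟨t₀, ht₀, -⟩ := hs hx
    obtain ⟨t, ht, hst⟩ := DirectedOn.exists_mem_subset_of_finite_of_subset_sUnion
      ⟨t₀, ht₀⟩ hS hfin hs
    exact (h t ht).mono hst

theorem IsPartialEmb.eq_right (hf : IsPartialEmb L f) {x : H} {y y' : H'} (h : (x, y) ∈ f)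
    (h' : (x, y') ∈ f) : y = y' := by
  have := hf.atEq (α := Fin 2) (a := ![x, x]) (b := ![y, y'])
    (by intro i; fin_cases i <;> simpa)
  simpa using this.1 (.var 0) (.var 1)

theorem IsPartialEmb.eq_left (hf : IsPartialEmb L f) {x x' : H} {y : H'} (h : (x, y) ∈ f)
    (h' : (x', y) ∈ f) : x = x' :=
  hf.pinv.eq_right (f := ClStructure.pinv f) h h'

theorem isPartialEmb_graph (e : H ↪[L] H') : IsPartialEmb L {p : H × H' | e p.1 = p.2} := by
  intro n φ hφ p hp
  have : (fun i => (p i).2) = e ∘ fun i => (p i).1 := funext fun i => (hp i).symm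
  rw [this]
  unfold Formula.Realize
  have h := BoundedFormula.IsQF.realize_embedding hφ e (v := fun i => (p i).1) (xs := default)
  rw [← h]
  exact iff_of_eq (congrArg _ (Subsingleton.elim _ _))

/-- A partial embedding with full domain and image is an isomorphism. -/
theorem IsPartialEmb.exists_equiv [IsEmpty (L.Relations 0)] (hf : IsPartialEmb L f)
    (hd : pdom f = Set.univ) (hr : prange f = Set.univ) :
    ∃ e : H ≃[L] H', ∀ x y, e x = y ↔ (x, y) ∈ f := by
  have hd' : ∀ x, ∃ y, (x, y) ∈ f := fun x => mem_pdom.1 (hd ▸ Set.mem_univ x)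
  have hr' : ∀ y, ∃ x, (x, y) ∈ f := fun y => mem_prange.1 (hr ▸ Set.mem_univ y)
  choose F hF using hd'
  choose G hG using hr'
  refine ⟨⟨⟨F, G, fun x => hf.eq_left (hG _) (hF x), fun y => hf.eq_right (hF _) (hG y)⟩,
    ?_, ?_⟩, fun x y => ⟨fun h => h ▸ hF x, fun h => hf.eq_right (hF x) h⟩⟩
  · intro n k x
    -- The value of the function is adjoined to its arguments as the index `none`, so that the tuple
    -- is nonempty even for a constant.
    have := hf.atEq (α := Option (Fin n)) (a := fun o => o.elim (Structure.funMap k x) x)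
      (b := fun o => o.elim (F (Structure.funMap k x)) (F ∘ x))
      (by rintro (_ | i) <;> exact hF _)
    have := this.1 (.var none) (.func k fun i => .var (some i))
    simpa [Term.realize, Function.comp_def] using this
  · intro n R x
    cases n with
    -- Between empty structures there are no tuples to test, and a nullary relation symbol would
    -- escape the partial embedding.
    | zero => exact isEmptyElim R
    | succ n =>
      have := hf.atEq (a := x) (b := F ∘ x) (fun i => hF _)
      have := this.2 _ R fun i => .var i
      simpa [Term.realize, Function.comp_def] using this.symm

end PartialEmb

theorem exists_finite_subset_pimage {H H' : Type w} {f : Set (H × H')} {X : Set H} {Y : Set H'}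
    (hY : Y.Finite) (h : Y ⊆ pimage f X) : ∃ c ⊆ X, c.Finite ∧ Y ⊆ pimage f c := by
  rcases Y.eq_empty_or_nonempty with rfl | ⟨y₀, hy₀⟩
  · exact ⟨∅, Set.empty_subset _, Set.finite_empty, Set.empty_subset _⟩
  have : Nonempty H := ⟨(h hy₀).choose⟩
  have h' : ∀ y ∈ Y, ∃ x ∈ X, (x, y) ∈ f := fun y hy => h hy
  choose! g hg using h'
  exact ⟨g '' Y, Set.image_subset_iff.2 fun y hy => (hg y hy).1, hY.image g,
    fun y hy => ⟨g y, ⟨y, hy, rfl⟩, (hg y hy).2⟩⟩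

theorem IsPartialEmb.prestrict_finite {H H' : Type w} [L.Structure H] [L.Structure H']
    {f : Set (H × H')} (hf : IsPartialEmb L f) {X : Set H} (hX : X.Finite) :
    (prestrict f X).Finite := by
  refine Set.Finite.of_finite_image (f := Prod.fst) (hX.subset ?_) ?_
  · rintro _ ⟨p, hp, rfl⟩
    exact hp.2
  · rintro ⟨a, b⟩ hp ⟨a', b'⟩ hq (rfl : a = a')
    rw [hf.eq_right hp.1 hq.1]

theorem pdom_prestrict {H H' : Type w} {f : Set (H × H')} {X : Set H} (hX : X ⊆ pdom f) :
    pdom (prestrict f X) = X := by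
  ext z
  simp only [prestrict, mem_pdom, Set.mem_ofPred_eq]
  exact ⟨fun ⟨_, _, h⟩ => h, fun h => (mem_pdom.1 (hX h)).imp fun _ hy => ⟨hy, h⟩⟩

theorem prange_prestrict {H H' : Type w} {f : Set (H × H')} {X : Set H} :
    prange (prestrict f X) = pimage f X := by
  ext z; simp [prestrict, and_comm]

end ClStructure

/-! ## Pregeometries -/

namespace ClStructure

variable {L : FirstOrder.Language.{u, v}} {H : ClStructure.{u, v, w} L}

/-- An independent family. -/
def FamIndep {I : Type*} (b : I → H) : Prop := ∀ i, b i ∉ H.cl (b '' {i}ᶜ)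

/-- The structure is the closure of a finite set. -/
def FinGen (H : ClStructure.{u, v, w} L) : Prop := ∃ F : Set H, F.Finite ∧ H.cl F = Set.univ

namespace IsPregeometry

theorem cl_subset (hH : H.IsPregeometry) {X Y : Set H} (h : X ⊆ H.cl Y) : H.cl X ⊆ H.cl Y :=
  (hH.mono _ _ h).trans (hH.idem Y).subset

theorem isCl_cl (hH : H.IsPregeometry) (X : Set H) : H.IsCl (H.cl X) := hH.idem X

theorem cl_subset_of_isCl (hH : H.IsPregeometry) {X Y : Set H} (hY : H.IsCl Y) (h : X ⊆ Y) : H.cl X ⊆ Y :=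
  (hH.mono _ _ h).trans (Eq.subset hY)

theorem isCl_of_subset (hH : H.IsPregeometry) {X : Set H} (h : H.cl X ⊆ X) : H.IsCl X :=
  h.antisymm (hH.subset_cl X)

theorem isCl_inter (hH : H.IsPregeometry) {X Y : Set H} (hX : H.IsCl X) (hY : H.IsCl Y) : H.IsCl (X ∩ Y) :=
  hH.isCl_of_subset (Set.subset_inter (hH.cl_subset_of_isCl hX Set.inter_subset_left)
    (hH.cl_subset_of_isCl hY Set.inter_subset_right))

theorem mem_cl_self (hH : H.IsPregeometry) {X : Set H} {a : H} (h : a ∈ X) : a ∈ H.cl X := hH.subset_cl X h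

theorem cl_countable (hH : H.IsPregeometry) (hc : H.CountableClosure) {X : Set H} (hX : X.Countable) :
    (H.cl X).Countable := by
  have : H.cl X ⊆ ⋃ Y ∈ {Y : Set H | Y.Finite ∧ Y ⊆ X}, H.cl Y := by
    intro a ha
    obtain ⟨Y, hYX, hY, haY⟩ := hH.finite_char X a ha
    exact Set.mem_biUnion (show Y ∈ {Y : Set H | Y.Finite ∧ Y ⊆ X} from ⟨hY, hYX⟩) haY
  exact (Set.Countable.biUnion (Set.countable_ofPred_finite_subset hX)
    fun Y hY => hc Y hY.1).mono this

theorem exists_mem_cl_of_directedOn (hH : H.IsPregeometry) {S : Set (Set H)} (hne : S.Nonempty)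
    (hS : DirectedOn (· ⊆ ·) S) {a : H} (ha : a ∈ H.cl (⋃₀ S)) : ∃ X ∈ S, a ∈ H.cl X := by
  obtain ⟨Y, hYX, hY, haY⟩ := hH.finite_char _ a ha
  obtain ⟨t, ht, hYt⟩ := DirectedOn.exists_mem_subset_of_finite_of_subset_sUnion hne hS hY hYX
  exact ⟨t, ht, hH.mono _ _ hYt haY⟩

theorem indep_mono (hH : H.IsPregeometry) {B B' : Set H} (hB : H.Indep B) (h : B' ⊆ B) : H.Indep B' :=
  fun b hb hb' => hB b (h hb) (hH.mono _ _ (Set.sdiff_subset_sdiff_left h) hb')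

theorem indep_insert (hH : H.IsPregeometry) {B : Set H} (hB : H.Indep B) {a : H} (ha : a ∉ H.cl B) :
    H.Indep (insert a B) := by
  have haB : a ∉ B := fun h => ha (hH.mem_cl_self h)
  rintro b (rfl | hb) hb'
  · refine ha (hH.mono _ _ ?_ hb')
    rintro x ⟨rfl | hx, hxb⟩
    · exact (hxb rfl).elim
    · exact hx
  · have hab : a ≠ b := fun h => haB (h ▸ hb)
    have : insert a B \ {b} = insert a (B \ {b}) :=
      (Set.insert_sdiff_singleton_comm hab B).symm
    rw [this] at hb'
    have := hH.exchange _ _ _ hb' (hB b hb)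
    rw [Set.insert_sdiff_singleton, Set.insert_eq_of_mem hb] at this
    exact ha this

theorem famIndep_of_indep (hH : H.IsPregeometry) {B : Set H} (hB : H.Indep B) {I : Type*} {b : I → H}
    (hinj : Function.Injective b) (hb : ∀ i, b i ∈ B) : FamIndep b := by
  refine fun i h => hB (b i) (hb i) (hH.mono _ _ ?_ h)
  rintro _ ⟨j, hj, rfl⟩
  exact ⟨hb j, fun h => hj (hinj h)⟩

theorem notMem_cl_image (hH : H.IsPregeometry) {I : Type*} {b : I → H} (hb : FamIndep b) {i : I} {S : Set I}
    (hi : i ∉ S) : b i ∉ H.cl (b '' S) := by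
  refine fun h => hb i (hH.mono _ _ (Set.image_mono ?_) h)
  rintro j hj rfl
  exact hi hj

theorem famIndep_indep (hH : H.IsPregeometry) {I : Type*} {b : I → H} (hb : FamIndep b) : H.Indep (Set.range b) := by
  rintro _ ⟨i, rfl⟩ h
  refine hb i (hH.mono _ _ ?_ h)
  rintro _ ⟨⟨j, rfl⟩, hj⟩
  exact ⟨j, fun h => hj (congrArg b h), rfl⟩

/-- Every independent subset of a set extends to a basis of that set. -/
theorem exists_basis (hH : H.IsPregeometry) {X B₀ : Set H} (hB₀ : H.Indep B₀) (h₀ : B₀ ⊆ X) :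
    ∃ B, B₀ ⊆ B ∧ B ⊆ X ∧ H.Indep B ∧ X ⊆ H.cl B := by
  obtain ⟨B, hBB, hB⟩ := zorn_subset_nonempty {B | H.Indep B ∧ B ⊆ X} (by
    intro c hc hch hne
    refine ⟨⋃₀ c, ⟨?_, Set.sUnion_subset fun s hs => (hc hs).2⟩,
      fun s hs => Set.subset_sUnion_of_mem hs⟩
    rintro b ⟨s, hs, hbs⟩ hb
    obtain ⟨Y, hYX, hY, hbY⟩ := hH.finite_char _ b hb
    obtain ⟨t, ht, hYt⟩ := DirectedOn.exists_mem_subset_of_finite_of_subset_sUnion hne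
      hch.directedOn hY (hYX.trans Set.sdiff_subset)
    rcases hch.total hs ht with hst | hts
    · exact (hc ht).1 b (hst hbs) (hH.mono Y (t \ {b}) (fun y hy => ⟨hYt hy, (hYX hy).2⟩) hbY)
    · exact (hc hs).1 b hbs (hH.mono Y (s \ {b}) (fun y hy => ⟨hts (hYt hy), (hYX hy).2⟩) hbY))
    B₀ ⟨hB₀, h₀⟩
  refine ⟨B, hBB, hB.prop.2, hB.prop.1, fun x hx => ?_⟩
  by_contra hxB
  have := hB.eq_of_subset ⟨hH.indep_insert hB.prop.1 hxB, Set.insert_subset hx hB.prop.2⟩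
    (Set.subset_insert x B)
  exact hxB (hH.mem_cl_self (this ▸ Set.mem_insert x B))

theorem indep_empty (_ : H.IsPregeometry) : H.Indep (∅ : Set H) := fun _ h => h.elim

theorem exists_basis_univ (hH : H.IsPregeometry) : ∃ B, H.Indep B ∧ H.cl B = Set.univ := by
  obtain ⟨B, -, -, hB, h⟩ := hH.exists_basis (X := Set.univ) hH.indep_empty (Set.empty_subset _)
  exact ⟨B, hB, Set.univ_subset_iff.1 h⟩

/-- The Steinitz exchange lemma. -/
theorem card_le_card (hH : H.IsPregeometry) (S : Finset H) : ∀ I : Finset H, H.Indep (I : Set H) →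
    (I : Set H) ⊆ H.cl S → I.card ≤ S.card := by
  classical
  suffices ∀ n, ∀ I : Finset H, (I \ S).card = n → H.Indep (I : Set H) →
    (I : Set H) ⊆ H.cl S → I.card ≤ S.card from fun I => this _ I rfl
  intro n
  induction n with
  | zero => exact fun I hI _ _ => Finset.card_le_card (by simpa using hI)
  | succ n ih =>
    intro I hn hI hIS
    obtain ⟨a, ha⟩ : (I \ S).Nonempty := Finset.card_pos.1 (by omega)
    obtain ⟨haI, haS⟩ := Finset.mem_sdiff.1 ha
    have haJ : a ∉ H.cl (I.erase a : Finset H) := by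
      rw [Finset.coe_erase]; exact hI a haI
    -- The element `a` is exchanged for some `s ∈ S`, which makes `I \ S` smaller. Such an `s`
    -- exists, for otherwise `S`, and with it `a`, would depend on `I.erase a`.
    obtain ⟨s, hs, hsJ⟩ : ∃ s ∈ S, s ∉ H.cl (I.erase a : Finset H) := by
      by_contra! hcon
      exact haJ (hH.cl_subset hcon (hIS haI))
    have hsE : s ∉ I.erase a := fun h => hsJ (hH.mem_cl_self h)
    have h₁ : H.Indep (insert s (I.erase a) : Finset H) := by
      rw [Finset.coe_insert]
      exact hH.indep_insert (hH.indep_mono hI (by simp)) hsJ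
    have := ih (insert s (I.erase a)) (by
        rw [Finset.insert_sdiff_of_mem _ hs, Finset.erase_sdiff_comm,
          Finset.card_erase_of_mem ha, hn, Nat.add_sub_cancel]) h₁ (by
        rw [Finset.coe_insert]
        refine Set.insert_subset (hH.mem_cl_self hs) ?_
        exact (Finset.coe_subset.2 (Finset.erase_subset _ _)).trans hIS)
    rw [Finset.card_insert_of_notMem hsE, Finset.card_erase_of_mem haI] at this
    have := Finset.card_pos.2 ⟨a, haI⟩
    omega

theorem finite_of_indep (hH : H.IsPregeometry) {B F : Set H} (hB : H.Indep B) (hF : F.Finite) (h : B ⊆ H.cl F) :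
    B.Finite ∧ B.ncard ≤ F.ncard := by
  have key : ∀ t : Finset H, (t : Set H) ⊆ B → t.card ≤ F.ncard := by
    intro t ht
    rw [Set.ncard_eq_toFinset_card F hF]
    exact hH.card_le_card _ t (hH.indep_mono hB ht) (by simpa using ht.trans h)
  have hfin : B.Finite := by
    by_contra hinf
    obtain ⟨t, ht, hc⟩ := Set.Infinite.exists_subset_card_eq hinf (F.ncard + 1)
    have := key t ht
    omega
  refine ⟨hfin, ?_⟩
  rw [Set.ncard_eq_toFinset_card B hfin]
  exact key _ (by simp)

/-- A closed subset of a finitely generated closed set is finitely generated. -/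
theorem exists_finite_cl_eq (hH : H.IsPregeometry) {A F : Set H} (hA : H.IsCl A) (hF : F.Finite) (h : A ⊆ H.cl F) :
    ∃ a ⊆ A, a.Finite ∧ H.cl a = A := by
  obtain ⟨B, -, hBA, hB, hAB⟩ := hH.exists_basis hH.indep_empty (Set.empty_subset A)
  exact ⟨B, hBA, (hH.finite_of_indep hB hF (hBA.trans h)).1,
    (hH.cl_subset_of_isCl hA hBA).antisymm hAB⟩

theorem not_finGen (hH : H.IsPregeometry) {B : Set H} (hB : H.Indep B) (hinf : B.Infinite) : ¬ H.FinGen :=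
  fun ⟨_, hF, h⟩ => hinf (hH.finite_of_indep hB hF (h ▸ Set.subset_univ B)).1

/-- In dimension `n`, an independent set of size at least `n` is a basis. -/
theorem cl_eq_univ_of_ncard_le (hH : H.IsPregeometry) {B I : Set H} (hB : H.cl B = Set.univ) (hfin : B.Finite)
    (hI : H.Indep I) (hcard : B.ncard ≤ I.ncard) : H.cl I = Set.univ := by
  obtain ⟨J, hIJ, -, hJ, hJu⟩ := hH.exists_basis hI (Set.subset_univ I)
  obtain ⟨hJfin, hle⟩ := hH.finite_of_indep hJ hfin (hB ▸ Set.subset_univ J)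
  have : I = J := Set.eq_of_subset_of_ncard_le hIJ (hle.trans hcard) hJfin
  exact this ▸ Set.univ_subset_iff.1 hJu

end IsPregeometry

end ClStructure

/-! ## Back and forth -/

namespace ClStructure

/-- The back-and-forth construction. -/
theorem exists_backAndForth {H H' : Type w} (P : Set (Set (H × H'))) {f₀ : Set (H × H')}
    (h₀ : f₀ ∈ P) {D : Set H} {D' : Set H'} (hD : D.Countable) (hD' : D'.Countable)
    (forth : ∀ f ∈ P, ∀ x ∈ D, ∃ f' ∈ P, f ⊆ f' ∧ x ∈ pdom f')
    (back : ∀ f ∈ P, ∀ y ∈ D', ∃ f' ∈ P, f ⊆ f' ∧ y ∈ prange f') :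
    ∃ S ⊆ P, DirectedOn (· ⊆ ·) S ∧ f₀ ∈ S ∧ D ⊆ pdom (⋃₀ S) ∧ D' ⊆ prange (⋃₀ S) := by
  have := hD.to_subtype
  have := hD'.to_subtype
  have := Encodable.ofCountable D
  have := Encodable.ofCountable D'
  -- Each element to be covered gives a cofinal subset of `P`; there are countably many, so some
  -- ideal containing `f₀` meets them all.
  let 𝒟 : D ⊕ D' → Order.Cofinal P := Sum.elim
    (fun x => ⟨{f | x.1 ∈ pdom f.1}, fun f => by
      obtain ⟨f', hf', h, hx⟩ := forth f f.2 x x.2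
      exact ⟨⟨f', hf'⟩, hx, h⟩⟩)
    (fun y => ⟨{f | y.1 ∈ prange f.1}, fun f => by
      obtain ⟨f', hf', h, hx⟩ := back f f.2 y y.2
      exact ⟨⟨f', hf'⟩, hx, h⟩⟩)
  let I := Order.idealOfCofinals ⟨f₀, h₀⟩ 𝒟
  refine ⟨Subtype.val '' {f : P | f ∈ I}, ?_, ?_, ⟨_, Order.mem_idealOfCofinals _ 𝒟, rfl⟩,
    ?_, ?_⟩
  · rintro _ ⟨f, -, rfl⟩
    exact f.2
  · rintro _ ⟨f, hf, rfl⟩ _ ⟨g, hg, rfl⟩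
    obtain ⟨k, hk, h₁, h₂⟩ := I.directed f hf g hg
    exact ⟨k, ⟨k, hk, rfl⟩, h₁, h₂⟩
  · intro x hx
    obtain ⟨f, hf, hfI⟩ := Order.cofinal_meets_idealOfCofinals ⟨f₀, h₀⟩ 𝒟 (Sum.inl ⟨x, hx⟩)
    exact pdom_mono (Set.subset_sUnion_of_mem (Set.mem_image_of_mem Subtype.val hfI)) hf
  · intro y hy
    obtain ⟨f, hf, hfI⟩ := Order.cofinal_meets_idealOfCofinals ⟨f₀, h₀⟩ 𝒟 (Sum.inr ⟨y, hy⟩)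
    exact prange_mono (Set.subset_sUnion_of_mem (Set.mem_image_of_mem Subtype.val hfI)) hf

end ClStructure

namespace IsQuasiminimalExcellent

variable {L : FirstOrder.Language.{u, v}} {C : Set (ClStructure.{u, v, w} L)}
variable {H H' : ClStructure.{u, v, w} L}

theorem cl_countable (hC : IsQuasiminimalExcellent C) (hH : H ∈ C) {X : Set H}
    (hX : X.Countable) : (H.cl X).Countable :=
  (hC.pregeometry H hH).cl_countable (hC.ccp H hH) hX

theorem prange_subset_cl (hC : IsQuasiminimalExcellent C) (hH : H ∈ C) (hH' : H' ∈ C)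
    {f g : Set (H × H')} (hf : IsPartialEmb L f) (hgf : g ⊆ f) (h : pdom f ⊆ H.cl (pdom g)) :
    prange f ⊆ H'.cl (prange g) := by
  intro y hy
  obtain ⟨x, hxy⟩ := mem_prange.1 hy
  have := hC.cl_map H hH H' hH' f hf (pdom g) x y (pdom_mono hgf) hxy (h (mem_pdom.2 ⟨y, hxy⟩))
  refine (hC.pregeometry H' hH').mono _ _ ?_ this
  rintro z ⟨a, ha, haz⟩
  obtain ⟨z', hz'⟩ := mem_pdom.1 ha
  exact mem_prange.2 ⟨a, hf.eq_right haz (hgf hz') ▸ hz'⟩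

/-- `cl_map` applies to a partial embedding and to its inverse, so dependence is both preserved and
reflected. This is how all later extensions are kept inside the intended closures. -/
theorem mem_cl_iff (hC : IsQuasiminimalExcellent C) (hH : H ∈ C) (hH' : H' ∈ C)
    {f g : Set (H × H')} (hf : IsPartialEmb L f) (hgf : g ⊆ f) {x : H} {y : H'}
    (hxy : (x, y) ∈ f) : x ∈ H.cl (pdom g) ↔ y ∈ H'.cl (prange g) := by
  have key : ∀ {H H' : ClStructure.{u, v, w} L} (_ : H ∈ C) (_ : H' ∈ C)
      {f g : Set (H × H')} (_ : IsPartialEmb L f) (_ : g ⊆ f) {x : H} {y : H'}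
      (_ : (x, y) ∈ f), x ∈ H.cl (pdom g) → y ∈ H'.cl (prange g) := by
    intro H H' hH hH' f g hf hgf x y hxy hx
    have := hC.prange_subset_cl hH hH' (f := insert (x, y) g) (g := g)
      (hf.mono (Set.insert_subset hxy hgf)) (Set.subset_insert _ _) (by
        rw [Set.insert_eq, pdom_union, pdom_singleton]
        exact Set.union_subset (Set.singleton_subset_iff.2 hx)
          ((hC.pregeometry H hH).subset_cl _))
    exact this (mem_prange.2 ⟨x, Set.mem_insert _ _⟩)
  refine ⟨key hH hH' hf hgf hxy, fun h => ?_⟩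
  have := key hH' hH hf.pinv (g := pinv g) (pinv_subset hgf) hxy
  simp only [pdom_pinv, prange_pinv] at this
  exact this h

/-- The image of a closed set under a partial embedding with closed image is closed. -/
theorem isCl_pimage (hC : IsQuasiminimalExcellent C) (hH : H ∈ C) (hH' : H' ∈ C)
    {f : Set (H × H')} (hf : IsPartialEmb L f) (hr : H'.IsCl (prange f)) {X : Set H}
    (hX : H.IsCl X) (hXf : X ⊆ pdom f) : H'.IsCl (pimage f X) := by
  have hpre' := hC.pregeometry H' hH'
  refine hpre'.isCl_of_subset fun y hy => ?_
  obtain ⟨x, hxy⟩ := mem_prange.1 (hpre'.cl_subset_of_isCl hr pimage_subset_prange hy)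
  have := (hC.mem_cl_iff hH hH' hf (g := prestrict f X) (fun _ h => h.1) hxy).2 (prange_prestrict ▸ hy)
  rw [pdom_prestrict hXf, show H.cl X = X from hX] at this
  exact ⟨x, this, hxy⟩

/-- Back and forth over a fixed partial map `g`. -/
theorem exists_extension (hC : IsQuasiminimalExcellent C) (hH : H ∈ C) (hH' : H' ∈ C)
    {g f₀ : Set (H × H')} (hfin : f₀.Finite) (h₀ : IsPartialEmb L (g ∪ f₀))
    (hd : (pdom g).Countable) (hr : (prange g).Countable)
    (forth : ∀ f : Set (H × H'), f.Finite → IsPartialEmb L (g ∪ f) → f₀ ⊆ f →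
      pdom (g ∪ f) ⊆ H.cl (pdom (g ∪ f₀)) →
      ∀ y ∈ H.cl (pdom (g ∪ f₀)), ∃ y', IsPartialEmb L (g ∪ f ∪ {(y, y')}))
    (back : ∀ f : Set (H' × H), f.Finite → IsPartialEmb L (pinv g ∪ f) → pinv f₀ ⊆ f →
      pdom (pinv g ∪ f) ⊆ H'.cl (prange (g ∪ f₀)) →
      ∀ y ∈ H'.cl (prange (g ∪ f₀)), ∃ y', IsPartialEmb L (pinv g ∪ f ∪ {(y, y')})) :
    ∃ F, g ∪ f₀ ⊆ F ∧ IsPartialEmb L F ∧ pdom F = H.cl (pdom (g ∪ f₀)) ∧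
      prange F = H'.cl (prange (g ∪ f₀)) := by
  have hp := hC.pregeometry H hH
  have hp' := hC.pregeometry H' hH'
  have hdc : (H.cl (pdom (g ∪ f₀))).Countable := hC.cl_countable hH (by
    rw [pdom_union]; exact hd.union (hfin.image _).countable)
  have hrc : (H'.cl (prange (g ∪ f₀))).Countable := hC.cl_countable hH' (by
    rw [prange_union]; exact hr.union (hfin.image _).countable)
  let P : Set (Set (H × H')) := {f | f₀ ⊆ f ∧ f.Finite ∧ IsPartialEmb L (g ∪ f) ∧
    pdom (g ∪ f) ⊆ H.cl (pdom (g ∪ f₀)) ∧ prange (g ∪ f) ⊆ H'.cl (prange (g ∪ f₀))}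
  have hstep : ∀ f ∈ P, ∀ x y, IsPartialEmb L (g ∪ f ∪ {(x, y)}) →
      (x ∈ H.cl (pdom (g ∪ f₀)) ∨ y ∈ H'.cl (prange (g ∪ f₀))) →
      f ∪ {(x, y)} ∈ P := by
    rintro f ⟨h₁, h₂, h₃, h₄, h₅⟩ x y hxy hor
    -- One coordinate of the new pair lies in the required closure as soon as the other does, so the
    -- two closures need no separate care.
    have hiff := hC.mem_cl_iff hH hH' hxy (g := g ∪ f₀) (x := x) (y := y)
      ((Set.union_subset_union_right g h₁).trans Set.subset_union_left) (Or.inr rfl)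
    have hx : x ∈ H.cl (pdom (g ∪ f₀)) := hor.elim id hiff.2
    refine ⟨h₁.trans Set.subset_union_left, h₂.union (Set.finite_singleton _),
      by rwa [← Set.union_assoc], ?_, ?_⟩
    · rw [← Set.union_assoc, pdom_union, pdom_singleton]
      exact Set.union_subset h₄ (Set.singleton_subset_iff.2 hx)
    · rw [← Set.union_assoc, prange_union, prange_singleton]
      exact Set.union_subset h₅ (Set.singleton_subset_iff.2 (hiff.1 hx))
  obtain ⟨S, hSP, hS, h₀S, hDS, hDS'⟩ := exists_backAndForth P (f₀ := f₀)
    ⟨subset_rfl, hfin, h₀, hp.subset_cl _, hp'.subset_cl _⟩ hdc hrc (by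
      rintro f hf x hx
      obtain ⟨y, hy⟩ := forth f hf.2.1 hf.2.2.1 hf.1 hf.2.2.2.1 x hx
      exact ⟨_, hstep f hf x y hy (Or.inl hx), Set.subset_union_left,
        mem_pdom.2 ⟨y, Or.inr rfl⟩⟩) (by
      rintro f hf y hy
      obtain ⟨x, hx⟩ := back (pinv f) (by rw [pinv_eq_image]; exact hf.2.1.image _)
        (by rw [← pinv_union]; exact hf.2.2.1.pinv) (pinv_subset hf.1)
        (by rw [← pinv_union, pdom_pinv]; exact hf.2.2.2.2) y hy
      rw [← pinv_union, ← pinv_singleton, ← pinv_union, isPartialEmb_pinv] at hx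
      exact ⟨_, hstep f hf x y hx (Or.inr hy), Set.subset_union_left,
        mem_prange.2 ⟨x, Or.inr rfl⟩⟩)
  have hF : g ∪ ⋃₀ S = ⋃₀ ((g ∪ ·) '' S) := by
    ext p
    simp only [Set.mem_union, Set.mem_sUnion, Set.mem_image, exists_exists_and_eq_and]
    constructor
    · rintro (h | ⟨f, hf, h⟩)
      · exact ⟨f₀, h₀S, Or.inl h⟩
      · exact ⟨f, hf, Or.inr h⟩
    · rintro ⟨f, hf, h | h⟩
      · exact Or.inl h
      · exact Or.inr ⟨f, hf, h⟩
  refine ⟨g ∪ ⋃₀ S, Set.union_subset_union_right g (Set.subset_sUnion_of_mem h₀S), ?_, ?_, ?_⟩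
  · rw [hF]
    refine isPartialEmb_sUnion ?_ ?_
    · rintro _ ⟨f, hf, rfl⟩ _ ⟨f', hf', rfl⟩
      obtain ⟨k, hk, h₁, h₂⟩ := hS f hf f' hf'
      exact ⟨_, ⟨k, hk, rfl⟩, Set.union_subset_union_right g h₁,
        Set.union_subset_union_right g h₂⟩
    · rintro _ ⟨f, hf, rfl⟩
      exact (hSP hf).2.2.1
  · refine Set.Subset.antisymm ?_ (hDS.trans (pdom_mono Set.subset_union_right))
    rw [hF]
    rintro x hx
    obtain ⟨y, _, ⟨f, hf, rfl⟩, hxy⟩ := mem_pdom.1 hx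
    exact (hSP hf).2.2.2.1 (mem_pdom.2 ⟨y, hxy⟩)
  · refine Set.Subset.antisymm ?_ (hDS'.trans (prange_mono Set.subset_union_right))
    rw [hF]
    rintro x hx
    obtain ⟨y, _, ⟨f, hf, rfl⟩, hxy⟩ := mem_prange.1 hx
    exact (hSP hf).2.2.2.2 (mem_prange.2 ⟨y, hxy⟩)

/-- Extension to the closure over a countable closed set (or the empty set) and a finite set. -/
theorem exists_extension_of_finite (hC : IsQuasiminimalExcellent C) (hH : H ∈ C) (hH' : H' ∈ C)
    {g f₀ : Set (H × H')} (hd : (pdom g).Countable ∧ H.IsCl (pdom g) ∨ g = ∅)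
    (hr : (prange g).Countable ∧ H'.IsCl (prange g) ∨ g = ∅) (hfin : f₀.Finite)
    (h₀ : IsPartialEmb L (g ∪ f₀)) :
    ∃ F, g ∪ f₀ ⊆ F ∧ IsPartialEmb L F ∧ pdom F = H.cl (pdom (g ∪ f₀)) ∧
      prange F = H'.cl (prange (g ∪ f₀)) := by
  have hd' : (pdom g).Countable ∧ H.IsCl (pdom g) ∨ pdom g = ∅ :=
    hd.imp_right fun h => by simp [h]
  have hr' : (prange g).Countable ∧ H'.IsCl (prange g) ∨ prange g = ∅ :=
    hr.imp_right fun h => by simp [h]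
  have hg : IsPartialEmb L g := h₀.mono Set.subset_union_left
  refine hC.exists_extension hH hH' hfin h₀ ?_ ?_ ?_ ?_
  · exact hd'.elim (fun h => h.1) fun h => by simp [h]
  · exact hr'.elim (fun h => h.1) fun h => by simp [h]
  · intro f hf hgf hff _ y hy
    refine hC.homogeneity_closure H hH H' hH' _ _ g hd' hr' hg rfl pimage_pdom f (hf.image _)
      hgf y ((hC.pregeometry H hH).mono _ _ ?_ hy)
    rw [pdom_union, Set.union_comm]
    exact Set.union_subset_union_left _ (pdom_mono hff)
  · intro f hf hgf hff _ y hy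
    refine hC.homogeneity_closure H' hH' H hH _ _ (pinv g) (by simpa using hr')
      (by simpa using hd') hg.pinv rfl pimage_pdom f (hf.image _) hgf y
      ((hC.pregeometry H' hH').mono _ _ ?_ hy)
    rw [prange_union, Set.union_comm, pdom_pinv, ← pdom_pinv (f := f₀)]
    exact Set.union_subset_union_left _ (pdom_mono hff)

/-- By `excellence`, compatibility of a map on `pdom f ∪ {y}` with all of `g` is already decided on
a finite part `K₀` of the crown. Thus only a finite map has to be extended to `y`, which
`homogeneity_closure` does over the empty set, once a finite set `Y` spanning `y` is included. -/
theorem exists_extension_of_crown_aux (hC : IsQuasiminimalExcellent C) (hH : H ∈ C)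
    (hH' : H' ∈ C) {g : Set (H × H')} (hg : IsClosedPartialEmb g) (hd : (pdom g).Countable)
    (hdc : H.IsCrown (pdom g)) :
    ∀ f : Set (H × H'), f.Finite → IsPartialEmb L (g ∪ f) → pdom f ⊆ H.cl (pdom g) →
      ∀ y ∈ H.cl (pdom g), ∃ y', IsPartialEmb L (g ∪ f ∪ {(y, y')}) := by
  intro f hf hgf hfd y hy
  have hp := hC.pregeometry H hH
  obtain ⟨K₀, hK₀, hK₀f, h⟩ := hC.excellence H hH H' hH' (pdom g) hd hdc g hg rfl
    (pdom f ∪ {y}) ((hf.image _).union (Set.finite_singleton y))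
    (Set.union_subset hfd (Set.singleton_subset_iff.2 hy))
  obtain ⟨Y, hY, hYf, hyY⟩ := hp.finite_char _ _ hy
  have hZ : prestrict g (K₀ ∪ Y) ⊆ g := fun _ h => h.1
  obtain ⟨y', hy'⟩ := hC.homogeneity_closure H hH H' hH' ∅ ∅ ∅ (Or.inr rfl) (Or.inr rfl)
    isPartialEmb_empty pdom_empty (by ext; simp) (f ∪ prestrict g (K₀ ∪ Y))
    (((hf.union (hg.1.prestrict_finite (hK₀f.union hYf)))).image _) (by
      rw [Set.empty_union]
      exact hgf.mono (Set.union_subset Set.subset_union_right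
        (hZ.trans Set.subset_union_left))) y (by
      refine hp.mono _ _ ?_ hyY
      intro z hz
      obtain ⟨z', hz'⟩ := mem_pdom.1 (hY hz)
      exact Or.inl (mem_pdom.2 ⟨z', Or.inr ⟨hz', Or.inr hz⟩⟩))
  refine ⟨y', (h (f ∪ {(y, y')}) (by rw [pdom_union, pdom_singleton]) (hy'.mono ?_)).mono ?_⟩
  · rintro p ((hp | hp) | hp)
    · exact Or.inl (Or.inr (Or.inl hp))
    · exact Or.inr hp
    · exact Or.inl (Or.inr (Or.inr ⟨hp.1, Or.inl hp.2⟩))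
  · rintro p ((hp | hp) | hp)
    · exact Or.inr hp
    · exact Or.inl (Or.inl hp)
    · exact Or.inl (Or.inr hp)

/-- A closed isomorphism of countable crowns extends to the closures. -/
theorem exists_extension_of_crown (hC : IsQuasiminimalExcellent C) (hH : H ∈ C) (hH' : H' ∈ C)
    {g : Set (H × H')} (hg : IsClosedPartialEmb g) (hg' : IsClosedPartialEmb (pinv g))
    (hd : (pdom g).Countable) (hr : (prange g).Countable) (hdc : H.IsCrown (pdom g))
    (hrc : H'.IsCrown (prange g)) :
    ∃ F, g ⊆ F ∧ IsPartialEmb L F ∧ pdom F = H.cl (pdom g) ∧ prange F = H'.cl (prange g) := by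
  obtain ⟨F, hgF, hF⟩ := hC.exists_extension hH hH' (g := g) (f₀ := ∅) Set.finite_empty
    (by simpa using hg.1) hd hr (by
      intro f hf hgf _ hfd y hy
      rw [Set.union_empty] at hfd hy
      exact hC.exists_extension_of_crown_aux hH hH' hg hd hdc f hf hgf
        ((pdom_mono Set.subset_union_right).trans hfd) y hy) (by
      intro f hf hgf _ hfd y hy
      rw [Set.union_empty, ← pdom_pinv] at hfd hy
      exact hC.exists_extension_of_crown_aux hH' hH hg' (by rwa [pdom_pinv])
        (by rwa [pdom_pinv]) f hf hgf ((pdom_mono Set.subset_union_right).trans hfd) y hy)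
  rw [Set.union_empty] at hgF hF
  exact ⟨F, hgF, hF⟩

end IsQuasiminimalExcellent

/-! ## Isomorphisms extending bijections of independent families -/

namespace ClStructure

variable {L : FirstOrder.Language.{u, v}} {H H' : ClStructure.{u, v, w} L} {I : Type*}

/-- `f` is an isomorphism of the closures of `b '' S` and `b' '' S` which maps `b` to `b'`. -/
structure IsIsoOn (b : I → H) (b' : I → H') (S : Set I) (f : Set (H × H')) : Prop where
  emb : IsPartialEmb L f
  dom : pdom f = H.cl (b '' S)
  ran : prange f = H'.cl (b' '' S)
  mem : ∀ i ∈ S, (b i, b' i) ∈ f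

theorem IsIsoOn.pinv {b : I → H} {b' : I → H'} {S : Set I} {f : Set (H × H')}
    (h : IsIsoOn b b' S f) : IsIsoOn b' b S (pinv f) :=
  ⟨h.emb.pinv, by rw [pdom_pinv, h.ran], by rw [prange_pinv, h.dom], h.mem⟩

/-- The index set can be read off from the map. This supplies the function `T` that `isIsoOn_sUnion`
asks for. -/
theorem IsIsoOn.setOf_mem {b : I → H} {b' : I → H'} {S : Set I} {f : Set (H × H')}
    (h : IsIsoOn b b' S f) (hp : H.IsPregeometry) (hp' : H'.IsPregeometry) :
    IsIsoOn b b' {i | (b i, b' i) ∈ f} f := by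
  refine ⟨h.emb, ?_, ?_, fun _ hi => hi⟩
  · rw [h.dom]
    refine (hp.mono _ _ (Set.image_mono h.mem)).antisymm (hp.cl_subset ?_)
    rintro _ ⟨i, hi, rfl⟩
    exact h.dom ▸ mem_pdom.2 ⟨_, hi⟩
  · rw [h.ran]
    refine (hp'.mono _ _ (Set.image_mono h.mem)).antisymm (hp'.cl_subset ?_)
    rintro _ ⟨i, hi, rfl⟩
    exact h.ran ▸ mem_prange.2 ⟨_, hi⟩

end ClStructure

namespace IsQuasiminimalExcellent

variable {L : FirstOrder.Language.{u, v}} {C : Set (ClStructure.{u, v, w} L)}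
variable {H H' : ClStructure.{u, v, w} L} {I : Type*}

theorem exists_isIsoOn_empty (hC : IsQuasiminimalExcellent C) (hH : H ∈ C) (hH' : H' ∈ C)
    (b : I → H) (b' : I → H') : ∃ F, IsIsoOn b b' ∅ F := by
  obtain ⟨F, -, h₁, h₂, h₃⟩ := hC.exists_extension_of_finite hH hH' (g := ∅) (f₀ := ∅)
    (Or.inr rfl) (Or.inr rfl) Set.finite_empty (by simpa using isPartialEmb_empty)
  exact ⟨F, h₁, by simpa using h₂, by simpa using h₃, fun i hi => hi.elim⟩

/-- By independence the new elements are generic over the domain and the image, so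
`homogeneity_generic` adds the pair; `homogeneity_closure` in both directions then fills up the
closures. -/
theorem exists_isIsoOn_insert (hC : IsQuasiminimalExcellent C) (hH : H ∈ C) (hH' : H' ∈ C)
    {b : I → H} {b' : I → H'} (hb : FamIndep b) (hb' : FamIndep b') {S : Set I}
    (hS : S.Countable) {f : Set (H × H')} (hf : IsIsoOn b b' S f) {i : I} (hi : i ∉ S) :
    ∃ F, f ⊆ F ∧ IsIsoOn b b' (insert i S) F := by
  have hp := hC.pregeometry H hH
  have hp' := hC.pregeometry H' hH'
  have hd : (pdom f).Countable ∧ H.IsCl (pdom f) :=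
    ⟨hf.dom ▸ hC.cl_countable hH (hS.image _), hf.dom ▸ hp.isCl_cl _⟩
  have hr : (prange f).Countable ∧ H'.IsCl (prange f) :=
    ⟨hf.ran ▸ hC.cl_countable hH' (hS.image _), hf.ran ▸ hp'.isCl_cl _⟩
  have h₁ : IsPartialEmb L (f ∪ {(b i, b' i)}) :=
    hC.homogeneity_generic H hH H' hH' _ _ f (Or.inl hd) (Or.inl hr) hf.emb rfl pimage_pdom _ _
      (by rw [hf.dom, hp.idem]; exact hp.notMem_cl_image hb hi)
      (by rw [hf.ran, hp'.idem]; exact hp'.notMem_cl_image hb' hi)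
  obtain ⟨F, hF, hFe, hFd, hFr⟩ := hC.exists_extension_of_finite hH hH' (Or.inl hd) (Or.inl hr)
    (Set.finite_singleton _) h₁
  have key : ∀ {H : ClStructure.{u, v, w} L} (_ : H.IsPregeometry) (c : I → H),
      H.cl (H.cl (c '' S) ∪ {c i}) = H.cl (c '' insert i S) := by
    intro H hp c
    rw [Set.image_insert_eq]
    refine Set.Subset.antisymm (hp.cl_subset (Set.union_subset (hp.mono _ _
      (Set.subset_insert _ _)) (Set.singleton_subset_iff.2
      (hp.mem_cl_self (Set.mem_insert _ _))))) (hp.mono _ _ ?_)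
    rw [Set.insert_eq, Set.union_comm]
    exact Set.union_subset_union_left _ (hp.subset_cl _)
  refine ⟨F, Set.subset_union_left.trans hF, hFe, ?_, ?_, ?_⟩
  · rw [hFd, pdom_union, pdom_singleton, hf.dom, key hp]
  · rw [hFr, prange_union, prange_singleton, hf.ran, key hp']
  · rintro j (rfl | hj)
    · exact hF (Or.inr rfl)
    · exact hF (Or.inl (hf.mem j hj))

/-- By finite character the closure of a directed union is the union of the closures. The image is
handled by the same argument for the inverse maps. -/
theorem isIsoOn_sUnion (hC : IsQuasiminimalExcellent C) (hH : H ∈ C) (hH' : H' ∈ C)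
    {b : I → H} {b' : I → H'} {c : Set (Set (H × H'))} (hc : DirectedOn (· ⊆ ·) c)
    (hne : c.Nonempty) (T : Set (H × H') → Set I) (h : ∀ f ∈ c, IsIsoOn b b' (T f) f) :
    IsIsoOn b b' (⋃ f ∈ c, T f) (⋃₀ c) := by
  have key : ∀ {H H' : ClStructure.{u, v, w} L} (_ : H ∈ C) (b : I → H) (b' : I → H')
      {c : Set (Set (H × H'))} (_ : DirectedOn (· ⊆ ·) c) (_ : c.Nonempty)
      (T : Set (H × H') → Set I) (_ : ∀ f ∈ c, IsIsoOn b b' (T f) f),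
      pdom (⋃₀ c) = H.cl (b '' ⋃ f ∈ c, T f) := by
    intro H H' hH b b' c hc hne T h
    have hp := hC.pregeometry H hH
    refine Set.Subset.antisymm ?_ ?_
    · intro x hx
      obtain ⟨y, f, hf, hxy⟩ := mem_pdom.1 hx
      have : x ∈ pdom f := mem_pdom.2 ⟨y, hxy⟩
      rw [(h f hf).dom] at this
      exact hp.mono _ _ (Set.image_mono (Set.subset_biUnion_of_mem hf)) this
    · intro x hx
      have hsub : b '' ⋃ f ∈ c, T f ⊆ ⋃₀ (pdom '' c) := by
        rintro _ ⟨i, hi, rfl⟩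
        obtain ⟨f, hf, hif⟩ := Set.mem_iUnion₂.1 hi
        exact ⟨_, ⟨f, hf, rfl⟩, mem_pdom.2 ⟨_, (h f hf).mem i hif⟩⟩
      obtain ⟨_, ⟨f, hf, rfl⟩, hxf⟩ := hp.exists_mem_cl_of_directedOn (hne.image pdom)
        (by
          rintro _ ⟨f, hf, rfl⟩ _ ⟨g, hg, rfl⟩
          obtain ⟨k, hk, h₁, h₂⟩ := hc f hf g hg
          exact ⟨_, ⟨k, hk, rfl⟩, pdom_mono h₁, pdom_mono h₂⟩) (hp.mono _ _ hsub hx)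
      rw [(h f hf).dom, hp.idem, ← (h f hf).dom] at hxf
      exact pdom_mono (Set.subset_sUnion_of_mem hf) hxf
  refine ⟨isPartialEmb_sUnion hc fun f hf => (h f hf).emb, key hH b b' hc hne T h, ?_, ?_⟩
  · have hc' : DirectedOn (· ⊆ ·) (pinv '' c) := by
      rintro _ ⟨f, hf, rfl⟩ _ ⟨g, hg, rfl⟩
      obtain ⟨k, hk, h₁, h₂⟩ := hc f hf g hg
      exact ⟨_, ⟨k, hk, rfl⟩, pinv_subset h₁, pinv_subset h₂⟩
    have := key hH' b' b hc' (hne.image _) (fun f => T (pinv f)) (by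
      rintro _ ⟨f, hf, rfl⟩
      exact (h f hf).pinv)
    rw [Set.biUnion_image] at this
    simp only [pinv_pinv] at this
    rw [← this, ← pdom_pinv]
    congr 1
    ext ⟨y, x⟩
    simp
  · intro i hi
    obtain ⟨f, hf, hif⟩ := Set.mem_iUnion₂.1 hi
    exact ⟨f, hf, (h f hf).mem i hif⟩

/-- A bijection of countable independent families extends to their closures. -/
theorem exists_isIsoOn_of_countable (hC : IsQuasiminimalExcellent C) (hH : H ∈ C) (hH' : H' ∈ C)
    {b : I → H} {b' : I → H'} (hb : FamIndep b) (hb' : FamIndep b') {S : Set I}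
    (hS : S.Countable) : ∃ F, IsIsoOn b b' S F := by
  obtain ⟨F₀, hF₀⟩ := hC.exists_isIsoOn_empty hH hH' b b'
  obtain ⟨F, -, hF⟩ := zorn_subset_nonempty {f | ∃ T ⊆ S, IsIsoOn b b' T f} (by
    intro c hc hch hne
    choose! T hTS hT using hc
    exact ⟨⋃₀ c, ⟨_, Set.iUnion₂_subset hTS, hC.isIsoOn_sUnion hH hH' hch.directedOn hne T hT⟩,
      fun s hs => Set.subset_sUnion_of_mem hs⟩) F₀ ⟨∅, Set.empty_subset _, hF₀⟩
  obtain ⟨T, hTS, hT⟩ := hF.prop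
  have : T = S := by
    refine hTS.antisymm fun i hi => ?_
    by_contra hiT
    -- By maximality the extension is `F` itself, which puts `b i` in the closure of `b '' T`,
    -- against independence.
    obtain ⟨F', hFF', hF'⟩ := hC.exists_isIsoOn_insert hH hH' hb hb' (hS.mono hTS) hT hiT
    have := hF.eq_of_subset ⟨_, Set.insert_subset hi hTS, hF'⟩ hFF'
    subst this
    have h₁ := mem_pdom.2 ⟨_, hF'.mem i (Set.mem_insert _ _)⟩
    rw [hT.dom] at h₁
    exact (hC.pregeometry H hH).notMem_cl_image hb hiT h₁
  exact ⟨F, this ▸ hT⟩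

/-- A partial embedding which is a finite union of isomorphisms between closed sets is closed. -/
theorem isClosedPartialEmb_iUnion (hC : IsQuasiminimalExcellent C) (hH : H ∈ C) (hH' : H' ∈ C)
    {ι : Type*} [Finite ι] {f : ι → Set (H × H')} (hf : IsPartialEmb L (⋃ i, f i))
    (hd : ∀ i, H.IsCl (pdom (f i))) (hr : ∀ i, H'.IsCl (prange (f i))) :
    IsClosedPartialEmb (⋃ i, f i) := by
  have hp := hC.pregeometry H hH
  have hp' := hC.pregeometry H' hH'
  refine ⟨hf, fun X hX hXcl => hp'.isCl_of_subset fun y hy => ?_⟩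
  obtain ⟨Y, hYX, hY, hyY⟩ := hp'.finite_char _ _ hy
  obtain ⟨c, hcX, hc, hYc⟩ := exists_finite_subset_pimage hY hYX
  have hAX : H.cl c ⊆ X := hp.cl_subset_of_isCl hXcl hcX
  -- Each domain meets `H.cl c` in a closed set, which is spanned by a finite set `a i` because `c`
  -- is finite. As there are finitely many domains, one finite set `d` controls all of these
  -- intersections.
  have hAi : ∀ i, H.IsCl (H.cl c ∩ pdom (f i)) := fun i => hp.isCl_inter (hp.isCl_cl c) (hd i)
  choose a haA hafin hacl using fun i =>
    hp.exists_finite_cl_eq (hAi i) hc Set.inter_subset_left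
  let d := c ∪ ⋃ i, a i
  have hdc : d ⊆ H.cl c := Set.union_subset (hp.subset_cl c)
    (Set.iUnion_subset fun i => (haA i).trans Set.inter_subset_left)
  have hdfin : d.Finite := hc.union (Set.finite_iUnion hafin)
  have hdU : d ⊆ pdom (⋃ i, f i) := hdc.trans (hAX.trans hX)
  let f₀ := prestrict (⋃ i, f i) d
  have hf₀ : IsPartialEmb L f₀ := hf.mono fun _ h => h.1
  -- `y` is pulled back along the inverse of the restriction to `d`. The aim is not that `(z, y)`
  -- lies in the given map, but that `z` shows on which image `y` depends.
  obtain ⟨z, hz⟩ := hC.homogeneity_closure H' hH' H hH ∅ ∅ ∅ (Or.inr rfl) (Or.inr rfl)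
    isPartialEmb_empty pdom_empty (by ext; simp) (pinv f₀) (by
      rw [pdom_pinv]; exact (hf.prestrict_finite hdfin).image _) (by
      rw [Set.empty_union]; exact hf₀.pinv) y (by
      rw [pdom_pinv, Set.union_empty, prange_prestrict]
      exact hp'.mono _ _ (hYc.trans (pimage_mono subset_rfl Set.subset_union_left)) hyY)
  rw [Set.empty_union, ← pinv_singleton, ← pinv_union, isPartialEmb_pinv] at hz
  have hzA : z ∈ H.cl c := by
    have := (hC.mem_cl_iff hH hH' hz (g := f₀) Set.subset_union_left (Or.inr rfl)).2 (by
      rw [prange_prestrict]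
      exact hp'.mono _ _ (hYc.trans (pimage_mono subset_rfl Set.subset_union_left)) hyY)
    rw [pdom_prestrict hdU] at this
    exact hp.cl_subset hdc this
  -- Since `z` lies in some domain `pdom (f i)`, it depends on `a i`. Hence `y` depends on the image
  -- of `a i`, and so belongs to the closed image of `H.cl c ∩ pdom (f i)`.
  obtain ⟨y', hy'⟩ := mem_pdom.1 (hX (hAX hzA))
  obtain ⟨i, hi⟩ := Set.mem_iUnion.1 hy'
  have hzi : z ∈ H.cl (a i) := by
    rw [hacl]; exact ⟨hzA, mem_pdom.2 ⟨y', hi⟩⟩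
  have had : a i ⊆ pdom (f i) := (haA i).trans Set.inter_subset_right
  have hyi := (hC.mem_cl_iff hH hH' hz (g := prestrict (f i) (a i))
    (fun p hp => Or.inl ⟨Set.mem_iUnion.2 ⟨i, hp.1⟩, Or.inr (Set.mem_iUnion.2 ⟨i, hp.2⟩)⟩)
    (Or.inr rfl)).1 (by rwa [pdom_prestrict had])
  rw [prange_prestrict] at hyi
  have hcl := hC.isCl_pimage hH hH' (hf.mono (Set.subset_iUnion f i)) (hr i) (hAi i)
    Set.inter_subset_right
  exact pimage_mono (Set.subset_iUnion f i) (Set.inter_subset_left.trans hAX)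
    (hp'.cl_subset_of_isCl hcl (pimage_mono subset_rfl (haA i)) hyi)

end IsQuasiminimalExcellent

/-! ### Index sets with a countable reserve, and coherent isomorphisms over finite sets -/

namespace ClStructure

variable {L : FirstOrder.Language.{u, v}} {J : Type*}

/-- The indices in `ℕ ⊕ J` whose second component, if present, is in `X`. -/
def idx (X : Finset J) : Set (ℕ ⊕ J) := {i | ∀ j, i = Sum.inr j → j ∈ X}

/-- The indices in `idx X` whose first component, if present, is less than `m`. -/
def idxLT (m : ℕ) (X : Finset J) : Set (ℕ ⊕ J) :=
  {i | (∀ n, i = Sum.inl n → n < m) ∧ ∀ j, i = Sum.inr j → j ∈ X}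

@[simp] theorem inl_mem_idx {X : Finset J} {n : ℕ} : Sum.inl n ∈ idx X := by simp [idx]

@[simp] theorem inr_mem_idx {X : Finset J} {j : J} : Sum.inr j ∈ idx X ↔ j ∈ X := by simp [idx]

@[simp] theorem inl_mem_idxLT {m : ℕ} {X : Finset J} {n : ℕ} :
    Sum.inl n ∈ idxLT m X ↔ n < m := by simp [idxLT]

@[simp] theorem inr_mem_idxLT {m : ℕ} {X : Finset J} {j : J} :
    Sum.inr j ∈ idxLT m X ↔ j ∈ X := by simp [idxLT]

theorem idx_mono {X Y : Finset J} (h : X ⊆ Y) : idx X ⊆ idx Y := fun _ hi j hj => h (hi j hj)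

theorem idxLT_mono {m n : ℕ} (h : m ≤ n) (X : Finset J) : idxLT m X ⊆ idxLT n X :=
  fun _ hi => ⟨fun k hk => (hi.1 k hk).trans_le h, hi.2⟩

theorem idx_countable (X : Finset J) : (idx X).Countable := by
  refine ((Set.countable_range Sum.inl).union (X.countable_toSet.image Sum.inr)).mono ?_
  rintro (n | j) h
  · exact Or.inl ⟨n, rfl⟩
  · exact Or.inr ⟨j, inr_mem_idx.1 h, rfl⟩

theorem idxLT_finite (m : ℕ) (X : Finset J) : (idxLT m X).Finite := by
  refine (((Set.finite_lt_nat m).image Sum.inl).union (X.finite_toSet.image Sum.inr)).subset ?_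
  rintro (n | j) h
  · exact Or.inl ⟨n, inl_mem_idxLT.1 h, rfl⟩
  · exact Or.inr ⟨j, inr_mem_idxLT.1 h, rfl⟩

theorem IsPregeometry.exists_mem_cl_idxLT {H : ClStructure.{u, v, w} L} (hp : H.IsPregeometry)
    (b : ℕ ⊕ J → H) (X : Finset J) {a : H} (ha : a ∈ H.cl (b '' idx X)) :
    ∃ m, ∀ n ≥ m, a ∈ H.cl (b '' idxLT n X) := by
  have hsub : b '' idx X ⊆ ⋃₀ Set.range fun n => b '' idxLT n X := by
    rintro _ ⟨n | j, hi, rfl⟩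
    · exact ⟨_, ⟨n + 1, rfl⟩, Set.mem_image_of_mem b (by simp)⟩
    · exact ⟨_, ⟨0, rfl⟩, Set.mem_image_of_mem b (by simpa using hi)⟩
  obtain ⟨_, ⟨m, rfl⟩, hm⟩ := hp.exists_mem_cl_of_directedOn (Set.range_nonempty _) (by
    rintro _ ⟨m, rfl⟩ _ ⟨n, rfl⟩
    exact ⟨_, ⟨max m n, rfl⟩, Set.image_mono (idxLT_mono (le_max_left _ _) X),
      Set.image_mono (idxLT_mono (le_max_right _ _) X)⟩) (hp.mono _ _ hsub ha)
  exact ⟨m, fun n hn => hp.mono _ _ (Set.image_mono (idxLT_mono hn X)) hm⟩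

end ClStructure

namespace IsQuasiminimalExcellent

variable {L : FirstOrder.Language.{u, v}} {C : Set (ClStructure.{u, v, w} L)}
variable {H H' : ClStructure.{u, v, w} L} {J : Type*}

/-- An automorphism `τ` of the closure of a face which fixes the closures of its intersections with
the other faces is, together with the identity of the other faces, a partial embedding. -/
theorem isPartialEmb_pid_union [DecidableEq J] (hC : IsQuasiminimalExcellent C) (hH : H ∈ C)
    {b : ℕ ⊕ J → H} (hb : FamIndep b) {X S : Finset J} {x : J} (hx : x ∈ X)
    (hxS : x ∉ S) {τ : Set (H × H)} (hτ : IsPartialEmb L τ)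
    (hτd : pdom τ ⊆ H.cl (b '' idx (X.erase x))) (hτr : prange τ ⊆ H.cl (b '' idx (X.erase x)))
    (hfix : ∀ y ∈ S, ∀ e ∈ H.cl (b '' idx ((X.erase y).erase x)), (e, e) ∈ τ) :
    IsPartialEmb L (pid (⋃ y ∈ S, H.cl (b '' idx (X.erase y))) ∪ τ) := by
  have hp := hC.pregeometry H hH
  refine isPartialEmb_of_finite fun s hs hsfin => ?_
  -- Finitely many pairs involve only finitely many indices of the reserve `ℕ`, so some `n` beyond
  -- them remains unused.
  have hloc : ∀ p ∈ s, ∃ m, ∀ n ≥ m,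
      (p.1 = p.2 ∧ ∃ y ∈ S, p.1 ∈ H.cl (b '' idxLT n (X.erase y))) ∨
      (p ∈ τ ∧ p.1 ∈ H.cl (b '' idxLT n (X.erase x)) ∧
        p.2 ∈ H.cl (b '' idxLT n (X.erase x))) := by
    rintro ⟨c, d⟩ hcd
    rcases hs hcd with ⟨h', h⟩ | h
    · obtain ⟨y, hy, hc⟩ := Set.mem_iUnion₂.1 h
      obtain ⟨m, hm⟩ := hp.exists_mem_cl_idxLT b _ hc
      exact ⟨m, fun n hn => Or.inl ⟨h', y, hy, hm n hn⟩⟩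
    · obtain ⟨m, hm⟩ := hp.exists_mem_cl_idxLT b _ (hτd (mem_pdom.2 ⟨d, h⟩))
      obtain ⟨m', hm'⟩ := hp.exists_mem_cl_idxLT b _ (hτr (mem_prange.2 ⟨c, h⟩))
      exact ⟨max m m', fun n hn => Or.inr ⟨h, hm n (le_of_max_le_left hn),
        hm' n (le_of_max_le_right hn)⟩⟩
  choose! m hm using hloc
  obtain ⟨n, hn⟩ := (hsfin.image m).bddAbove
  replace hm : ∀ p ∈ s, _ := fun p hp => hm p hp n (hn ⟨p, hp, rfl⟩)
  have hGc : (H.cl (b '' idxLT n (X.erase x))).Countable :=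
    hC.cl_countable hH ((idxLT_finite _ _).image _).countable
  have hGcl := hp.isCl_cl (b '' idxLT n (X.erase x))
  -- The elements with indices `x` and `n` are both generic over the closure of the part of the face
  -- `X \ {x}` below `n`. So some `ρ` fixes that closure pointwise and moves the first element to
  -- the second.
  have h₁ : IsPartialEmb L (pid (H.cl (b '' idxLT n (X.erase x))) ∪
      {(b (Sum.inr x), b (Sum.inl n))}) :=
    hC.homogeneity_generic H hH H hH _ _ _ (Or.inl ⟨hGc, hGcl⟩) (Or.inl ⟨hGc, hGcl⟩)
      (isPartialEmb_pid _) pdom_pid (by simpa using pimage_pdom (f := pid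
        (H.cl (b '' idxLT n (X.erase x))))) _ _
      (by rw [hp.idem]; exact hp.notMem_cl_image hb (by simp))
      (by rw [hp.idem]; exact hp.notMem_cl_image hb (by simp))
  obtain ⟨ρ, hρ, hρe, hρd, -⟩ := hC.exists_extension_of_finite hH hH
    (g := pid (H.cl (b '' idxLT n (X.erase x)))) (by simpa using Or.inl ⟨hGc, hGcl⟩)
    (by simpa using Or.inl ⟨hGc, hGcl⟩) (Set.finite_singleton _) h₁
  have hρid : ∀ c ∈ H.cl (b '' idxLT n (X.erase x)), (c, c) ∈ ρ :=
    fun c hc => hρ (Or.inl ⟨rfl, hc⟩)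
  have hρx : (b (Sum.inr x), b (Sum.inl n)) ∈ ρ := hρ (Or.inr rfl)
  -- The finite map is contained in `τ` conjugated by `ρ`. Points of a face missing `y` are moved by
  -- `ρ` into the closure for `X \ {x, y}`, where `τ` is the identity; on the pairs from `τ`, `ρ` is
  -- the identity at both coordinates.
  refine (hρe.pcomp (hτ.pcomp hρe.pinv)).mono ?_
  rintro ⟨c, d⟩ hcd
  rcases hm _ hcd with ⟨h, y, hy, hc⟩ | ⟨h, hc, hd⟩
  · obtain rfl : c = d := h
    have hyx : x ≠ y := fun h => hxS (h ▸ hy)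
    -- the generators of the closure containing `c`, and their images
    let B := b '' idxLT n (X.erase y)
    have hBρ : ∀ e ∈ B, ∃ e' ∈ b '' idx ((X.erase y).erase x), (e, e') ∈ ρ := by
      rintro _ ⟨k | j, hk, rfl⟩
      · exact ⟨_, ⟨Sum.inl k, by simp, rfl⟩, hρid _ (hp.mem_cl_self
          ⟨Sum.inl k, by simpa using hk, rfl⟩)⟩
      · rcases eq_or_ne j x with rfl | hjx
        · exact ⟨_, ⟨Sum.inl n, by simp, rfl⟩, hρx⟩
        · have hj : j ≠ y ∧ j ∈ X := by simpa using hk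
          exact ⟨_, ⟨Sum.inr j, by simp [hjx, hj], rfl⟩, hρid _ (hp.mem_cl_self
            ⟨Sum.inr j, by simp [hjx, hj], rfl⟩)⟩
    have hBd : B ⊆ pdom ρ := fun e he => by
      obtain ⟨e', -, h⟩ := hBρ e he
      exact mem_pdom.2 ⟨e', h⟩
    have hcρ : c ∈ pdom ρ := by
      rw [hρd] at hBd ⊢
      exact hp.cl_subset hBd hc
    obtain ⟨c', hc'⟩ := mem_pdom.1 hcρ
    have hc'cl : c' ∈ H.cl (b '' idx ((X.erase y).erase x)) := by
      refine hp.mono _ _ ?_ (hC.cl_map H hH H hH ρ hρe B c c' hBd hc' hc)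
      rintro e' ⟨e, he, hee'⟩
      obtain ⟨e'', he'', h⟩ := hBρ e he
      rwa [hρe.eq_right hee' h]
    exact ⟨c', hc', c', hfix y hy c' hc'cl, hc'⟩
  · exact ⟨c, hρid c hc, d, h, hρid d hd⟩

theorem isCrown_iUnion [DecidableEq J] (hp : H.IsPregeometry) {b : ℕ ⊕ J → H}
    (hb : FamIndep b) (X S : Finset J) :
    H.IsCrown (⋃ y : S, H.cl (b '' idx (X.erase y.1))) := by
  refine ⟨Set.range b, S.card, fun i => b '' idx (X.erase (S.equivFin.symm i).1),
    hp.famIndep_indep hb, fun i => Set.image_subset_range _ _, ?_⟩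
  exact (S.equivFin.symm.surjective.iUnion_comp
    fun y : S => H.cl (b '' idx (X.erase y.1))).symm

/-- Induction on the set `S` of faces to be extended simultaneously. For a single face it suffices
to adjoin the missing vertex. To add a face, one shows that the union of the face maps is a partial
embedding and then extends it by `exists_extension_of_crown`. -/
theorem exists_isIsoOn_faces [DecidableEq J] (hC : IsQuasiminimalExcellent C) (hH : H ∈ C)
    (hH' : H' ∈ C) {b : ℕ ⊕ J → H} {b' : ℕ ⊕ J → H'} (hb : FamIndep b) (hb' : FamIndep b')
    {X : Finset J} (f : Finset J → Set (H × H')) (hf : ∀ Y ⊂ X, IsIsoOn b b' (idx Y) (f Y))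
    (hcoh : ∀ Y Z, Y ⊆ Z → Z ⊂ X → f Y ⊆ f Z) (S : Finset J) (hS : S.Nonempty) :
    S ⊆ X → ∃ F, IsIsoOn b b' (idx X) F ∧ ∀ y ∈ S, f (X.erase y) ⊆ F := by
  have hp := hC.pregeometry H hH
  have hp' := hC.pregeometry H' hH'
  induction hS using Finset.Nonempty.cons_induction with
  | singleton x =>
    intro hx
    have hx : x ∈ X := by simpa using hx
    obtain ⟨F, hF, hFX⟩ := hC.exists_isIsoOn_insert hH hH' hb hb' (idx_countable _)
      (hf _ (Finset.erase_ssubset hx)) (i := Sum.inr x) (by simp)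
    refine ⟨F, ?_, by simpa using hF⟩
    convert hFX
    ext (n | j)
    · simp
    · by_cases h : j = x <;> simp [h, hx]
  | cons x S hxS hS ih =>
    intro hSX
    have hx : x ∈ X := hSX (Finset.mem_cons_self _ _)
    have hSX' : S ⊆ X := (Finset.subset_cons hxS).trans hSX
    obtain ⟨F, hF, hFS⟩ := ih hSX'
    have hfx := hf _ (Finset.erase_ssubset hx)
    -- `τ` measures how far `F`, which extends the faces in `S`, is from the prescribed map on the
    -- new face: that map is contained in `τ` followed by `F`.
    let τ : Set (H × H) := {p | p.2 ∈ H.cl (b '' idx (X.erase x))} ∩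
      pcomp (f (X.erase x)) (pinv F)
    have hτ : IsPartialEmb L τ := (hfx.emb.pcomp hF.emb.pinv).mono Set.inter_subset_right
    have hτF : f (X.erase x) ⊆ pcomp τ F := by
      rintro ⟨c, e⟩ hce
      have he : e ∈ H'.cl (b' '' idx (X.erase x)) := hfx.ran ▸ mem_prange.2 ⟨c, hce⟩
      have he' : e ∈ prange F := by
        rw [hF.ran]
        exact hp'.mono _ _ (Set.image_mono (idx_mono (Finset.erase_subset _ _))) he
      obtain ⟨d, hd⟩ := mem_prange.1 he'
      refine ⟨d, ⟨?_, e, hce, hd⟩, hd⟩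
      have h₁ : pdom ((fun i => (b i, b' i)) '' idx (X.erase x)) = b '' idx (X.erase x) := by
        simp only [pdom, Set.image_image]
      have h₂ : prange ((fun i => (b i, b' i)) '' idx (X.erase x)) = b' '' idx (X.erase x) := by
        simp only [prange, Set.image_image]
      have := (hC.mem_cl_iff hH hH' hF.emb (g := (fun i => (b i, b' i)) '' idx (X.erase x))
        (Set.image_subset_iff.2 fun i hi =>
          hF.mem i (idx_mono (Finset.erase_subset _ _) hi)) hd).2 (by rwa [h₂])
      rwa [h₁] at this
    -- By coherence both the map on the new face and `F` extend the map on the intersection of the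
    -- two faces, so `τ` is the identity there.
    have hfix : ∀ y ∈ S, ∀ e ∈ H.cl (b '' idx ((X.erase y).erase x)), (e, e) ∈ τ := by
      intro y hy e he
      have hss : (X.erase y).erase x ⊂ X :=
        (Finset.erase_subset _ _).trans_ssubset (Finset.erase_ssubset (hSX' hy))
      rw [← (hf _ hss).dom] at he
      obtain ⟨e', he'⟩ := mem_pdom.1 he
      refine ⟨?_, e', hcoh _ _ ?_ (Finset.erase_ssubset hx) he',
        hFS y hy (hcoh _ _ (Finset.erase_subset _ _) (Finset.erase_ssubset (hSX' hy)) he')⟩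
      · rw [(hf _ hss).dom] at he
        exact hp.mono _ _ (Set.image_mono (idx_mono
          (Finset.erase_subset_erase _ (Finset.erase_subset _ _)))) he
      · exact Finset.erase_subset_erase _ (Finset.erase_subset _ _)
    have hV := hC.isPartialEmb_pid_union hH hb hx hxS hτ (by
      rintro c hc
      obtain ⟨d, -, e, hce, -⟩ := mem_pdom.1 hc
      rw [← hfx.dom]
      exact mem_pdom.2 ⟨e, hce⟩) (by
      rintro d hd
      obtain ⟨c, h, -⟩ := mem_prange.1 hd
      exact h) hfix
    -- All face maps factor through `F`: those for `S` by the identity, the new one by `τ`.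
    have hU : IsPartialEmb L (⋃ y : Finset.cons x S hxS, f (X.erase y.1)) := by
      refine (hV.pcomp hF.emb).mono (Set.iUnion_subset ?_)
      rintro ⟨y, hy⟩ ⟨c, e⟩ hce
      rcases Finset.mem_cons.1 hy with rfl | hy
      · obtain ⟨d, hd, hde⟩ := hτF hce
        exact ⟨d, Or.inr hd, hde⟩
      · refine ⟨c, Or.inl ⟨rfl, Set.mem_iUnion₂.2 ⟨y, hy, ?_⟩⟩, hFS y hy hce⟩
        rw [← (hf _ (Finset.erase_ssubset (hSX' hy))).dom]
        exact mem_pdom.2 ⟨e, hce⟩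
    have hfy : ∀ y : Finset.cons x S hxS, IsIsoOn b b' (idx (X.erase y.1)) (f (X.erase y.1)) :=
      fun y => hf _ (Finset.erase_ssubset (hSX y.2))
    have hdom : pdom (⋃ y : Finset.cons x S hxS, f (X.erase y.1)) =
        ⋃ y : Finset.cons x S hxS, H.cl (b '' idx (X.erase y.1)) := by
      rw [pdom, Set.image_iUnion]
      exact Set.iUnion_congr fun y => (hfy y).dom
    have hran : prange (⋃ y : Finset.cons x S hxS, f (X.erase y.1)) =
        ⋃ y : Finset.cons x S hxS, H'.cl (b' '' idx (X.erase y.1)) := by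
      rw [prange, Set.image_iUnion]
      exact Set.iUnion_congr fun y => (hfy y).ran
    have hclosed := hC.isClosedPartialEmb_iUnion hH hH' hU
      (fun y => (hfy y).dom ▸ hp.isCl_cl _) (fun y => (hfy y).ran ▸ hp'.isCl_cl _)
    have hpinv : pinv (⋃ y : Finset.cons x S hxS, f (X.erase y.1)) =
        ⋃ y : Finset.cons x S hxS, pinv (f (X.erase y.1)) := by
      ext ⟨c, d⟩; simp
    have hclosed' : IsClosedPartialEmb (pinv (⋃ y : Finset.cons x S hxS, f (X.erase y.1))) := by
      have := hU.pinv
      rw [hpinv] at this ⊢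
      exact hC.isClosedPartialEmb_iUnion hH' hH this
        (fun y => (hfy y).pinv.dom ▸ hp'.isCl_cl _) (fun y => (hfy y).pinv.ran ▸ hp.isCl_cl _)
    obtain ⟨F', hUF', hF'e, hF'd, hF'r⟩ := hC.exists_extension_of_crown hH hH' hclosed hclosed'
      (by rw [hdom]; exact Set.countable_iUnion fun y =>
        hC.cl_countable hH ((idx_countable _).image _))
      (by rw [hran]; exact Set.countable_iUnion fun y =>
        hC.cl_countable hH' ((idx_countable _).image _))
      (by rw [hdom]; exact isCrown_iUnion hp hb X _)
      (by rw [hran]; exact isCrown_iUnion hp' hb' X _)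
    -- two different faces cover all indices
    obtain ⟨y₀, hy₀⟩ := hS
    have hcover : ∀ i ∈ idx X, ∃ y : Finset.cons x S hxS, i ∈ idx (X.erase y.1) := by
      rintro (n | j) hi
      · exact ⟨⟨x, Finset.mem_cons_self _ _⟩, by simp⟩
      · rcases eq_or_ne j x with rfl | hjx
        · exact ⟨⟨y₀, Finset.mem_cons_of_mem hy₀⟩, by
            simpa [hx] using fun h : j = y₀ => hxS (h ▸ hy₀)⟩
        · exact ⟨⟨x, Finset.mem_cons_self _ _⟩, by simpa [hjx] using hi⟩
    have hcl : ∀ {H : ClStructure.{u, v, w} L} (_ : H.IsPregeometry) (b : ℕ ⊕ J → H),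
        H.cl (⋃ y : Finset.cons x S hxS, H.cl (b '' idx (X.erase y.1))) = H.cl (b '' idx X) := by
      intro H hp b
      refine Set.Subset.antisymm (hp.cl_subset (Set.iUnion_subset fun y => hp.mono _ _
        (Set.image_mono (idx_mono (Finset.erase_subset _ _))))) (hp.mono _ _ ?_)
      rintro _ ⟨i, hi, rfl⟩
      obtain ⟨y, hy⟩ := hcover i hi
      exact Set.mem_iUnion.2 ⟨y, hp.mem_cl_self ⟨i, hy, rfl⟩⟩
    refine ⟨F', ⟨hF'e, by rw [hF'd, hdom, hcl hp], by rw [hF'r, hran, hcl hp'], ?_⟩, ?_⟩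
    · intro i hi
      obtain ⟨y, hy⟩ := hcover i hi
      exact hUF' (Set.mem_iUnion.2 ⟨y, (hfy y).mem i hy⟩)
    · intro y hy
      exact (Set.subset_iUnion (fun y : Finset.cons x S hxS => f (X.erase y.1)) ⟨y, hy⟩).trans hUF'

theorem exists_isIsoOn_step (hC : IsQuasiminimalExcellent C) (hH : H ∈ C)
    (hH' : H' ∈ C) {b : ℕ ⊕ J → H} {b' : ℕ ⊕ J → H'} (hb : FamIndep b) (hb' : FamIndep b')
    {X : Finset J} (f : Finset J → Set (H × H')) (hf : ∀ Y ⊂ X, IsIsoOn b b' (idx Y) (f Y))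
    (hcoh : ∀ Y Z, Y ⊆ Z → Z ⊂ X → f Y ⊆ f Z) :
    ∃ F, IsIsoOn b b' (idx X) F ∧ ∀ Y ⊂ X, f Y ⊆ F := by
  classical
  rcases X.eq_empty_or_nonempty with rfl | hX
  · obtain ⟨F, hF⟩ := hC.exists_isIsoOn_of_countable hH hH' hb hb' (idx_countable (∅ : Finset J))
    exact ⟨F, hF, fun Y hY => (Finset.not_ssubset_empty Y hY).elim⟩
  · obtain ⟨F, hF, hFX⟩ := hC.exists_isIsoOn_faces hH hH' hb hb' f hf hcoh X hX subset_rfl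
    refine ⟨F, hF, fun Y hY => ?_⟩
    -- A proper subset misses some vertex `x`, so it is contained in the face `X.erase x`, and
    -- coherence reduces the claim to faces.
    obtain ⟨x, hx, hxY⟩ := Finset.exists_of_ssubset hY
    exact (hcoh _ _ (Finset.subset_erase.2 ⟨hY.1, hxY⟩) (Finset.erase_ssubset hx)).trans (hFX x hx)

/-- A bijection of infinite independent families extends to their closures. -/
theorem exists_isIsoOn_univ (hC : IsQuasiminimalExcellent C) (hH : H ∈ C)
    (hH' : H' ∈ C) {b : ℕ ⊕ J → H} {b' : ℕ ⊕ J → H'} (hb : FamIndep b) (hb' : FamIndep b') :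
    ∃ F, IsIsoOn b b' Set.univ F := by
  classical
  -- The recursion chooses an extension of all earlier maps whenever one exists; the default `∅` is
  -- never used, by `exists_isIsoOn_step`.
  let step : ∀ X : Finset J, (∀ Y ⊂ X, Set (H × H')) → Set (H × H') := fun X r =>
    if h : ∃ F, IsIsoOn b b' (idx X) F ∧ ∀ Y (hY : Y ⊂ X), r Y hY ⊆ F then h.choose else ∅
  let f : Finset J → Set (H × H') := Finset.strongInduction step
  have hf : ∀ X, IsIsoOn b b' (idx X) (f X) ∧ ∀ Y ⊂ X, f Y ⊆ f X := by
    intro X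
    induction X using Finset.strongInduction with
    | H X ih =>
      have h : ∃ F, IsIsoOn b b' (idx X) F ∧ ∀ Y (_ : Y ⊂ X), f Y ⊆ F :=
        hC.exists_isIsoOn_step hH hH' hb hb' f (fun Y hY => (ih Y hY).1) fun Y Z hYZ hZ => by
          rcases eq_or_ssubset_of_subset hYZ with rfl | hss
          · exact subset_rfl
          · exact (ih Z hZ).2 Y hss
      have hX : f X = h.choose := by
        have : f X = step X fun Y _ => f Y := Finset.strongInduction_eq step X
        rw [this]
        exact dif_pos h
      rw [hX]
      exact h.choose_spec
  have hdir : DirectedOn (· ⊆ ·) (Set.range f) := by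
    have hmono : ∀ Y Z, Y ⊆ Z → f Y ⊆ f Z := fun Y Z hYZ => by
      rcases eq_or_ssubset_of_subset hYZ with rfl | hss
      · exact subset_rfl
      · exact (hf Z).2 Y hss
    rintro _ ⟨Y, rfl⟩ _ ⟨Z, rfl⟩
    exact ⟨_, ⟨Y ∪ Z, rfl⟩, hmono _ _ Finset.subset_union_left,
      hmono _ _ Finset.subset_union_right⟩
  have := hC.isIsoOn_sUnion hH hH' hdir (Set.range_nonempty f)
    (fun g => {i | (b i, b' i) ∈ g}) (by
      rintro _ ⟨X, rfl⟩
      exact (hf X).1.setOf_mem (hC.pregeometry H hH) (hC.pregeometry H' hH'))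
  refine ⟨⋃₀ Set.range f, ?_⟩
  convert this
  refine (Set.eq_univ_of_forall fun i => Set.mem_iUnion₂.2 ?_).symm
  rcases i with n | j
  · exact ⟨_, ⟨∅, rfl⟩, (hf ∅).1.mem _ (by simp)⟩
  · exact ⟨_, ⟨{j}, rfl⟩, (hf {j}).1.mem _ (by simp)⟩

end IsQuasiminimalExcellent

/-! ### Induced closure operations and extension of finite partial embeddings -/

namespace ClStructure

variable {L : FirstOrder.Language.{u, v}}

/-- A substructure with the induced closure operation. -/
abbrev restrict (H : ClStructure.{u, v, w} L) (S : L.Substructure H) : ClStructure.{u, v, w} L :=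
  ⟨S, fun X => Subtype.val ⁻¹' H.cl (Subtype.val '' X)⟩

end ClStructure

namespace IsQuasiminimalExcellent

variable {L : FirstOrder.Language.{u, v}} {C : Set (ClStructure.{u, v, w} L)}
variable {H H' : ClStructure.{u, v, w} L}

/-- The graph of an embedding is a partial embedding. Consequently the closure operation of a member
is determined by its `L`-structure, and a substructure in the class carries the induced closure. -/
theorem mem_cl_iff_embedding (hC : IsQuasiminimalExcellent C) (hH : H ∈ C) (hH' : H' ∈ C)
    (e : H ↪[L] H') (X : Set H) (x : H) : e x ∈ H'.cl (e '' X) ↔ x ∈ H.cl X := by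
  have h₁ : pdom {p : H × H' | e p.1 = p.2 ∧ p.1 ∈ X} = X := by ext; simp
  have h₂ : prange {p : H × H' | e p.1 = p.2 ∧ p.1 ∈ X} = e '' X := by
    ext; simp [and_comm]
  have := hC.mem_cl_iff hH hH' (isPartialEmb_graph e)
    (g := {p : H × H' | e p.1 = p.2 ∧ p.1 ∈ X}) (fun _ h => h.1) (x := x) (y := e x) rfl
  rw [h₁, h₂] at this
  exact this.symm

theorem isIso (hC : IsQuasiminimalExcellent C) (hH : H ∈ C) (hH' : H' ∈ C) (e : H ≃[L] H') :
    IsIso e := by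
  intro X
  ext y
  obtain ⟨x, rfl⟩ := e.surjective y
  rw [e.injective.mem_set_image]
  exact hC.mem_cl_iff_embedding hH hH' e.toEmbedding X x

/-- The closure of a set, with the induced closure operation, is in the class. -/
theorem exists_restrict_mem (hC : IsQuasiminimalExcellent C) (hH : H ∈ C) (X : Set H) :
    ∃ S : L.Substructure H, (S : Set H) = H.cl X ∧ H.restrict S ∈ C := by
  obtain ⟨S, hS, c, hc⟩ := hC.cl_mem H hH X
  have h : (fun X : Set S => Subtype.val ⁻¹' H.cl (Subtype.val '' X)) = c := by
    funext Y
    ext x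
    exact hC.mem_cl_iff_embedding hc hH S.subtype Y x
  exact ⟨S, hS, by rwa [← h] at hc⟩

theorem exists_partialEmb_of_indep (hC : IsQuasiminimalExcellent C) (hH : H ∈ C) (hH' : H' ∈ C)
    {B : Set H} {B' : Set H'} (hB : H.Indep B) (hB' : H'.Indep B') (hBB' : #B = #B') :
    ∃ F : Set (H × H'), IsPartialEmb L F ∧ pdom F = H.cl B ∧ prange F = H'.cl B' := by
  have hp := hC.pregeometry H hH
  have hp' := hC.pregeometry H' hH'
  obtain ⟨e⟩ := Cardinal.eq.1 hBB'
  have hr : ∀ {I : Type w} (φ : I ≃ B), (fun i => (φ i : H)) '' Set.univ = B := by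
    intro I φ
    rw [Set.image_univ, Set.range_comp' Subtype.val φ, φ.range_eq_univ, Set.image_univ,
      Subtype.range_val]
  have hr' : ∀ {I : Type w} (φ : I ≃ B'), (fun i => (φ i : H')) '' Set.univ = B' := by
    intro I φ
    rw [Set.image_univ, Set.range_comp' Subtype.val φ, φ.range_eq_univ, Set.image_univ,
      Subtype.range_val]
  have hb : ∀ {I : Type w} (φ : I ≃ B), FamIndep fun i => (φ i : H) := fun φ =>
    hp.famIndep_of_indep hB (Subtype.val_injective.comp φ.injective) fun i => (φ i).2
  have hb' : ∀ {I : Type w} (φ : I ≃ B'), FamIndep fun i => (φ i : H') := fun φ =>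
    hp'.famIndep_of_indep hB' (Subtype.val_injective.comp φ.injective) fun i => (φ i).2
  have key : ∀ {I : Type w} (φ : I ≃ B),
      (∃ F, IsIsoOn (fun i => (φ i : H)) (fun i => (e (φ i) : H')) Set.univ F) →
      ∃ F : Set (H × H'), IsPartialEmb L F ∧ pdom F = H.cl B ∧ prange F = H'.cl B' := by
    rintro I φ ⟨F, hF⟩
    exact ⟨F, hF.emb, by rw [hF.dom, hr φ], hF.ran.trans (congrArg H'.cl (hr' (φ.trans e)))⟩
  rcases B.finite_or_infinite with hfin | hinf
  · have : Finite B := hfin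
    exact key (Equiv.refl _) (hC.exists_isIsoOn_of_countable hH hH' (hb (Equiv.refl _))
      (hb' e) Set.countable_univ)
  · have : Infinite B := hinf.to_subtype
    -- Splitting off a copy of `ℕ` does not change an infinite cardinality; it provides the reserve
    -- of indices.
    have : #(ℕ ⊕ B) = #B := by
      rw [Cardinal.mk_sum]
      simpa using Cardinal.add_eq_right (Cardinal.aleph0_le_mk B) (Cardinal.aleph0_le_mk B)
    obtain ⟨φ⟩ := Cardinal.eq.1 this
    exact key φ (hC.exists_isIsoOn_univ hH hH' (hb φ) (hb' (φ.trans e)))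

/-- Models of the same dimension are isomorphic. -/
theorem exists_iso_of_hasDim [IsEmpty (L.Relations 0)] (hC : IsQuasiminimalExcellent C)
    (hH : H ∈ C) (hH' : H' ∈ C) {κ : Cardinal.{w}} (h : H.HasDim κ) (h' : H'.HasDim κ) :
    ∃ e : H ≃[L] H', IsIso e := by
  obtain ⟨B, hB, hBu, hBκ⟩ := h
  obtain ⟨B', hB', hBu', hBκ'⟩ := h'
  obtain ⟨F, hF, hFd, hFr⟩ := hC.exists_partialEmb_of_indep hH hH' hB hB' (hBκ.trans hBκ'.symm)
  obtain ⟨e, -⟩ := hF.exists_equiv (hFd.trans hBu) (hFr.trans hBu')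
  exact ⟨e, hC.isIso hH hH' e⟩

theorem exists_extend_of_mem (hC : IsQuasiminimalExcellent C) (hH : H ∈ C) (hH' : H' ∈ C)
    {f : Set (H × H')} (hf : IsPartialEmb L f) (hfin : f.Finite) {x : H}
    (hx : x ∈ H.cl (pdom f)) : ∃ y, IsPartialEmb L (f ∪ {(x, y)}) := by
  obtain ⟨y, hy⟩ := hC.homogeneity_closure H hH H' hH' ∅ ∅ ∅ (Or.inr rfl) (Or.inr rfl)
    isPartialEmb_empty pdom_empty (by ext; simp) f (hfin.image _)
    (by rwa [Set.empty_union]) x (by rwa [Set.union_empty])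
  exact ⟨y, by rwa [Set.empty_union] at hy⟩

/-- `homogeneity_generic` is available only over closed sets, or the empty set, so the finite map is
first extended to the closures of its domain and image. -/
theorem isPartialEmb_union_of_notMem (hC : IsQuasiminimalExcellent C) (hH : H ∈ C) (hH' : H' ∈ C)
    {f : Set (H × H')} (hf : IsPartialEmb L f) (hfin : f.Finite) {x : H} {y : H'}
    (hx : x ∉ H.cl (pdom f)) (hy : y ∉ H'.cl (prange f)) : IsPartialEmb L (f ∪ {(x, y)}) := by
  have hp := hC.pregeometry H hH
  have hp' := hC.pregeometry H' hH'
  obtain ⟨F, hfF, hF, hFd, hFr⟩ := hC.exists_extension_of_finite hH hH' (g := ∅) (Or.inr rfl)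
    (Or.inr rfl) hfin (by rwa [Set.empty_union])
  rw [Set.empty_union] at hfF hFd hFr
  have := hC.homogeneity_generic H hH H' hH' (pdom F) (prange F) F
    (Or.inl ⟨hFd ▸ hC.cl_countable hH (hfin.image _).countable, hFd ▸ hp.isCl_cl _⟩)
    (Or.inl ⟨hFr ▸ hC.cl_countable hH' (hfin.image _).countable, hFr ▸ hp'.isCl_cl _⟩)
    hF rfl pimage_pdom x y (by rwa [hFd, hp.idem]) (by rwa [hFr, hp'.idem])
  exact this.mono (Set.union_subset_union_left _ hfF)

/-- Finite partial embeddings can be extended, if there are enough independent elements. -/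
theorem exists_extend (hC : IsQuasiminimalExcellent C) (hH : H ∈ C) (hH' : H' ∈ C)
    {f : Set (H × H')} (hf : IsPartialEmb L f) (hfin : f.Finite) (x : H)
    (hx : x ∈ H.cl (pdom f) ∨ ∃ y, y ∉ H'.cl (prange f)) :
    ∃ y, IsPartialEmb L (f ∪ {(x, y)}) := by
  by_cases hxf : x ∈ H.cl (pdom f)
  · exact hC.exists_extend_of_mem hH hH' hf hfin hxf
  · obtain ⟨y, hy⟩ := hx.resolve_left hxf
    exact ⟨y, hC.isPartialEmb_union_of_notMem hH hH' hf hfin hxf hy⟩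

theorem exists_extend_of_not_finGen (hC : IsQuasiminimalExcellent C) (hH : H ∈ C) (hH' : H' ∈ C)
    (h' : ¬ H'.FinGen) {f : Set (H × H')} (hf : IsPartialEmb L f) (hfin : f.Finite) (x : H) :
    ∃ y, IsPartialEmb L (f ∪ {(x, y)}) := by
  refine hC.exists_extend hH hH' hf hfin x (Or.inr ?_)
  by_contra! hcon
  exact h' ⟨prange f, hfin.image _, Set.eq_univ_of_forall hcon⟩

/-- Finite partial embeddings of a model into itself can be extended. -/
theorem exists_extend_self (hC : IsQuasiminimalExcellent C) (hH : H ∈ C)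
    {f : Set (H × H)} (hf : IsPartialEmb L f) (hfin : f.Finite) (x : H) :
    ∃ y, IsPartialEmb L (f ∪ {(x, y)}) := by
  have hp := hC.pregeometry H hH
  refine hC.exists_extend hH hH hf hfin x ?_
  by_contra! hcon
  obtain ⟨hx, hcon⟩ := hcon
  -- If no generic value is left, the image contains a finite basis `B`. Its preimage `I` is
  -- independent and at least as large, hence spans too, so `x` depends on the domain after all.
  obtain ⟨B, -, hBf, hB, hfB⟩ := hp.exists_basis hp.indep_empty (Set.empty_subset (prange f))
  have hBu : H.cl B = Set.univ := Set.eq_univ_of_forall fun y => hp.cl_subset hfB (hcon y)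
  let I : Set H := pimage (pinv f) B
  have hIf : I ⊆ pdom f := by
    rintro a ⟨b, -, hab⟩
    exact mem_pdom.2 ⟨b, hab⟩
  have hI : H.Indep I := by
    rintro a ⟨b, hb, hab⟩ ha
    have := hC.cl_map H hH H hH f hf (I \ {a}) a b (Set.sdiff_subset.trans hIf) hab ha
    refine hB b hb (hp.mono _ _ ?_ this)
    rintro c ⟨d, ⟨⟨c', hc', hdc'⟩, hda⟩, hdc⟩
    refine ⟨hf.eq_right hdc hdc' ▸ hc', fun hcb => hda ?_⟩
    obtain rfl : c = b := hcb
    exact hf.eq_left hdc hab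
  have hcard : B.ncard ≤ I.ncard := by
    have hIfin : I.Finite := (hfin.image Prod.fst).subset hIf
    choose! g hg using fun b (hb : b ∈ B) => mem_prange.1 (hBf hb)
    refine Set.ncard_le_ncard_of_injOn g (fun b hb => ⟨b, hb, hg b hb⟩) ?_ hIfin
    intro b hb b' hb' h
    exact hf.eq_right (hg b hb) (h ▸ hg b' hb')
  have := hp.cl_eq_univ_of_ncard_le hBu ((hfin.image _).subset hBf) hI hcard
  exact hx (hp.mono _ _ hIf (this ▸ Set.mem_univ x))

end IsQuasiminimalExcellent

/-! ## Infinitary formulas -/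

namespace LQFormula

open FirstOrder.Language

variable {L : FirstOrder.Language.{u, v}} {M N : Type w} [L.Structure M] [L.Structure N] {n : ℕ}

theorem realize_iOr {φ : ℕ → LQFormula L n} {b : Fin n → M} :
    (iOr φ).Realize b ↔ ∃ i, (φ i).Realize b := by
  simp [iOr, Realize]

theorem realize_and {φ ψ : LQFormula L n} {b : Fin n → M} :
    (φ.and ψ).Realize b ↔ φ.Realize b ∧ ψ.Realize b := by
  simp only [LQFormula.and, Realize]
  exact ⟨fun h => ⟨by simpa using h 0, by simpa using h 1⟩,
    fun h i => by split_ifs; exacts [h.1, h.2]⟩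

theorem realize_or {φ ψ : LQFormula L n} {b : Fin n → M} :
    (φ.or ψ).Realize b ↔ φ.Realize b ∨ ψ.Realize b := by
  rw [LQFormula.or, realize_iOr]
  constructor
  · rintro ⟨i, h⟩
    split_ifs at h
    exacts [Or.inl h, Or.inr h]
  · rintro (h | h)
    exacts [⟨0, by simpa using h⟩, ⟨1, by simpa using h⟩]

theorem realize_all {φ : LQFormula L (n + 1)} {b : Fin n → M} :
    φ.all.Realize b ↔ ∀ a : M, φ.Realize (Fin.snoc b a : Fin (n + 1) → M) := by
  simp [all, Realize]

theorem realize_alls {φ : LQFormula L n} {b : Fin 0 → M} :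
    (alls n φ).Realize b ↔ ∀ a : Fin n → M, φ.Realize a := by
  induction n with
  | zero => exact ⟨fun h a => Subsingleton.elim b a ▸ h, fun h => h b⟩
  | succ n ih =>
    rw [alls, ih]
    simp only [realize_all]
    exact ⟨fun h a => by simpa using h (Fin.init a) (a (Fin.last n)), fun h a x => h _⟩

theorem noQ_alls {φ : LQFormula L n} (h : φ.NoQ) : (alls n φ).NoQ := by
  induction n with
  | zero => exact h
  | succ n ih => exact ih h

theorem IsQF.noQ {φ : LQFormula L n} (h : φ.IsQF) : φ.NoQ := by
  induction φ with
  | falsum => trivial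
  | equal => trivial
  | rel => trivial
  | neg φ ih => exact ih h
  | iAnd φ ih => exact fun i => ih i (h i)
  | ex => exact h.elim
  | exUncountable => exact h.elim

open Classical in
/-- The conjunction of a countable family of formulas. -/
noncomputable def conj {ι : Type*} [Countable ι] (φ : ι → LQFormula L n) : LQFormula L n :=
  if _h : Nonempty ι then iAnd (φ ∘ (exists_surjective_nat ι).choose) else neg falsum

theorem realize_conj {ι : Type*} [Countable ι] {φ : ι → LQFormula L n} {b : Fin n → M} :
    (conj φ).Realize b ↔ ∀ i, (φ i).Realize b := by
  unfold conj
  split_ifs with h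
  · simp only [Realize, Function.comp_apply]
    exact ((exists_surjective_nat ι).choose_spec.forall (p := fun i => (φ i).Realize b)).symm
  · simp [Realize, not_nonempty_iff.1 h]

theorem noQ_conj {ι : Type*} [Countable ι] {φ : ι → LQFormula L n} (h : ∀ i, (φ i).NoQ) :
    (conj φ).NoQ := by
  unfold conj
  split_ifs
  · exact fun i => h _
  · trivial

theorem isQF_conj {ι : Type*} [Countable ι] {φ : ι → LQFormula L n} (h : ∀ i, (φ i).IsQF) :
    (conj φ).IsQF := by
  unfold conj
  split_ifs
  · exact fun i => h _
  · trivial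

/-- The disjunction of a countable family of formulas. -/
noncomputable def disj {ι : Type*} [Countable ι] (φ : ι → LQFormula L n) : LQFormula L n :=
  neg (conj fun i => neg (φ i))

theorem realize_disj {ι : Type*} [Countable ι] {φ : ι → LQFormula L n} {b : Fin n → M} :
    (disj φ).Realize b ↔ ∃ i, (φ i).Realize b := by
  simp [disj, Realize, realize_conj]

theorem noQ_disj {ι : Type*} [Countable ι] {φ : ι → LQFormula L n} (h : ∀ i, (φ i).NoQ) :
    (disj φ).NoQ := noQ_conj (φ := fun i => neg (φ i)) h

theorem isQF_disj {ι : Type*} [Countable ι] {φ : ι → LQFormula L n} (h : ∀ i, (φ i).IsQF) :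
    (disj φ).IsQF := isQF_conj (φ := fun i => neg (φ i)) h

theorem realize_iff_of_atEq {φ : LQFormula L n} (hφ : φ.IsQF) {a : Fin n → M} {b : Fin n → N}
    (h : AtEq L a b) : φ.Realize a ↔ φ.Realize b := by
  induction φ with
  | falsum => exact Iff.rfl
  | equal t₁ t₂ => exact h.1 t₁ t₂
  | rel R ts => exact h.2 _ R ts
  | neg φ ih => exact not_congr (ih hφ h)
  | iAnd φ ih => exact forall_congr' fun i => ih i (hφ i) h
  | ex => exact hφ.elim
  | exUncountable => exact hφ.elim

/-- Invariance of `L_{ω₁,ω}`-formulas under back-and-forth systems. -/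
theorem realize_iff_of_backAndForth (R : ∀ n, (Fin n → M) → (Fin n → N) → Prop)
    (hR : ∀ n a b, R n a b → AtEq L a b)
    (forth : ∀ n a b, R n a b → ∀ x, ∃ y, R (n + 1) (Fin.snoc a x) (Fin.snoc b y))
    (back : ∀ n a b, R n a b → ∀ y, ∃ x, R (n + 1) (Fin.snoc a x) (Fin.snoc b y))
    {φ : LQFormula L n} (hφ : φ.NoQ) {a : Fin n → M} {b : Fin n → N} (h : R n a b) :
    φ.Realize a ↔ φ.Realize b := by
  induction φ with
  | falsum => exact Iff.rfl
  | equal t₁ t₂ => exact (hR _ _ _ h).1 t₁ t₂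
  | rel R ts => exact (hR _ _ _ h).2 _ R ts
  | neg φ ih => exact not_congr (ih hφ h)
  | iAnd φ ih => exact forall_congr' fun i => ih i (hφ i) h
  | ex φ ih =>
    constructor
    · rintro ⟨x, hx⟩
      obtain ⟨y, hy⟩ := forth _ _ _ h x
      exact ⟨y, (ih hφ hy).1 hx⟩
    · rintro ⟨y, hy⟩
      obtain ⟨x, hx⟩ := back _ _ _ h y
      exact ⟨x, (ih hφ hx).2 hy⟩
  | exUncountable => exact hφ.elim

theorem atEq_embedding (e : M ↪[L] N) {α : Type*} (a : α → M) : AtEq L a (e ∘ a) := by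
  constructor
  · intro t₁ t₂
    rw [HomClass.realize_term, HomClass.realize_term, e.injective.eq_iff]
  · intro l R ts
    have : (fun i => (ts i).realize (e ∘ a)) = e ∘ fun i => (ts i).realize a :=
      funext fun i => HomClass.realize_term e
    rw [this]
    exact (e.map_rel R _).symm

theorem satisfiesSentence_equiv (e : M ≃[L] N) {σ : LQFormula L 0} (hσ : σ.NoQ) :
    SatisfiesSentence M σ ↔ SatisfiesSentence N σ := by
  refine realize_iff_of_backAndForth (fun n a b => b = e ∘ a) ?_ ?_ ?_ hσ
    (Subsingleton.elim _ _)
  · rintro n a _ rfl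
    exact atEq_embedding e.toEmbedding a
  · rintro n a _ rfl x
    exact ⟨e x, (Fin.comp_snoc ..).symm⟩
  · rintro n a _ rfl y
    obtain ⟨x, rfl⟩ := e.surjective y
    exact ⟨x, (Fin.comp_snoc ..).symm⟩

/-- The atomic diagram of a tuple. -/
theorem exists_diagram [Countable L.Symbols] (a : Fin n → M) :
    ∃ φ : LQFormula L n, φ.IsQF ∧ ∀ {N : Type w} [L.Structure N] (b : Fin n → N),
      φ.Realize b ↔ AtEq L a b := by
  classical
  have : Countable (Σ l, L.Functions l) :=
    (Sum.inl_injective (β := Σ l, L.Relations l)).countable (β := L.Symbols)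
  have : Countable (Σ l, L.Relations l) :=
    (Sum.inr_injective (α := Σ l, L.Functions l)).countable (β := L.Symbols)
  let sgn : Prop → LQFormula L n → LQFormula L n := fun p φ => if p then φ else neg φ
  have hsgn : ∀ {N : Type w} [L.Structure N] (p : Prop) (φ : LQFormula L n) (b : Fin n → N),
      (sgn p φ).Realize b ↔ (p ↔ φ.Realize b) := by
    intro N _ p φ b
    by_cases h : p <;> simp [sgn, h, Realize]
  let at₁ : L.Term (Fin n) × L.Term (Fin n) → LQFormula L n := fun t => equal t.1 t.2
  let at₂ : (Σ R : Σ l, L.Relations l, Fin R.1 → L.Term (Fin n)) → LQFormula L n :=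
    fun R => rel R.1.2 R.2
  let A := Sum.elim at₁ at₂
  have hA : ∀ i, (A i).IsQF := by rintro (t | R) <;> trivial
  refine ⟨conj fun i => sgn ((A i).Realize a) (A i), isQF_conj fun i => ?_, fun {N} _ b => ?_⟩
  · by_cases h : (A i).Realize a
    · simpa only [sgn, if_pos h] using hA i
    · simp only [sgn, if_neg h]
      exact hA i
  · simp only [realize_conj, hsgn]
    exact ⟨fun h => ⟨fun t₁ t₂ => h (Sum.inl (t₁, t₂)), fun l R ts => h (Sum.inr ⟨⟨l, R⟩, ts⟩)⟩,
      fun h i => realize_iff_of_atEq (hA i) h⟩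

/-! ### The downward Löwenheim–Skolem theorem -/

/-- A countable set has a countable hull for a finitary closure condition. -/
theorem exists_hull {X : Type*} (Φ : Set X → Set X) (hΦ : ∀ F, F.Finite → (Φ F).Countable)
    {A : Set X} (hA : A.Countable) :
    ∃ N, A ⊆ N ∧ N.Countable ∧ ∀ F ⊆ N, F.Finite → Φ F ⊆ N := by
  let s : ℕ → Set X := fun k => Nat.rec A (fun _ T => T ∪ ⋃ F ∈ {F | F.Finite ∧ F ⊆ T}, Φ F) k
  have hs : ∀ k, s (k + 1) = s k ∪ ⋃ F ∈ {F | F.Finite ∧ F ⊆ s k}, Φ F := fun _ => rfl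
  have hmono : Monotone s := monotone_nat_of_le_succ fun k => by
    rw [hs]; exact Set.subset_union_left
  refine ⟨⋃ k, s k, Set.subset_iUnion s 0, Set.countable_iUnion fun k => ?_, ?_⟩
  · induction k with
    | zero => exact hA
    | succ k ih =>
      rw [hs]
      exact ih.union ((Set.countable_ofPred_finite_subset ih).biUnion fun F hF => hΦ F hF.1)
  · intro F hF hfin
    obtain ⟨_, ⟨k, rfl⟩, hk⟩ := DirectedOn.exists_mem_subset_of_finite_of_subset_sUnion
      (Set.range_nonempty s) (by
        rintro _ ⟨k, rfl⟩ _ ⟨l, rfl⟩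
        exact ⟨_, ⟨max k l, rfl⟩, hmono (le_max_left _ _), hmono (le_max_right _ _)⟩) hfin
      (by rwa [Set.sUnion_range])
    refine Set.Subset.trans ?_ (Set.subset_iUnion s (k + 1))
    rw [hs]
    exact Set.subset_union_of_subset_right (Set.subset_biUnion_of_mem
      (show F ∈ {F | F.Finite ∧ F ⊆ s k} from ⟨hfin, hk⟩)) _

/-- Skolem functions in the form of a countable-valued operator on sets: a substructure closed under
it on finite subsets contains the witnesses that the existential subformulas need. -/
theorem exists_skolem {φ : LQFormula L n} (hφ : φ.NoQ) :
    ∃ Φ : Set M → Set M, (∀ F, F.Finite → (Φ F).Countable) ∧ ∀ S : L.Substructure M,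
      (∀ F ⊆ (S : Set M), F.Finite → Φ F ⊆ S) →
      ∀ a : Fin n → S, φ.Realize a ↔ φ.Realize (S.subtype ∘ a) := by
  induction φ with
  | falsum => exact ⟨fun _ => ∅, fun _ _ => Set.countable_empty, fun _ _ _ => Iff.rfl⟩
  | equal t₁ t₂ =>
    exact ⟨fun _ => ∅, fun _ _ => Set.countable_empty,
      fun S _ a => (atEq_embedding S.subtype a).1 t₁ t₂⟩
  | rel R ts =>
    exact ⟨fun _ => ∅, fun _ _ => Set.countable_empty,
      fun S _ a => (atEq_embedding S.subtype a).2 _ R ts⟩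
  | neg φ ih =>
    obtain ⟨Φ, hΦ, h⟩ := ih hφ
    exact ⟨Φ, hΦ, fun S hS a => not_congr (h S hS a)⟩
  | iAnd φ ih =>
    choose Φ hΦ h using fun i => ih i (hφ i)
    exact ⟨fun F => ⋃ i, Φ i F, fun F hF => Set.countable_iUnion fun i => hΦ i F hF,
      fun S hS a => forall_congr' fun i => h i S
        (fun F hF hfin => (Set.subset_iUnion (fun i => Φ i F) i).trans (hS F hF hfin)) a⟩
  | @ex n φ ih =>
    obtain ⟨Φ, hΦ, h⟩ := ih hφ
    -- One witness is chosen for each tuple from `F` that has one; a finite `F` has finitely many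
    -- such tuples.
    refine ⟨fun F => Φ F ∪ Set.range fun a : {a : Fin n → F //
        ∃ x : M, φ.Realize (Fin.snoc (Subtype.val ∘ a) x : Fin (n + 1) → M)} => a.2.choose,
      fun F hF => ?_, fun S hS a => ?_⟩
    · have : Finite F := hF
      exact (hΦ F hF).union (Set.countable_range _)
    · have hS' := h S fun F hF hfin => Set.subset_union_left.trans (hS F hF hfin)
      constructor
      · rintro ⟨x, hx⟩
        refine ⟨S.subtype x, ?_⟩
        rw [← Fin.comp_snoc]
        exact (hS' _).1 hx
      · intro hx
        let F : Set M := Set.range (S.subtype ∘ a)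
        let a' : Fin n → F := fun i => ⟨_, Set.mem_range_self i⟩
        have hx' : ∃ x : M, φ.Realize (Fin.snoc (Subtype.val ∘ a') x : Fin (n + 1) → M) := hx
        have hmem : hx'.choose ∈ S := hS F (by rintro _ ⟨i, rfl⟩; exact (a i).2)
          (Set.finite_range _) (Or.inr ⟨⟨a', hx'⟩, rfl⟩)
        refine ⟨⟨_, hmem⟩, (hS' _).2 ?_⟩
        rw [Fin.comp_snoc]
        exact hx'.choose_spec
  | exUncountable => exact hφ.elim

/-- The downward Löwenheim–Skolem theorem for a sentence of `L_{ω₁,ω}`, with an additional finitary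
closure condition. -/
theorem exists_countable_substructure [Countable L.Symbols] {σ : LQFormula L 0} (hσ : σ.NoQ)
    (hM : SatisfiesSentence M σ) (Ψ : Set M → Set M) (hΨ : ∀ F, F.Finite → (Ψ F).Countable)
    {A : Set M} (hA : A.Countable) :
    ∃ S : L.Substructure M, A ⊆ S ∧ (S : Set M).Countable ∧ SatisfiesSentence S σ ∧
      ∀ F ⊆ (S : Set M), F.Finite → Ψ F ⊆ S := by
  have : Countable (Σ l, L.Functions l) :=
    (Sum.inl_injective (β := Σ l, L.Relations l)).countable (β := L.Symbols)
  obtain ⟨Φ, hΦ, hΦσ⟩ := exists_skolem (M := M) hσ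
  -- One hull serves three purposes: Skolem witnesses, the extra condition `Ψ`, and closure under
  -- the function symbols, of which there are countably many.
  obtain ⟨N, hAN, hN, hcl⟩ := exists_hull (fun F => Φ F ∪ Ψ F ∪
      Set.range fun p : Σ f : Σ l, L.Functions l, Fin f.1 → F =>
        Structure.funMap p.1.2 (Subtype.val ∘ p.2 : Fin p.1.1 → M))
    (fun F hF => by
      have : Finite F := hF
      exact ((hΦ F hF).union (hΨ F hF)).union (Set.countable_range _)) hA
  let S : L.Substructure M := ⟨N, fun {l} f x hx => by
    refine hcl (Set.range x) (Set.range_subset_iff.2 hx) (Set.finite_range x) (Or.inr ?_)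
    exact ⟨⟨⟨l, f⟩, fun i => ⟨x i, Set.mem_range_self i⟩⟩, rfl⟩⟩
  refine ⟨S, hAN, hN, ?_, fun F hF hfin =>
    (Set.subset_union_right.trans Set.subset_union_left).trans (hcl F hF hfin)⟩
  refine (hΦσ S (fun F hF hfin =>
    (Set.subset_union_left.trans Set.subset_union_left).trans (hcl F hF hfin)) _).2 ?_
  rw [Subsingleton.elim (S.subtype ∘ _) Fin.elim0]
  exact hM

end LQFormula

/-! ## Structures which are locally in a class -/

namespace ClStructure

open FirstOrder.Language

variable {L : FirstOrder.Language.{u, v}} {C : Set (ClStructure.{u, v, w} L)}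
variable {H H' : ClStructure.{u, v, w} L}

/-- The structures with a finitary closure operation, all of whose countable subsets are contained
in countable closed substructures from the class `C`. -/
def locally (C : Set (ClStructure.{u, v, w} L)) : Set (ClStructure.{u, v, w} L) :=
  {H | (∀ X Y : Set H, X ⊆ Y → H.cl X ⊆ H.cl Y) ∧
    (∀ (X : Set H) (a : H), a ∈ H.cl X → ∃ Y ⊆ X, Y.Finite ∧ a ∈ H.cl Y) ∧
    ∀ A : Set H, A.Countable → ∃ S : L.Substructure H,
      A ⊆ S ∧ (S : Set H).Countable ∧ H.cl S ⊆ S ∧ H.restrict S ∈ C}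

/-- The structures with a finitary closure operation, all of whose finite subsets are contained
in closed substructures from the class `C`. -/
def finLocally (C : Set (ClStructure.{u, v, w} L)) : Set (ClStructure.{u, v, w} L) :=
  {H | (∀ X Y : Set H, X ⊆ Y → H.cl X ⊆ H.cl Y) ∧
    (∀ (X : Set H) (a : H), a ∈ H.cl X → ∃ Y ⊆ X, Y.Finite ∧ a ∈ H.cl Y) ∧
    ∀ A : Set H, A.Finite → ∃ S : L.Substructure H, A ⊆ S ∧ H.cl S ⊆ S ∧ H.restrict S ∈ C}

theorem locally_subset_finLocally : locally C ⊆ finLocally C := fun _ h =>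
  ⟨h.1, h.2.1, fun A hA => (h.2.2 A hA.countable).imp fun _ h => ⟨h.1, h.2.2⟩⟩

theorem isIso_of_forall_mem_iff (e : H ≃[L] H')
    (h : ∀ X x, e x ∈ H'.cl (e '' X) ↔ x ∈ H.cl X) : IsIso e := by
  intro X
  ext y
  obtain ⟨x, rfl⟩ := e.surjective y
  rw [e.injective.mem_set_image]
  exact h X x

theorem IsIso.mem_iff {e : H ≃[L] H'} (h : IsIso e) (X : Set H) (x : H) :
    e x ∈ H'.cl (e '' X) ↔ x ∈ H.cl X := by
  rw [h X, e.injective.mem_set_image]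

theorem mem_cl_restrict {S : L.Substructure H} {X : Set (H.restrict S)} {x : H.restrict S} :
    x ∈ (H.restrict S).cl X ↔ x.1 ∈ H.cl (Subtype.val '' X) := Iff.rfl

theorem mem_cl_restrict_preimage {S : L.Substructure H} {X : Set H} (hX : X ⊆ S)
    {x : H.restrict S} :
    x ∈ (H.restrict S).cl (Subtype.val ⁻¹' X) ↔ x.1 ∈ H.cl X := by
  rw [mem_cl_restrict, Set.image_preimage_eq_of_subset]
  rwa [Subtype.range_val]

/-- The part of a partial map between two substructures. -/
def pcut (S : L.Substructure H) (S' : L.Substructure H') (f : Set (H × H')) :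
    Set (H.restrict S × H'.restrict S') := {p | (p.1.1, p.2.1) ∈ f}

theorem isPartialEmb_pcut {S : L.Substructure H} {S' : L.Substructure H'} {f : Set (H × H')}
    (hd : pdom f ⊆ S) (hr : prange f ⊆ S') : IsPartialEmb L (pcut S S' f) ↔ IsPartialEmb L f := by
  have h₁ := isPartialEmb_graph (L := L) S.subtype
  have h₂ := isPartialEmb_graph (L := L) S'.subtype
  constructor
  · intro h
    refine (h₁.pinv.pcomp (h.pcomp (H := H.restrict S) h₂)).mono ?_
    rintro ⟨x, y⟩ hxy
    exact ⟨⟨x, hd (mem_pdom.2 ⟨y, hxy⟩)⟩, rfl, ⟨y, hr (mem_prange.2 ⟨x, hxy⟩)⟩, hxy, rfl⟩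
  · intro h
    refine (h₁.pcomp (h.pcomp h₂.pinv)).mono ?_
    rintro ⟨x, y⟩ hxy
    exact ⟨x.1, rfl, y.1, hxy, rfl⟩

theorem pdom_pcut {S : L.Substructure H} {S' : L.Substructure H'} {f : Set (H × H')}
    (hr : prange f ⊆ S') : pdom (pcut S S' f) = Subtype.val ⁻¹' pdom f := by
  ext x
  rw [Set.mem_preimage, mem_pdom, mem_pdom]
  exact ⟨fun ⟨y, h⟩ => ⟨y.1, h⟩, fun ⟨y, h⟩ => ⟨⟨y, hr (mem_prange.2 ⟨_, h⟩)⟩, h⟩⟩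

theorem prange_pcut {S : L.Substructure H} {S' : L.Substructure H'} {f : Set (H × H')}
    (hd : pdom f ⊆ S) : prange (pcut S S' f) = Subtype.val ⁻¹' prange f := by
  ext x
  rw [Set.mem_preimage, mem_prange, mem_prange]
  exact ⟨fun ⟨y, h⟩ => ⟨y.1, h⟩, fun ⟨y, h⟩ => ⟨⟨y, hd (mem_pdom.2 ⟨_, h⟩)⟩, h⟩⟩

theorem isCl_preimage {S : L.Substructure H} {X : Set H} (hX : X ⊆ S) (h : H.IsCl X) :
    (H.restrict S).IsCl (Subtype.val ⁻¹' X) := by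
  ext x
  rw [mem_cl_restrict_preimage hX, show H.cl X = X from h]
  rfl

theorem IsPartialEmb.countable {H H' : Type w} [L.Structure H] [L.Structure H']
    {f : Set (H × H')} (hf : IsPartialEmb L f) (h : (pdom f).Countable) : f.Countable := by
  refine Set.MapsTo.countable_of_injOn (f := Prod.fst)
    (fun p hp => Set.mem_image_of_mem Prod.fst hp) ?_ h
  rintro ⟨a, b⟩ hp ⟨a', b'⟩ hq (rfl : a = a')
  rw [hf.eq_right hp hq]

end ClStructure

namespace IsQuasiminimalExcellent

open FirstOrder.Language

variable {L : FirstOrder.Language.{u, v}} {C : Set (ClStructure.{u, v, w} L)}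
variable {H H' : ClStructure.{u, v, w} L}

theorem restrict_map_mem_iff (hC : IsQuasiminimalExcellent C) (f : H ↪[L] H')
    (hf : ∀ X x, f x ∈ H'.cl (f '' X) ↔ x ∈ H.cl X) (S : L.Substructure H) :
    H.restrict S ∈ C ↔ H'.restrict (S.map f.toHom) ∈ C := by
  let e : H.restrict S ≃[L] H'.restrict (S.map f.toHom) := f.substructureEquivMap S
  have he : ∀ x, (e x).1 = f x.1 := fun x => rfl
  have hiso : IsIso e := isIso_of_forall_mem_iff e fun X x => by
    rw [mem_cl_restrict, mem_cl_restrict, ← hf, he, Set.image_image, Set.image_image]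
    simp only [he]
  have hiso' : IsIso e.symm := isIso_of_forall_mem_iff e.symm fun X x => by
    rw [← hiso.mem_iff, ← Set.image_comp]
    simp
  exact ⟨fun h => hC.isoClosed _ h _ e hiso, fun h => hC.isoClosed _ h _ e.symm hiso'⟩

theorem subset_locally (hC : IsQuasiminimalExcellent C) : C ⊆ locally C := by
  intro H hH
  have hp := hC.pregeometry H hH
  refine ⟨hp.mono, hp.finite_char, fun A hA => ?_⟩
  obtain ⟨S, hS, hSC⟩ := hC.exists_restrict_mem hH A
  exact ⟨S, hS ▸ hp.subset_cl A, hS ▸ hC.cl_countable hH hA,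
    by rw [hS, hp.idem], hSC⟩

/-- By finite character each axiom involves only finitely many elements, and is checked inside a
closed substructure from the class that contains them. -/
theorem pregeometry_of_finLocally (hC : IsQuasiminimalExcellent C) (hH : H ∈ finLocally C) :
    H.IsPregeometry := by
  obtain ⟨hmono, hfin, hloc⟩ := hH
  have hsub : ∀ X : Set H, X ⊆ H.cl X := by
    intro X a ha
    obtain ⟨S, hAS, -, hS⟩ := hloc {a} (Set.finite_singleton a)
    have := (hC.pregeometry _ hS).subset_cl (Subtype.val ⁻¹' {a}) (show
      (⟨a, hAS rfl⟩ : H.restrict S) ∈ _ from rfl)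
    rw [mem_cl_restrict_preimage hAS] at this
    exact hmono _ _ (Set.singleton_subset_iff.2 ha) this
  refine ⟨hsub, hmono, fun X => ?_, hfin, fun X a b hab ha => ?_⟩
  · refine Set.Subset.antisymm (fun a ha => ?_) (hsub _)
    obtain ⟨Y, hYX, hY, haY⟩ := hfin _ a ha
    choose! Z hZX hZ hyZ using fun y (hy : y ∈ Y) => hfin _ y (hYX hy)
    have hZfin : (⋃ y ∈ Y, Z y).Finite := hY.biUnion hZ
    obtain ⟨S, hAS, hcl, hS⟩ := hloc _ hZfin
    have hYZ : Y ⊆ H.cl (⋃ y ∈ Y, Z y) := fun y hy =>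
      hmono _ _ (Set.subset_biUnion_of_mem hy) (hyZ y hy)
    have hYS : Y ⊆ S := hYZ.trans ((hmono _ _ hAS).trans hcl)
    have haS : a ∈ S := hcl (hmono _ _ hYS haY)
    have := (hC.pregeometry _ hS).cl_subset (X := Subtype.val ⁻¹' Y)
      (Y := Subtype.val ⁻¹' ⋃ y ∈ Y, Z y) (fun y hy =>
        (mem_cl_restrict_preimage hAS).2 (hYZ hy))
      ((mem_cl_restrict_preimage (x := ⟨a, haS⟩) hYS).2 haY)
    rw [mem_cl_restrict_preimage hAS] at this
    exact hmono _ _ (Set.iUnion₂_subset hZX) this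
  · obtain ⟨Y, hYX, hY, haY⟩ := hfin _ a hab
    -- The finite set witnessing the dependence is normalised so that `b` is not among the remaining
    -- parameters, which then all lie in `X`.
    have h₁ : a ∈ H.cl (insert b (Y \ {b})) := hmono _ _ (by simp) haY
    have h₂ : Y \ {b} ⊆ X := fun y hy => (hYX hy.1).resolve_left hy.2
    have h₃ : a ∉ H.cl (Y \ {b}) := fun h => ha (hmono _ _ h₂ h)
    obtain ⟨S, hAS, -, hS⟩ := hloc (insert a (insert b (Y \ {b})))
      (((hY.sdiff).insert b).insert a)
    have haS : a ∈ S := hAS (Set.mem_insert _ _)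
    have hbS : b ∈ S := hAS (Set.mem_insert_of_mem _ (Set.mem_insert _ _))
    have hYS : Y \ {b} ⊆ S := fun y hy => hAS (Or.inr (Or.inr hy))
    have hins : ∀ c (hc : c ∈ S), (Subtype.val ⁻¹' insert c (Y \ {b}) : Set (H.restrict S)) =
        insert ⟨c, hc⟩ (Subtype.val ⁻¹' (Y \ {b})) := by
      intro c hc
      ext x
      simp only [Set.mem_preimage, Set.mem_insert_iff, Subtype.ext_iff]
    have := (hC.pregeometry _ hS).exchange (Subtype.val ⁻¹' (Y \ {b})) ⟨a, haS⟩ ⟨b, hbS⟩ (by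
        rw [← hins, mem_cl_restrict_preimage (Set.insert_subset hbS hYS)]
        exact h₁) (by
        rw [mem_cl_restrict_preimage hYS]
        exact h₃)
    rw [← hins, mem_cl_restrict_preimage (Set.insert_subset haS hYS)] at this
    exact hmono _ _ (Set.insert_subset_insert h₂) this

theorem pregeometry_of_locally (hC : IsQuasiminimalExcellent C) (hH : H ∈ locally C) :
    H.IsPregeometry := hC.pregeometry_of_finLocally (locally_subset_finLocally hH)

theorem exists_restrict_mem_of_subset (hC : IsQuasiminimalExcellent C) (hp : H.IsPregeometry)
    {S : L.Substructure H} (hcl : H.cl S ⊆ S) (hS : H.restrict S ∈ C) {A : Set H} (hAS : A ⊆ S)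
    (hA : A.Countable) :
    ∃ T : L.Substructure H, (T : Set H) = H.cl A ∧ (T : Set H).Countable ∧ H.restrict T ∈ C := by
  obtain ⟨T, hT, hTC⟩ := hC.exists_restrict_mem hS (Subtype.val ⁻¹' A)
  have hmap : ((T.map S.subtype.toHom : L.Substructure H) : Set H) = H.cl A := by
    rw [Substructure.coe_map, hT]
    ext x
    constructor
    · rintro ⟨y, hy, rfl⟩
      exact (mem_cl_restrict_preimage hAS).1 hy
    · intro hx
      exact ⟨⟨x, hcl (hp.mono _ _ hAS hx)⟩, (mem_cl_restrict_preimage hAS).2 hx, rfl⟩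
  refine ⟨T.map S.subtype.toHom, hmap, ?_, (hC.restrict_map_mem_iff (H := H.restrict S)
    S.subtype (fun X x => Iff.rfl) T).1 hTC⟩
  rw [Substructure.coe_map, hT]
  exact (hC.cl_countable hS (hA.preimage Subtype.val_injective)).image _

theorem exists_restrict_mem_of_locally (hC : IsQuasiminimalExcellent C) (hH : H ∈ locally C)
    {A : Set H} (hA : A.Countable) :
    ∃ S : L.Substructure H, (S : Set H) = H.cl A ∧ (S : Set H).Countable ∧ H.restrict S ∈ C := by
  obtain ⟨S, hAS, -, hcl, hS⟩ := hH.2.2 A hA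
  exact hC.exists_restrict_mem_of_subset (hC.pregeometry_of_locally hH) hcl hS hAS hA

theorem exists_restrict_mem_of_finLocally (hC : IsQuasiminimalExcellent C)
    (hH : H ∈ finLocally C) {A : Set H} (hA : A.Finite) :
    ∃ S : L.Substructure H, (S : Set H) = H.cl A ∧ (S : Set H).Countable ∧ H.restrict S ∈ C := by
  obtain ⟨S, hAS, hcl, hS⟩ := hH.2.2 A hA
  exact hC.exists_restrict_mem_of_subset (hC.pregeometry_of_finLocally hH) hcl hS hAS hA.countable

theorem mem_of_countable (hC : IsQuasiminimalExcellent C) (hH : H ∈ locally C) [Countable H] :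
    H ∈ C := by
  have hp := hC.pregeometry_of_locally hH
  obtain ⟨S, hS, -, hSC⟩ := hC.exists_restrict_mem_of_locally hH (Set.countable_univ)
  have : S = ⊤ := by
    apply SetLike.coe_injective
    rw [hS]
    exact Set.univ_subset_iff.1 (hp.subset_cl _)
  subst this
  exact hC.isoClosed _ hSC H Substructure.topEquiv
    (isIso_of_forall_mem_iff (H := H.restrict ⊤) _ fun X x => Iff.rfl)

theorem cl_map_of_finLocally (hC : IsQuasiminimalExcellent C) (hH : H ∈ finLocally C)
    (hH' : H' ∈ finLocally C) {f : Set (H × H')} (hf : IsPartialEmb L f) {X : Set H} {y : H} {y' : H'}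
    (hX : X ⊆ pdom f) (hy : (y, y') ∈ f) (hyX : y ∈ H.cl X) : y' ∈ H'.cl (pimage f X) := by
  obtain ⟨Y, hYX, hY, hyY⟩ := hH.2.1 _ _ hyX
  let g := prestrict f Y ∪ {(y, y')}
  have hgf : g ⊆ f := Set.union_subset (fun _ h => h.1) (Set.singleton_subset_iff.2 hy)
  have hgfin : g.Finite := (hf.prestrict_finite hY).union (Set.finite_singleton _)
  obtain ⟨S, hdS, -, hS⟩ := hH.2.2 (pdom g) (hgfin.image _)
  obtain ⟨S', hrS, -, hS'⟩ := hH'.2.2 (prange g) (hgfin.image _)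
  have hyS : y ∈ S := hdS (mem_pdom.2 ⟨y', Or.inr rfl⟩)
  have hyS' : y' ∈ S' := hrS (mem_prange.2 ⟨y, Or.inr rfl⟩)
  have hYg : Y ⊆ pdom g := by
    rw [pdom_union, pdom_prestrict (hYX.trans hX)]
    exact Set.subset_union_left
  have := hC.cl_map _ hS _ hS' (pcut S S' g) ((isPartialEmb_pcut hdS hrS).2 (hf.mono hgf))
    (Subtype.val ⁻¹' Y) ⟨y, hyS⟩ ⟨y', hyS'⟩ (by
      rw [pdom_pcut hrS]; exact Set.preimage_mono hYg) (Or.inr rfl)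
      ((mem_cl_restrict_preimage (hYg.trans hdS)).2 hyY)
  rw [mem_cl_restrict] at this
  refine hH'.1 _ _ ?_ this
  rintro _ ⟨z, ⟨x, hx, hxz⟩, rfl⟩
  exact ⟨x.1, hYX hx, hgf hxz⟩

theorem cl_map_of_locally (hC : IsQuasiminimalExcellent C) (hH : H ∈ locally C)
    (hH' : H' ∈ locally C) {f : Set (H × H')} (hf : IsPartialEmb L f) {X : Set H} {y : H} {y' : H'}
    (hX : X ⊆ pdom f) (hy : (y, y') ∈ f) (hyX : y ∈ H.cl X) : y' ∈ H'.cl (pimage f X) :=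
  hC.cl_map_of_finLocally (locally_subset_finLocally hH) (locally_subset_finLocally hH') hf hX hy hyX

end IsQuasiminimalExcellent

/-! ### Transfer of the axioms to structures locally in the class -/

namespace IsQuasiminimalExcellent

open FirstOrder.Language

variable {L : FirstOrder.Language.{u, v}} {C : Set (ClStructure.{u, v, w} L)}
variable {H H' : ClStructure.{u, v, w} L}

theorem mem_locally_of_iso (hC : IsQuasiminimalExcellent C) (hH : H ∈ locally C)
    (e : H ≃[L] H') (he : IsIso e) : H' ∈ locally C := by
  have hcl : ∀ X : Set H', ∃ Y : Set H, X = e '' Y :=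
    fun X => ⟨e ⁻¹' X, (Set.image_preimage_eq X e.surjective).symm⟩
  obtain ⟨hmono, hfin, hloc⟩ := hH
  refine ⟨fun X Y hXY => ?_, fun X a ha => ?_, fun A hA => ?_⟩
  · obtain ⟨X, rfl⟩ := hcl X
    obtain ⟨Y, rfl⟩ := hcl Y
    rw [he, he]
    exact Set.image_mono (hmono _ _ ((Set.image_subset_image_iff e.injective).1 hXY))
  · obtain ⟨X, rfl⟩ := hcl X
    obtain ⟨a, rfl⟩ := e.surjective a
    obtain ⟨Y, hYX, hY, haY⟩ := hfin X a ((he.mem_iff X a).1 ha)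
    exact ⟨e '' Y, Set.image_mono hYX, hY.image e, (he.mem_iff Y a).2 haY⟩
  · obtain ⟨A, rfl⟩ := hcl A
    obtain ⟨S, hAS, hSc, hScl, hS⟩ := hloc A (by
      rw [← e.injective.preimage_image A]
      exact hA.preimage e.injective)
    refine ⟨S.map e.toEmbedding.toHom, Set.image_mono hAS, hSc.image e, ?_,
      (hC.restrict_map_mem_iff e.toEmbedding he.mem_iff S).1 hS⟩
    refine (he S).trans_subset (Set.image_mono hScl)

theorem exists_restrict_mem_locally (hC : IsQuasiminimalExcellent C) (hH : H ∈ locally C)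
    (X : Set H) : ∃ S : L.Substructure H, (S : Set H) = H.cl X ∧ H.restrict S ∈ locally C := by
  have hp := hC.pregeometry_of_locally hH
  let S : L.Substructure H := ⟨H.cl X, fun {n} f x hx => by
    obtain ⟨T, hT, -, -⟩ := hC.exists_restrict_mem_of_locally hH (Set.countable_range x)
    have : Structure.funMap f x ∈ T := T.fun_mem f x fun i =>
      hT.symm.subset (hp.mem_cl_self (Set.mem_range_self i))
    rw [← SetLike.mem_coe, hT] at this
    exact hp.cl_subset (Set.range_subset_iff.2 hx) this⟩
  refine ⟨S, rfl, fun Y Z hYZ a ha => ?_, fun Y a ha => ?_, fun A hA => ?_⟩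
  · exact hp.mono _ _ (Set.image_mono hYZ) ha
  · obtain ⟨Z, hZY, hZ, haZ⟩ := hp.finite_char _ _ ha
    have hZS : Z ⊆ S := hZY.trans (by rintro _ ⟨y, -, rfl⟩; exact y.2)
    refine ⟨Subtype.val ⁻¹' Z, ?_, hZ.preimage Subtype.val_injective.injOn, ?_⟩
    · intro z hz
      obtain ⟨y, hy, hyz⟩ := hZY hz
      rwa [← Subtype.ext hyz]
    · exact (mem_cl_restrict_preimage hZS).2 haZ
  · obtain ⟨T, hT, hTc, hTC⟩ := hC.exists_restrict_mem_of_locally hH (hA.image Subtype.val)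
    have hAS : Subtype.val '' A ⊆ (S : Set H) := by rintro _ ⟨y, -, rfl⟩; exact y.2
    have hTS : T ≤ S := by
      rw [← SetLike.coe_subset_coe, hT]
      exact hp.cl_subset hAS
    have hmap : (T.comap S.subtype.toHom).map S.subtype.toHom = T :=
      SetLike.coe_injective (Set.image_preimage_eq_of_subset (f := Subtype.val) (by
        rwa [Subtype.range_val]))
    have hval : Subtype.val '' (T.comap S.subtype.toHom : Set S) = T :=
      congrArg (fun T : L.Substructure H => (T : Set H)) hmap
    refine ⟨T.comap S.subtype.toHom, ?_, ?_, ?_, ?_⟩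
    · rintro a ha
      have : a.1 ∈ (T : Set H) := hT ▸ hp.mem_cl_self ⟨a, ha, rfl⟩
      exact this
    · exact hTc.preimage Subtype.val_injective
    · intro a ha
      rw [mem_cl_restrict, hval, hT, hp.idem, ← hT] at ha
      exact ha
    · rw [hC.restrict_map_mem_iff (H := H.restrict S) S.subtype (fun X x => Iff.rfl), hmap]
      exact hTC

theorem homogeneity_generic_of_locally (hC : IsQuasiminimalExcellent C) (hH : H ∈ locally C)
    (hH' : H' ∈ locally C) {g : Set (H × H')} (hg : IsPartialEmb L g)
    (hd : (pdom g).Countable ∧ H.IsCl (pdom g) ∨ pdom g = ∅)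
    (hr : (prange g).Countable ∧ H'.IsCl (prange g) ∨ prange g = ∅) {x : H} {x' : H'}
    (hx : x ∉ H.cl (pdom g)) (hx' : x' ∉ H'.cl (prange g)) :
    IsPartialEmb L (g ∪ {(x, x')}) := by
  have hdc : (pdom g).Countable := hd.elim (fun h => h.1) fun h => by simp [h]
  have hrc : (prange g).Countable := hr.elim (fun h => h.1) fun h => by simp [h]
  obtain ⟨S, hdS, -, -, hS⟩ := hH.2.2 (pdom (g ∪ {(x, x')})) (by
    rw [pdom_union, pdom_singleton]; exact hdc.union (Set.countable_singleton _))
  obtain ⟨S', hrS, -, -, hS'⟩ := hH'.2.2 (prange (g ∪ {(x, x')})) (by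
    rw [prange_union, prange_singleton]; exact hrc.union (Set.countable_singleton _))
  have hgd : pdom g ⊆ S := (pdom_mono Set.subset_union_left).trans hdS
  have hgr : prange g ⊆ S' := (prange_mono Set.subset_union_left).trans hrS
  have hxS : x ∈ S := hdS (mem_pdom.2 ⟨x', Or.inr rfl⟩)
  have hxS' : x' ∈ S' := hrS (mem_prange.2 ⟨x, Or.inr rfl⟩)
  have := hC.homogeneity_generic _ hS _ hS' (pdom (pcut S S' g)) (prange (pcut S S' g))
    (pcut S S' g) (by
      rw [pdom_pcut hgr]
      exact hd.imp (fun h => ⟨h.1.preimage Subtype.val_injective, isCl_preimage hgd h.2⟩)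
        fun h => by rw [h, Set.preimage_empty]) (by
      rw [prange_pcut hgd]
      exact hr.imp (fun h => ⟨h.1.preimage Subtype.val_injective, isCl_preimage hgr h.2⟩)
        fun h => by rw [h, Set.preimage_empty]) ((isPartialEmb_pcut hgd hgr).2 hg) rfl
    pimage_pdom ⟨x, hxS⟩ ⟨x', hxS'⟩ (by
      rw [pdom_pcut hgr, mem_cl_restrict_preimage hgd]; exact hx) (by
      rw [prange_pcut hgd, mem_cl_restrict_preimage hgr]; exact hx')
  rw [← isPartialEmb_pcut hdS hrS]
  refine this.mono ?_
  rintro ⟨a, a'⟩ (h | h)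
  · exact Or.inl h
  · obtain ⟨h₁, h₂⟩ := Prod.ext_iff.1 h
    exact Or.inr (Prod.ext (Subtype.ext h₁) (Subtype.ext h₂))

theorem homogeneity_closure_of_locally (hC : IsQuasiminimalExcellent C) (hH : H ∈ locally C)
    (hH' : H' ∈ locally C) {g f : Set (H × H')} (hg : IsPartialEmb L g)
    (hd : (pdom g).Countable ∧ H.IsCl (pdom g) ∨ pdom g = ∅)
    (hr : (prange g).Countable ∧ H'.IsCl (prange g) ∨ prange g = ∅) (hf : (pdom f).Finite)
    (hgf : IsPartialEmb L (g ∪ f)) {y : H} (hy : y ∈ H.cl (pdom f ∪ pdom g)) :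
    ∃ y', IsPartialEmb L (g ∪ f ∪ {(y, y')}) := by
  have hdc : (pdom g).Countable := hd.elim (fun h => h.1) fun h => by simp [h]
  have hgfc : (g ∪ f).Countable := hgf.countable (by
    rw [pdom_union]; exact hdc.union hf.countable)
  have hp := hC.pregeometry_of_locally hH
  obtain ⟨S, hdS, -, hcl, hS⟩ := hH.2.2 (pdom (g ∪ f)) (hgfc.image _)
  obtain ⟨S', hrS, -, -, hS'⟩ := hH'.2.2 (prange (g ∪ f)) (hgfc.image _)
  have hgd : pdom g ⊆ S := (pdom_mono Set.subset_union_left).trans hdS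
  have hgr : prange g ⊆ S' := (prange_mono Set.subset_union_left).trans hrS
  have hfd : pdom f ⊆ S := (pdom_mono Set.subset_union_right).trans hdS
  have hfr : prange f ⊆ S' := (prange_mono Set.subset_union_right).trans hrS
  have hsub : pdom f ∪ pdom g ⊆ S := Set.union_subset hfd hgd
  have hyS : y ∈ S := hcl (hp.mono _ _ hsub hy)
  obtain ⟨y', hy'⟩ := hC.homogeneity_closure _ hS _ hS' (pdom (pcut S S' g))
    (prange (pcut S S' g)) (pcut S S' g) (by
      rw [pdom_pcut hgr]
      exact hd.imp (fun h => ⟨h.1.preimage Subtype.val_injective, isCl_preimage hgd h.2⟩)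
        fun h => by rw [h, Set.preimage_empty]) (by
      rw [prange_pcut hgd]
      exact hr.imp (fun h => ⟨h.1.preimage Subtype.val_injective, isCl_preimage hgr h.2⟩)
        fun h => by rw [h, Set.preimage_empty]) ((isPartialEmb_pcut hgd hgr).2 hg) rfl
    pimage_pdom (pcut S S' f) (by
      rw [pdom_pcut hfr]; exact hf.preimage Subtype.val_injective.injOn)
    ((isPartialEmb_pcut hdS hrS).2 hgf) ⟨y, hyS⟩ (by
      rw [pdom_pcut hgr, pdom_pcut hfr, ← Set.preimage_union, mem_cl_restrict_preimage hsub]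
      exact hy)
  refine ⟨y'.1, ?_⟩
  rw [← isPartialEmb_pcut (S := S) (S' := S')]
  · refine hy'.mono ?_
    rintro ⟨a, a'⟩ (h | h)
    · exact Or.inl h
    · obtain ⟨h₁, h₂⟩ := Prod.ext_iff.1 h
      exact Or.inr (Prod.ext (Subtype.ext h₁) (Subtype.ext h₂))
  · rw [pdom_union, pdom_singleton]
    exact Set.union_subset hdS (Set.singleton_subset_iff.2 hyS)
  · rw [prange_union, prange_singleton]
    exact Set.union_subset hrS (Set.singleton_subset_iff.2 y'.2)

theorem isCrown_preimage (hp : H.IsPregeometry) {S : L.Substructure H} {K : Set H} (hK : K ⊆ S)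
    (h : H.IsCrown K) : (H.restrict S).IsCrown (Subtype.val ⁻¹' K) := by
  obtain ⟨B, n, D, hB, hDB, rfl⟩ := h
  have hDS : ∀ i, D i ⊆ S := fun i =>
    (hp.subset_cl _).trans ((Set.subset_iUnion (fun i => H.cl (D i)) i).trans hK)
  refine ⟨Subtype.val ⁻¹' B, n, fun i => Subtype.val ⁻¹' D i, fun b hb h => ?_,
    fun i => Set.preimage_mono (hDB i), ?_⟩
  · rw [mem_cl_restrict] at h
    refine hB b.1 hb (hp.mono _ _ ?_ h)
    rintro _ ⟨c, ⟨hc, hcb⟩, rfl⟩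
    exact ⟨hc, fun h => hcb (Subtype.ext h)⟩
  · ext x
    rw [Set.mem_preimage, Set.mem_iUnion, Set.mem_iUnion]
    exact exists_congr fun i => (mem_cl_restrict_preimage (hDS i)).symm

/-- The countable data fit into closed substructures `S` and `S'` from the class. The point is that
the finite set must work for every `f` into `H'`, not only for those with image in `S'`. -/
theorem excellence_of_locally (hC : IsQuasiminimalExcellent C) (hH : H ∈ locally C)
    (hH' : H' ∈ locally C) {g : Set (H × H')} (hK : (pdom g).Countable)
    (hKc : H.IsCrown (pdom g)) (hg : IsClosedPartialEmb g) {X : Set H} (hX : X.Finite)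
    (hXK : X ⊆ H.cl (pdom g)) :
    ∃ K₀ ⊆ pdom g, K₀.Finite ∧ ∀ f : Set (H × H'), pdom f = X →
      IsPartialEmb L (f ∪ prestrict g K₀) → IsPartialEmb L (f ∪ g) := by
  have hp := hC.pregeometry_of_locally hH
  have hp' := hC.pregeometry_of_locally hH'
  obtain ⟨S, hdS, -, hcl, hS⟩ := hH.2.2 _ hK
  obtain ⟨S', hrS, -, hcl', hS'⟩ := hH'.2.2 (prange g) ((hg.1.countable hK).image _)
  have hXS : X ⊆ S := hXK.trans ((hp.mono _ _ hdS).trans hcl)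
  -- Adding to `K₀` finite subsets of the crown that span `X` forces the values of `f` to depend on
  -- values of `g`, hence to lie in the closed set `S'`.
  choose! D hDK hDfin hXD using fun x (hx : x ∈ X) => hp.finite_char _ x (hXK hx)
  have hDfin' : (⋃ x ∈ X, D x).Finite := hX.biUnion hDfin
  have hDK' : ⋃ x ∈ X, D x ⊆ pdom g := Set.iUnion₂_subset hDK
  have hcut : IsClosedPartialEmb (pcut S S' g) := by
    refine ⟨(isPartialEmb_pcut hdS hrS).2 hg.1, fun Y hY hYcl => ?_⟩
    have hYS : Subtype.val '' Y ⊆ (S : Set H) := by rintro _ ⟨y, -, rfl⟩; exact y.2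
    have h₁ : H.IsCl (Subtype.val '' Y) := by
      refine hp.isCl_of_subset fun y hy => ?_
      have hyS : y ∈ S := hcl (hp.mono _ _ hYS hy)
      have : (⟨y, hyS⟩ : S) ∈ (H.restrict S).cl Y := hy
      rw [show (H.restrict S).cl Y = Y from hYcl] at this
      exact ⟨_, this, rfl⟩
    have h₂ : Subtype.val '' Y ⊆ pdom g := by
      rw [pdom_pcut hrS] at hY
      exact Set.image_subset_iff.2 hY
    have h₃ := isCl_preimage (pimage_subset_prange.trans hrS) (hg.2 _ h₂ h₁)
    convert h₃ using 1
    ext z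
    simp only [mem_pimage, Set.mem_preimage]
    constructor
    · rintro ⟨y, hy, hyz⟩
      exact ⟨y.1, ⟨y, hy, rfl⟩, hyz⟩
    · rintro ⟨_, ⟨y, hy, rfl⟩, hyz⟩
      exact ⟨y, hy, hyz⟩
  obtain ⟨K₀, hK₀, hK₀f, h⟩ := hC.excellence _ hS _ hS' (pdom (pcut S S' g)) (by
      rw [pdom_pcut hrS]; exact hK.preimage Subtype.val_injective) (by
      rw [pdom_pcut hrS]; exact isCrown_preimage hp hdS hKc) _ hcut rfl (Subtype.val ⁻¹' X)
    (hX.preimage Subtype.val_injective.injOn) (fun x hx => by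
      rw [pdom_pcut hrS, mem_cl_restrict_preimage hdS]; exact hXK hx)
  rw [pdom_pcut hrS] at hK₀
  refine ⟨Subtype.val '' K₀ ∪ ⋃ x ∈ X, D x,
    Set.union_subset (Set.image_subset_iff.2 hK₀) hDK', (hK₀f.image _).union hDfin', ?_⟩
  intro f hfX hf
  have hfr : prange f ⊆ S' := by
    intro y hy
    obtain ⟨x, hxy⟩ := mem_prange.1 hy
    have hxX : x ∈ X := hfX ▸ mem_pdom.2 ⟨y, hxy⟩
    have h₁ : D x ⊆ pdom (f ∪ prestrict g (Subtype.val '' K₀ ∪ ⋃ x ∈ X, D x)) := by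
      intro d hd
      obtain ⟨d', hd'⟩ := mem_pdom.1 (hDK x hxX hd)
      exact mem_pdom.2 ⟨d', Or.inr ⟨hd', Or.inr (Set.mem_iUnion₂.2 ⟨x, hxX, hd⟩)⟩⟩
    have := hC.cl_map_of_locally hH hH' hf h₁ (Or.inl hxy) (hXD x hxX)
    refine hcl' (hp'.mono _ _ ?_ this)
    rintro d' ⟨d, hd, hdd'⟩
    obtain ⟨d'', hd''⟩ := mem_pdom.1 (hDK x hxX hd)
    have : d' = d'' := hf.eq_right hdd' (Or.inr ⟨hd'', Or.inr (Set.mem_iUnion₂.2 ⟨x, hxX, hd⟩)⟩)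
    exact hrS (this ▸ mem_prange.2 ⟨d, hd''⟩)
  have hfd : pdom f ⊆ S := hfX ▸ hXS
  have h₀ : prestrict g (Subtype.val '' K₀ ∪ ⋃ x ∈ X, D x) ⊆ g := fun _ h => h.1
  have h₁ : pdom (f ∪ prestrict g (Subtype.val '' K₀ ∪ ⋃ x ∈ X, D x)) ⊆ S := by
    rw [pdom_union]; exact Set.union_subset hfd ((pdom_mono h₀).trans hdS)
  have h₂ : prange (f ∪ prestrict g (Subtype.val '' K₀ ∪ ⋃ x ∈ X, D x)) ⊆ S' := by
    rw [prange_union]; exact Set.union_subset hfr ((prange_mono h₀).trans hrS)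
  have := h (pcut S S' f) (by rw [pdom_pcut hfr, hfX])
    (((isPartialEmb_pcut h₁ h₂).2 hf).mono (by
      rintro ⟨a, a'⟩ (ha | ha)
      · exact Or.inl ha
      · exact Or.inr ⟨ha.1, Or.inl ⟨a, ha.2, rfl⟩⟩))
  exact (isPartialEmb_pcut (S := S) (S' := S') (by
    rw [pdom_union]; exact Set.union_subset hfd hdS) (by
    rw [prange_union]; exact Set.union_subset hfr hrS)).1 this

/-- Passing to `locally C` keeps all the axioms while making membership depend only on countable
subsets; this is the class that the sentence axiomatises. -/
theorem locally (hC : IsQuasiminimalExcellent C) : IsQuasiminimalExcellent (locally C) where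
  isoClosed _ hH _ e he := hC.mem_locally_of_iso hH e he
  pregeometry _ hH := hC.pregeometry_of_locally hH
  ccp _ hH X hX := by
    obtain ⟨S, hS, hSc, -⟩ := hC.exists_restrict_mem_of_locally hH hX.countable
    rwa [← hS]
  cl_mem _ hH X := by
    obtain ⟨S, hS, hSC⟩ := hC.exists_restrict_mem_locally hH X
    exact ⟨S, hS, _, hSC⟩
  cl_map _ hH _ hH' _ hf _ _ _ hX hy hyX := hC.cl_map_of_locally hH hH' hf hX hy hyX
  homogeneity_generic _ hH _ hH' G G' g hG hG' hg hgG hgG' x x' hx hx' := by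
    subst hgG
    rw [pimage_pdom] at hgG'
    subst hgG'
    exact hC.homogeneity_generic_of_locally hH hH' hg hG hG' hx hx'
  homogeneity_closure _ hH _ hH' G G' g hG hG' hg hgG hgG' f hf hgf y hy := by
    subst hgG
    rw [pimage_pdom] at hgG'
    subst hgG'
    exact hC.homogeneity_closure_of_locally hH hH' hg hG hG' hf hgf hy
  excellence _ hH _ hH' K hK hKc g hg hgK X hX hXK := by
    subst hgK
    exact hC.excellence_of_locally hH hH' hK hKc hg hX hXK

end IsQuasiminimalExcellent

/-! ## Definability of the closure and Scott sentences -/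

namespace LQFormula

variable {L : FirstOrder.Language.{u, v}}

/-- Countable structures with the extension property for finite partial maps have Scott sentences. -/
theorem exists_isScottSentence [Countable L.Symbols] [IsEmpty (L.Relations 0)] {M : Type w}
    [L.Structure M] [Countable M]
    (hM : ∀ f : Set (M × M), IsPartialEmb L f → f.Finite → ∀ x, ∃ y,
      IsPartialEmb L (f ∪ {(x, y)})) : ∃ σ : LQFormula L 0, IsScottSentence σ M := by
  choose δ hδqf hδ using fun (n : ℕ) (a : Fin n → M) => exists_diagram (L := L) a
  -- the one-point extension property at the tuple `a`
  let θ : ∀ n (_ : Fin n → M), LQFormula L n := fun n a =>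
    (neg (δ n a)).or ((conj fun c : M => ex (δ (n + 1) (Fin.snoc a c))).and
      (all (disj fun c : M => δ (n + 1) (Fin.snoc a c))))
  have hθ : ∀ {N : Type w} [L.Structure N] n (a : Fin n → M) (b : Fin n → N),
      (θ n a).Realize b ↔ (AtEq L a b →
        (∀ c, ∃ d, AtEq L (Fin.snoc a c : Fin (n + 1) → M) (Fin.snoc b d : Fin (n + 1) → N)) ∧
        ∀ d, ∃ c, AtEq L (Fin.snoc a c : Fin (n + 1) → M)
          (Fin.snoc b d : Fin (n + 1) → N)) := by
    intro N _ n a b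
    simp only [θ, realize_or, realize_and, realize_conj, realize_all, realize_disj, Realize, hδ,
      imp_iff_not_or]
  have hδn : ∀ n a, (δ n a).NoQ := fun n a => (hδqf n a).noQ
  have hθn : ∀ n a, (θ n a).NoQ := by
    intro n a i
    have h₁ : (conj fun c : M => ex (δ (n + 1) (Fin.snoc a c))).NoQ := noQ_conj fun c => hδn _ _
    have h₂ : (disj fun c : M => δ (n + 1) (Fin.snoc a c)).NoQ := noQ_disj fun c => hδn _ _
    show LQFormula.NoQ (ite _ _ _)
    split_ifs
    · exact hδn _ _
    · intro j
      show LQFormula.NoQ (ite _ _ _)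
      split_ifs
      exacts [h₁, h₂]
  -- The formulas `θ` are conditional on the right atomic type, so the diagram of the empty tuple is
  -- needed to start the back-and-forth.
  let σ : LQFormula L 0 := (δ 0 Fin.elim0).and
    (conj fun p : Σ n, Fin n → M => alls p.1 (θ p.1 p.2))
  have hσ : ∀ (N : Type w) [L.Structure N], SatisfiesSentence N σ ↔
      AtEq L (Fin.elim0 : Fin 0 → M) (Fin.elim0 : Fin 0 → N) ∧
      ∀ n (a : Fin n → M) (b : Fin n → N), (θ n a).Realize b := by
    intro N _
    simp only [SatisfiesSentence, σ, realize_and, realize_conj, realize_alls, hδ, Sigma.forall]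
  have hσn : σ.NoQ := by
    intro i
    show LQFormula.NoQ (ite _ _ _)
    split_ifs
    · exact hδn _ _
    · exact noQ_conj fun p => noQ_alls (hθn _ _)
  refine ⟨σ, hσn, fun N _ _ => ⟨fun h => ?_, fun ⟨e⟩ => (satisfiesSentence_equiv e hσn).2 ?_⟩⟩
  -- In a countable model `N`, pairs of finite tuples with equal diagrams form a back-and-forth
  -- system, because `N` satisfies all the `θ`.
  · obtain ⟨h₀, h⟩ := (hσ N).1 h
    let P : Set (Set (N × M)) := {f | ∃ (n : ℕ) (a : Fin n → M) (b : Fin n → N),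
      AtEq L a b ∧ f = Set.range fun i => (b i, a i)}
    have hsnoc : ∀ {n} (a : Fin n → M) (b : Fin n → N) c d,
        (Set.range fun i => (b i, a i)) ∪ {(d, c)} ⊆ Set.range fun i : Fin (n + 1) =>
          ((Fin.snoc b d : Fin (n + 1) → N) i, (Fin.snoc a c : Fin (n + 1) → M) i) := by
      rintro n a b c d _ (⟨i, rfl⟩ | rfl)
      · exact ⟨i.castSucc, by simp⟩
      · exact ⟨Fin.last n, by simp⟩
    have hstep : ∀ {n} (a : Fin n → M) (b : Fin n → N) c d,
        AtEq L (Fin.snoc a c : Fin (n + 1) → M) (Fin.snoc b d : Fin (n + 1) → N) →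
        ∃ f' ∈ P, (Set.range fun i => (b i, a i)) ⊆ f' ∧ (d, c) ∈ f' := fun {n} a b c d h =>
      ⟨_, ⟨n + 1, _, _, h, rfl⟩, Set.subset_union_left.trans (hsnoc a b c d),
        hsnoc a b c d (Or.inr rfl)⟩
    obtain ⟨S, hSP, hS, -, hd, hr⟩ := exists_backAndForth P ⟨0, _, _, h₀, rfl⟩
      (Set.countable_univ (α := N)) (Set.countable_univ (α := M)) (by
        rintro _ ⟨n, a, b, hab, rfl⟩ d -
        obtain ⟨c, hc⟩ := ((hθ n a b).1 (h n a b) hab).2 d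
        obtain ⟨f', hf', h₁, h₂⟩ := hstep a b c d hc
        exact ⟨f', hf', h₁, mem_pdom.2 ⟨c, h₂⟩⟩) (by
        rintro _ ⟨n, a, b, hab, rfl⟩ c -
        obtain ⟨d, hd⟩ := ((hθ n a b).1 (h n a b) hab).1 c
        obtain ⟨f', hf', h₁, h₂⟩ := hstep a b c d hd
        exact ⟨f', hf', h₁, mem_prange.2 ⟨d, h₂⟩⟩)
    obtain ⟨e, -⟩ := (isPartialEmb_sUnion (L := L) hS (by
      intro f hf
      obtain ⟨n, a, b, hab, rfl⟩ := hSP hf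
      exact hab.symm.isPartialEmb)).exists_equiv (Set.univ_subset_iff.1 hd)
      (Set.univ_subset_iff.1 hr)
    exact ⟨e⟩
  -- `M` satisfies its own extension conditions: two tuples of `M` with the same diagram form a
  -- finite partial embedding, and `hM` extends it in either direction.
  · refine (hσ M).2 ⟨AtEq.refl _, fun n a b => (hθ n a b).2 fun hab => ?_⟩
    have key : ∀ (a b : Fin n → M), AtEq L a b → ∀ c, ∃ d,
        AtEq L (Fin.snoc a c : Fin (n + 1) → M) (Fin.snoc b d : Fin (n + 1) → M) := by
      intro a b hab c
      obtain ⟨d, hd⟩ := hM _ hab.isPartialEmb (Set.finite_range _) c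
      refine ⟨d, hd.atEq fun i => ?_⟩
      refine Fin.lastCases ?_ (fun i => ?_) i
      · simp
      · left
        exact ⟨i, by simp⟩
    refine ⟨key a b hab, fun d => ?_⟩
    obtain ⟨c, hc⟩ := key b a hab.symm d
    exact ⟨c, hc.symm⟩

end LQFormula

namespace IsQuasiminimalExcellent

variable {L : FirstOrder.Language.{u, v}} {C : Set (ClStructure.{u, v, w} L)}
variable {H H' : ClStructure.{u, v, w} L}

theorem countable_of_hasDim (hC : IsQuasiminimalExcellent C) (hH : H ∈ C) {κ : Cardinal.{w}}
    (hκ : κ ≤ ℵ₀) (h : H.HasDim κ) : Countable H := by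
  obtain ⟨B, -, hBu, rfl⟩ := h
  have := hC.cl_countable hH (X := B) (Cardinal.le_aleph0_iff_set_countable.1 hκ)
  rw [hBu] at this
  exact Set.countable_univ_iff.1 this

theorem exists_isScottSentence [Countable L.Symbols] [IsEmpty (L.Relations 0)]
    (hC : IsQuasiminimalExcellent C) (hH : H ∈ C) [Countable H] :
    ∃ σ : LQFormula L 0, IsScottSentence σ H :=
  LQFormula.exists_isScottSentence fun _ hf hfin x => hC.exists_extend_self hH hf hfin x

theorem _root_.ClStructure.IsPregeometry.hasDim_restrict (hp : H.IsPregeometry)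
    {S : L.Substructure H} {B : Set H} (hS : (S : Set H) = H.cl B) (hB : H.Indep B) :
    (H.restrict S).HasDim #B := by
  have hBS : B ⊆ S := hS ▸ hp.subset_cl B
  refine ⟨Subtype.val ⁻¹' B, fun b hb h => ?_, ?_, ?_⟩
  · rw [mem_cl_restrict] at h
    refine hB b.1 hb (hp.mono _ _ ?_ h)
    rintro _ ⟨c, ⟨hc, hcb⟩, rfl⟩
    exact ⟨hc, fun h => hcb (Subtype.ext h)⟩
  · refine Set.eq_univ_of_forall fun x => (mem_cl_restrict_preimage hBS).2 ?_
    rw [← hS]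
    exact x.2
  · exact Cardinal.mk_congr ((Equiv.subtypeSubtypeEquivSubtype fun h => hBS h))

/-- There is a model of any dimension up to that of a given model. -/
theorem exists_hasDim (hC : IsQuasiminimalExcellent C) (hH : H ∈ C) {κ μ : Cardinal.{w}}
    (h : H.HasDim κ) (hμ : μ ≤ κ) : ∃ H' ∈ C, H'.HasDim μ := by
  have hp := hC.pregeometry H hH
  obtain ⟨B, hB, -, rfl⟩ := h
  obtain ⟨B', hB'B, hB'⟩ := Cardinal.le_mk_iff_exists_subset.1 hμ
  obtain ⟨S, hS, hSC⟩ := hC.exists_restrict_mem hH B'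
  exact ⟨_, hSC, hB' ▸ hp.hasDim_restrict hS (hp.indep_mono hB hB'B)⟩

theorem exists_hasDim_of_infinite (hC : IsQuasiminimalExcellent C)
    (hinf : HasInfiniteDimensionalModel C) (n : ℕ∞) : ∃ H ∈ C, H.HasDim (n : Cardinal.{w}) := by
  obtain ⟨H, hH, κ, hκ, h⟩ := hinf
  exact hC.exists_hasDim hH h ((Cardinal.ofENat_le_aleph0 n).trans hκ)

theorem range_pair {α : Type*} {X Y : Type w} (a : α → X) (b : α → Y) :
    pdom (Set.range fun i => (a i, b i)) = Set.range a ∧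
    prange (Set.range fun i => (a i, b i)) = Set.range b := by
  constructor
  · ext x; simp
  · ext x; simp

/-- The closure operations are quantifier-free definable. -/
theorem exists_definesClosure [Countable L.Symbols] (hC : IsQuasiminimalExcellent C)
    (hinf : HasInfiniteDimensionalModel C) :
    ∃ π : ∀ n : ℕ, LQFormula L (n + 1), DefinesClosure C π := by
  obtain ⟨M, hM, hMdim⟩ := hC.exists_hasDim_of_infinite hinf ⊤
  have : Countable M := hC.countable_of_hasDim hM (by simp) hMdim
  have hMfg : ¬ M.FinGen := by
    obtain ⟨B, hB, -, hBc⟩ := hMdim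
    refine (hC.pregeometry M hM).not_finGen hB ?_
    rw [← Set.infinite_coe_iff, Cardinal.infinite_iff, hBc]
    simp
  choose δ hδqf hδ using fun (n : ℕ) (a : Fin n → M) => LQFormula.exists_diagram (L := L) a
  -- The formula lists the atomic types of dependent tuples in the countable infinite-dimensional
  -- model `M`. No type is missed: generic elements never run out in `M`, so every finite tuple of
  -- any member of the class has a copy there.
  refine ⟨fun n => LQFormula.disj fun p : {p : (Fin n → M) × M // p.2 ∈ M.cl (Set.range p.1)} =>
    δ (n + 1) (Fin.snoc p.1.1 p.1.2), fun n => ⟨LQFormula.isQF_disj fun p => hδqf _ _, ?_⟩⟩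
  intro H hH b a
  simp only [LQFormula.realize_disj, hδ]
  have hset : ∀ {X : Type w} (b : Fin n → X) (a : X), Set.range (Fin.snoc b a : Fin (n + 1) → X) =
      insert a (Set.range b) := fun b a => Fin.range_snoc ..
  constructor
  · intro ha
    -- embed the tuple into the model of dimension `ℵ₀`
    have key : ∀ s : Set H, s.Finite → ∃ f : Set (H × M), IsPartialEmb L f ∧ f.Finite ∧
        pdom f = s := by
      intro s hs
      induction s, hs using Set.Finite.induction_on with
      | empty => exact ⟨∅, isPartialEmb_empty, Set.finite_empty, pdom_empty⟩
      | @insert x s hxs hs ih =>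
        obtain ⟨f, hf, hfin, rfl⟩ := ih
        obtain ⟨y, hy⟩ := hC.exists_extend_of_not_finGen hH hM hMfg hf hfin x
        exact ⟨_, hy, hfin.union (Set.finite_singleton _), by
          rw [pdom_union, pdom_singleton, Set.union_comm, ← Set.insert_eq]⟩
    obtain ⟨f, hf, -, hfd⟩ := key _ (Set.finite_range (Fin.snoc b a : Fin (n + 1) → H))
    have hex : ∀ x ∈ Set.range (Fin.snoc b a : Fin (n + 1) → H), ∃ y, (x, y) ∈ f :=
      fun x hx => mem_pdom.1 (hfd ▸ hx)
    rw [hset] at hex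
    choose b' hb' using fun i => hex (b i) (Or.inr ⟨i, rfl⟩)
    obtain ⟨a', ha'⟩ := hex a (Or.inl rfl)
    refine ⟨⟨(b', a'), ?_⟩, AtEq.symm (hf.atEq fun i => ?_)⟩
    · have := (hC.mem_cl_iff hH hM hf (g := Set.range fun i => (b i, b' i))
        (by rintro _ ⟨i, rfl⟩; exact hb' i) ha').1 (by rwa [(range_pair b b').1])
      rwa [(range_pair b b').2] at this
    · refine Fin.lastCases ?_ (fun i => ?_) i
      · simpa using ha'
      · simpa using hb' i
  · rintro ⟨⟨⟨b', a'⟩, ha'⟩, h⟩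
    have := (hC.mem_cl_iff hM hH h.isPartialEmb (g := Set.range fun i => (b' i, b i))
      (x := a') (y := a) (by rintro _ ⟨i, rfl⟩; exact ⟨i.castSucc, by simp⟩)
      ⟨Fin.last n, by simp⟩).1 (by rwa [(range_pair b' b).1])
    rwa [(range_pair b' b).2] at this

end IsQuasiminimalExcellent

/-! ## The models of the sentence -/

namespace LQFormula

open FirstOrder.Language

variable {L : FirstOrder.Language.{u, v}}

theorem realize_snoc_embedding {M N : Type w} [L.Structure M] [L.Structure N] {n : ℕ}
    {φ : LQFormula L (n + 1)} (hφ : φ.IsQF) (e : M ↪[L] N) (b : Fin n → M) (a : M) :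
    φ.Realize (Fin.snoc (e ∘ b) (e a) : Fin (n + 1) → N) ↔
      φ.Realize (Fin.snoc b a : Fin (n + 1) → M) := by
  rw [← Fin.comp_snoc]
  exact (realize_iff_of_atEq hφ (atEq_embedding e _)).symm

end LQFormula

namespace IsQuasiminimalExcellent

open FirstOrder.Language

variable {L : FirstOrder.Language.{u, v}} {C : Set (ClStructure.{u, v, w} L)}
variable {H H' : ClStructure.{u, v, w} L} {π : ∀ n : ℕ, LQFormula L (n + 1)}

theorem cl_eq_of_definesClosure (hC : IsQuasiminimalExcellent C) (hπ : DefinesClosure C π)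
    (hH : H ∈ C) (X : Set H) : H.cl X = {a | ∃ (n : ℕ) (b : Fin n → H), (∀ i, b i ∈ X) ∧
      (π n).Realize (Fin.snoc b a : Fin (n + 1) → H)} := by
  have hp := hC.pregeometry H hH
  ext a
  constructor
  · intro ha
    obtain ⟨Y, hYX, hY, haY⟩ := hp.finite_char _ _ ha
    obtain ⟨n, f, rfl⟩ := hY.fin_embedding
    exact ⟨n, f, fun i => hYX ⟨i, rfl⟩, ((hπ n).2 H hH f a).1 haY⟩
  · rintro ⟨n, b, hb, h⟩
    exact hp.mono _ _ (Set.range_subset_iff.2 hb) (((hπ n).2 H hH b a).2 h)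

/-- Quantifier-free formulas and the induced closure have the same meaning in a substructure from
the class as in the whole structure. -/
theorem definesClosure_locally (hπ : DefinesClosure C π) : DefinesClosure (ClStructure.locally C) π := by
  refine fun n => ⟨(hπ n).1, fun H hH b a => ?_⟩
  obtain ⟨S, hS, -, -, hSC⟩ := hH.2.2 (insert a (Set.range b))
    ((Set.finite_range b).insert a).countable
  have hbS : Set.range b ⊆ S := (Set.subset_insert _ _).trans hS
  have haS : a ∈ S := hS (Set.mem_insert _ _)
  let b' : Fin n → S := fun i => ⟨b i, hbS ⟨i, rfl⟩⟩
  have hb' : S.subtype ∘ b' = b := rfl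
  have hr : Subtype.val '' Set.range b' = Set.range b := by
    rw [← Set.range_comp]; rfl
  have h₁ := (hπ n).2 _ hSC b' ⟨a, haS⟩
  have h₂ := LQFormula.realize_snoc_embedding (hπ n).1 S.subtype b' ⟨a, haS⟩
  rw [mem_cl_restrict, hr] at h₁
  exact h₁.trans h₂.symm

/-- Models which are not finitely generated satisfy the same sentences of `L_{ω₁,ω}`. -/
theorem satisfiesSentence_iff_of_not_finGen (hC : IsQuasiminimalExcellent C) (hH : H ∈ C)
    (hH' : H' ∈ C) (h : ¬ H.FinGen) (h' : ¬ H'.FinGen) {σ : LQFormula L 0} (hσ : σ.NoQ) :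
    SatisfiesSentence H σ ↔ SatisfiesSentence H' σ := by
  have forth : ∀ {H H' : ClStructure.{u, v, w} L} (_ : H ∈ C) (_ : H' ∈ C) (_ : ¬ H'.FinGen)
      (n : ℕ) (a : Fin n → H) (b : Fin n → H'), IsPartialEmb L (Set.range fun i => (a i, b i)) →
      ∀ x, ∃ y, AtEq L (Fin.snoc a x : Fin (n + 1) → H) (Fin.snoc b y : Fin (n + 1) → H') := by
    intro H H' hH hH' h' n a b hab x
    obtain ⟨y, hy⟩ := hC.exists_extend_of_not_finGen hH hH' h' hab (Set.finite_range _) x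
    refine ⟨y, hy.atEq fun i => ?_⟩
    refine Fin.lastCases ?_ (fun i => ?_) i
    · simp
    · left
      exact ⟨i, by simp⟩
  refine LQFormula.realize_iff_of_backAndForth (fun n a b => AtEq L a b) (fun _ _ _ h => h)
    (fun n a b hab => forth hH hH' h' n a b hab.isPartialEmb) (fun n a b hab y => ?_) hσ ?_
  · obtain ⟨x, hx⟩ := forth hH' hH h n b a hab.symm.isPartialEmb y
    exact ⟨x, hx.symm⟩
  -- Partial embeddings say nothing about the empty tuple, so agreement on closed terms is obtained
  -- by adding one point and forgetting it. The structure has a point because an empty structure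
  -- would be finitely generated.
  · have : Nonempty H := by
      by_contra hne
      rw [not_nonempty_iff] at hne
      exact h ⟨∅, Set.finite_empty, Set.eq_univ_of_forall fun x => hne.elim x⟩
    obtain ⟨x⟩ := this
    obtain ⟨y, hy⟩ := forth hH hH' h' 0 Fin.elim0 Fin.elim0 (isPartialEmb_empty.mono (by
      rintro _ ⟨i, -⟩; exact i.elim0)) x
    have := hy.comp (Fin.elim0 : Fin 0 → Fin 1)
    rwa [Subsingleton.elim (_ ∘ Fin.elim0) (Fin.elim0 : Fin 0 → H),
      Subsingleton.elim (_ ∘ Fin.elim0) (Fin.elim0 : Fin 0 → H')] at this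

theorem not_finGen_of_hasDim (hC : IsQuasiminimalExcellent C) (hH : H ∈ C) {κ : Cardinal.{w}}
    (hκ : ℵ₀ ≤ κ) (h : H.HasDim κ) : ¬ H.FinGen := by
  obtain ⟨B, hB, -, rfl⟩ := h
  refine (hC.pregeometry H hH).not_finGen hB ?_
  rwa [← Set.infinite_coe_iff, Cardinal.infinite_iff]

theorem not_finGen_of_not_countable (hC : IsQuasiminimalExcellent C) (hH : H ∈ C)
    (h : ¬ Countable H) : ¬ H.FinGen := by
  rintro ⟨F, hF, hFu⟩
  have := hC.ccp H hH F hF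
  rw [hFu] at this
  exact h (Set.countable_univ_iff.1 this)

theorem satisfiesSentence_classSentence_iff {M : Type w} [L.Structure M] {σ : ℕ∞ → LQFormula L 0} :
    SatisfiesSentence M (classSentence σ π) ↔ (∃ n, SatisfiesSentence M (σ n)) ∧
      ∀ (n : ℕ) (b : Fin n → M),
        {a : M | (π n).Realize (Fin.snoc b a : Fin (n + 1) → M)}.Countable := by
  simp only [SatisfiesSentence, classSentence, LQFormula.realize_and, LQFormula.realize_or,
    LQFormula.realize_iOr, LQFormula.Realize, LQFormula.realize_alls, not_not]
  refine and_congr_left fun _ => ?_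
  constructor
  · rintro (h | ⟨n, h⟩)
    exacts [⟨_, h⟩, ⟨_, h⟩]
  · rintro ⟨n, h⟩
    induction n using ENat.recTopCoe with
    | top => exact Or.inl h
    | coe n => exact Or.inr ⟨n, h⟩

variable {M : ℕ∞ → ClStructure.{u, v, w} L} {σ : ℕ∞ → LQFormula L 0}

/-- A countable member lies in `C`, so its dimension selects the sentence `σ n`. An uncountable
member is infinite-dimensional, hence agrees with `M ⊤` on sentences without `Q`. Countability of
the closures gives the clauses with `Q`. -/
theorem locally_subset_modClass [IsEmpty (L.Relations 0)] (hC : IsQuasiminimalExcellent C)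
    (hM : ∀ n, M n ∈ C ∧ (M n).HasDim (n : Cardinal.{w})) (hπ : DefinesClosure C π)
    (hσ : ∀ n, IsScottSentence (σ n) (M n)) :
    ClStructure.locally C ⊆ modClass.{u, v, w} (classSentence σ π) π := by
  intro H hH
  have hπ' := definesClosure_locally hπ
  refine ⟨satisfiesSentence_classSentence_iff.2 ⟨?_, fun n b => ?_⟩,
    hC.locally.cl_eq_of_definesClosure hπ' hH⟩
  · by_cases hc : Countable H
    · have hHC := hC.mem_of_countable hH
      obtain ⟨B, hB, hBu⟩ := (hC.pregeometry H hHC).exists_basis_univ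
      obtain ⟨n, hn⟩ : ∃ n : ℕ∞, (n : Cardinal.{w}) = #B := by
        have : #B ≤ ℵ₀ := Cardinal.le_aleph0_iff_set_countable.2 (B.to_countable)
        rcases this.lt_or_eq with h | h
        · obtain ⟨n, hn⟩ := Cardinal.lt_aleph0.1 h
          exact ⟨n, by simp [hn]⟩
        · exact ⟨⊤, by simp [h]⟩
      obtain ⟨e, -⟩ := hC.exists_iso_of_hasDim hHC (hM n).1 ⟨B, hB, hBu, hn.symm⟩ (hM n).2
      exact ⟨n, ((hσ n).2 H).2 ⟨e⟩⟩
    · refine ⟨⊤, ?_⟩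
      have hMc := hC.countable_of_hasDim (hM ⊤).1 (by simp) (hM ⊤).2
      rw [hC.locally.satisfiesSentence_iff_of_not_finGen hH (hC.subset_locally (hM ⊤).1)
        (hC.locally.not_finGen_of_not_countable hH hc)
        (hC.not_finGen_of_hasDim (hM ⊤).1 (by simp) (hM ⊤).2) (hσ ⊤).1]
      exact ((hσ ⊤).2 (M ⊤)).2 ⟨Language.Equiv.refl L _⟩
  · have := hC.locally.ccp H hH _ (Set.finite_range b)
    convert this using 1
    ext a
    exact ((hπ' n).2 H hH b a).symm

/-- A Scott sentence determines only countable structures, so a given countable set is enclosed in a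
countable closed model of `σ n`. That model is a copy of `M n`, and its induced closure is the right
one because both closures are defined by the quantifier-free formulas `π`. -/
theorem modClass_subset_locally [Countable L.Symbols] (hC : IsQuasiminimalExcellent C)
    (hM : ∀ n, M n ∈ C ∧ (M n).HasDim (n : Cardinal.{w})) (hπ : DefinesClosure C π)
    (hσ : ∀ n, IsScottSentence (σ n) (M n)) :
    modClass.{u, v, w} (classSentence σ π) π ⊆ ClStructure.locally C := by
  rintro H ⟨hHs, hcl⟩
  obtain ⟨⟨n, hn⟩, hcount⟩ := satisfiesSentence_classSentence_iff.1 hHs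
  have hmono : ∀ X Y : Set H, X ⊆ Y → H.cl X ⊆ H.cl Y := by
    intro X Y hXY
    rw [hcl, hcl]
    rintro a ⟨n, b, hb, h⟩
    exact ⟨n, b, fun i => hXY (hb i), h⟩
  have hfin : ∀ (X : Set H) (a : H), a ∈ H.cl X → ∃ Y ⊆ X, Y.Finite ∧ a ∈ H.cl Y := by
    intro X a ha
    rw [hcl] at ha
    obtain ⟨n, b, hb, h⟩ := ha
    refine ⟨Set.range b, Set.range_subset_iff.2 hb, Set.finite_range b, ?_⟩
    rw [hcl]
    exact ⟨n, b, fun i => ⟨i, rfl⟩, h⟩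
  have hccp : ∀ F : Set H, F.Finite → (H.cl F).Countable := by
    intro F hF
    have : Finite F := hF
    refine (Set.countable_iUnion fun p : Σ n, Fin n → F =>
      hcount p.1 (Subtype.val ∘ p.2)).mono ?_
    rw [hcl]
    rintro a ⟨n, b, hb, h⟩
    exact Set.mem_iUnion.2 ⟨⟨n, fun i => ⟨b i, hb i⟩⟩, h⟩
  refine ⟨hmono, hfin, fun A hA => ?_⟩
  -- Closures of finite sets are countable, so `H.cl` itself can be taken as the additional closure
  -- condition.
  obtain ⟨S, hAS, hSc, hSσ, hScl⟩ := LQFormula.exists_countable_substructure (hσ n).1 hn H.cl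
    hccp hA
  refine ⟨S, hAS, hSc, fun a ha => ?_, ?_⟩
  · obtain ⟨Y, hYS, hY, haY⟩ := hfin _ a ha
    exact hScl Y hYS hY haY
  · have : Countable S := hSc.to_subtype
    obtain ⟨e⟩ := ((hσ n).2 S).1 hSσ
    refine hC.isoClosed (M n) (hM n).1 (H.restrict S) e.symm
      (isIso_of_forall_mem_iff (H' := H.restrict S) e.symm fun X x => ?_)
    let j : M n ↪[L] H := S.subtype.comp e.symm.toEmbedding
    have hj : Subtype.val '' (e.symm '' X) = j '' X := by
      rw [← Set.image_comp]; rfl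
    rw [mem_cl_restrict, hj, hcl, hC.cl_eq_of_definesClosure hπ (hM n).1]
    constructor
    · rintro ⟨k, b, hb, h⟩
      choose c hc hcb using hb
      obtain rfl : j ∘ c = b := funext hcb
      exact ⟨k, c, hc, (LQFormula.realize_snoc_embedding (hπ k).1 j c x).1 h⟩
    · rintro ⟨k, c, hc, h⟩
      exact ⟨k, j ∘ c, fun i => ⟨c i, hc i, rfl⟩,
        (LQFormula.realize_snoc_embedding (hπ k).1 j c x).2 h⟩

end IsQuasiminimalExcellent

/-! ## Finitely local structures -/

namespace IsQuasiminimalExcellent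

open FirstOrder.Language

variable {L : FirstOrder.Language.{u, v}} {C : Set (ClStructure.{u, v, w} L)}
variable {H H' : ClStructure.{u, v, w} L}

theorem exists_extend_of_mem_of_finLocally (hC : IsQuasiminimalExcellent C)
    (hH : H ∈ finLocally C) (hH' : H' ∈ finLocally C) {f : Set (H × H')} (hf : IsPartialEmb L f)
    (hfin : f.Finite) {x : H} (hx : x ∈ H.cl (pdom f)) :
    ∃ y ∈ H'.cl (prange f), IsPartialEmb L (f ∪ {(x, y)}) := by
  have hp := hC.pregeometry_of_finLocally hH
  obtain ⟨S, hdS, hcl, hS⟩ := hH.2.2 (pdom f) (hfin.image _)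
  obtain ⟨S', hrS, -, hS'⟩ := hH'.2.2 (prange f) (hfin.image _)
  have hxS : x ∈ S := hcl (hp.mono _ _ hdS hx)
  have hcut := (isPartialEmb_pcut hdS hrS).2 hf
  have hcutfin : (pcut S S' f).Finite := hfin.preimage
    (f := fun p : H.restrict S × H'.restrict S' => (p.1.1, p.2.1)) fun p _ q _ h =>
      Prod.ext (Subtype.ext (congrArg Prod.fst h)) (Subtype.ext (congrArg Prod.snd h))
  obtain ⟨y, hy⟩ := hC.exists_extend_of_mem hS hS' hcut hcutfin (x := ⟨x, hxS⟩) (by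
    rw [pdom_pcut hrS]; exact (mem_cl_restrict_preimage hdS).2 hx)
  have hxy : IsPartialEmb L (f ∪ {(x, y.1)}) := by
    rw [← isPartialEmb_pcut (S := S) (S' := S')]
    · refine hy.mono ?_
      rintro ⟨a, a'⟩ (h | h)
      · exact Or.inl h
      · obtain ⟨h₁, h₂⟩ := Prod.ext_iff.1 h
        exact Or.inr (Prod.ext (Subtype.ext h₁) (Subtype.ext h₂))
    · rw [pdom_union, pdom_singleton]
      exact Set.union_subset hdS (Set.singleton_subset_iff.2 hxS)
    · rw [prange_union, prange_singleton]
      exact Set.union_subset hrS (Set.singleton_subset_iff.2 y.2)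
  refine ⟨y, ?_, hxy⟩
  have := hC.cl_map_of_finLocally hH hH' hxy (pdom_mono Set.subset_union_left) (Or.inr rfl) hx
  refine (hC.pregeometry_of_finLocally hH').mono _ _ ?_ this
  rintro b ⟨a, ha, hab⟩
  obtain ⟨b', hb'⟩ := mem_pdom.1 ha
  rw [hxy.eq_right hab (Or.inl hb')]
  exact mem_prange.2 ⟨a, hb'⟩

theorem isPartialEmb_union_of_notMem_of_finLocally (hC : IsQuasiminimalExcellent C)
    (hH : H ∈ finLocally C) (hH' : H' ∈ finLocally C) {f : Set (H × H')} (hf : IsPartialEmb L f)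
    (hfin : f.Finite) {x : H} {y : H'} (hx : x ∉ H.cl (pdom f)) (hy : y ∉ H'.cl (prange f)) :
    IsPartialEmb L (f ∪ {(x, y)}) := by
  have hfin' : (f ∪ {(x, y)}).Finite := hfin.union (Set.finite_singleton _)
  obtain ⟨S, hdS, -, hS⟩ := hH.2.2 (pdom (f ∪ {(x, y)})) (hfin'.image _)
  obtain ⟨S', hrS, -, hS'⟩ := hH'.2.2 (prange (f ∪ {(x, y)})) (hfin'.image _)
  have hfd : pdom f ⊆ S := (pdom_mono Set.subset_union_left).trans hdS
  have hfr : prange f ⊆ S' := (prange_mono Set.subset_union_left).trans hrS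
  have hxS : x ∈ S := hdS (mem_pdom.2 ⟨y, Or.inr rfl⟩)
  have hyS : y ∈ S' := hrS (mem_prange.2 ⟨x, Or.inr rfl⟩)
  have hcutfin : (pcut S S' f).Finite := hfin.preimage
    (f := fun p : H.restrict S × H'.restrict S' => (p.1.1, p.2.1)) fun p _ q _ h =>
      Prod.ext (Subtype.ext (congrArg Prod.fst h)) (Subtype.ext (congrArg Prod.snd h))
  have := hC.isPartialEmb_union_of_notMem hS hS' ((isPartialEmb_pcut hfd hfr).2 hf) hcutfin
    (x := ⟨x, hxS⟩) (y := ⟨y, hyS⟩)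
    (by rw [pdom_pcut hfr, mem_cl_restrict_preimage hfd]; exact hx)
    (by rw [prange_pcut hfd, mem_cl_restrict_preimage hfr]; exact hy)
  rw [← isPartialEmb_pcut hdS hrS]
  refine this.mono ?_
  rintro ⟨a, a'⟩ (h | h)
  · exact Or.inl h
  · obtain ⟨h₁, h₂⟩ := Prod.ext_iff.1 h
    exact Or.inr (Prod.ext (Subtype.ext h₁) (Subtype.ext h₂))

theorem mem_cl_iff_of_finLocally (hC : IsQuasiminimalExcellent C)
    (hH : H ∈ finLocally C) (hH' : H' ∈ finLocally C) {F : Set (H × H')} (hF : IsPartialEmb L F)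
    {X : Set H} (hX : X ⊆ pdom F) {x : H} {y : H'} (hxy : (x, y) ∈ F) :
    y ∈ H'.cl (pimage F X) ↔ x ∈ H.cl X := by
  refine ⟨fun h => ?_, hC.cl_map_of_finLocally hH hH' hF hX hxy⟩
  refine (hC.pregeometry_of_finLocally hH).mono _ _ ?_
    (hC.cl_map_of_finLocally hH' hH hF.pinv (by
      rw [pdom_pinv]; exact pimage_subset_prange) hxy h)
  rintro a ⟨b, ⟨a', ha', hb'⟩, hb⟩
  obtain rfl : a = a' := hF.eq_left hb hb'
  exact ha'

/-- A countable infinite-dimensional subset of a finitely local structure spans a countable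
infinite-dimensional model. -/
theorem exists_equiv_of_finLocally [IsEmpty (L.Relations 0)] (hC : IsQuasiminimalExcellent C)
    (hH : H ∈ finLocally C) {M : ClStructure.{u, v, w} L} (hM : M ∈ C) [Countable M]
    (hMfg : ¬ M.FinGen) {A : Set H} (hA : A.Countable)
    (hAfg : ∀ F : Set H, F.Finite → ¬ A ⊆ H.cl F) (S : L.Substructure H)
    (hS : (S : Set H) = H.cl A) :
    ∃ e : M ≃[L] H.restrict S, IsIso e := by
  have hp := hC.pregeometry_of_finLocally hH
  have hM' := locally_subset_finLocally (hC.subset_locally hM)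
  have hAc : (H.cl A).Countable := hp.cl_countable (fun F hF => by
    obtain ⟨T, hT, hTc, -⟩ := hC.exists_restrict_mem_of_finLocally hH hF
    rwa [← hT]) hA
  let P : Set (Set (M × H)) := {f | IsPartialEmb L f ∧ f.Finite ∧ prange f ⊆ H.cl A}
  have hadd : ∀ f ∈ P, ∀ x y, IsPartialEmb L (f ∪ {(x, y)}) → y ∈ H.cl A → f ∪ {(x, y)} ∈ P := by
    intro f hf x y hxy hy
    refine ⟨hxy, hf.2.1.union (Set.finite_singleton _), ?_⟩
    rw [prange_union, prange_singleton]
    exact Set.union_subset hf.2.2 (Set.singleton_subset_iff.2 hy)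
  obtain ⟨T, hTP, hT, -, hTd, hTr⟩ := exists_backAndForth P
    (f₀ := ∅) ⟨isPartialEmb_empty, Set.finite_empty, by simp⟩
    (Set.countable_univ (α := M)) hAc (by
      intro f hf x _
      by_cases hx : x ∈ M.cl (pdom f)
      · obtain ⟨y, hy, hxy⟩ := hC.exists_extend_of_mem_of_finLocally hM' hH hf.1 hf.2.1 hx
        exact ⟨_, hadd f hf x y hxy (hp.cl_subset hf.2.2 hy), Set.subset_union_left,
          mem_pdom.2 ⟨y, Or.inr rfl⟩⟩
      -- A generic value is found in `A`, which is not spanned by the finite image of `f`.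
      · obtain ⟨y, hyA, hy⟩ := Set.not_subset.1 (hAfg _ (hf.2.1.image Prod.snd))
        exact ⟨_, hadd f hf x y (hC.isPartialEmb_union_of_notMem_of_finLocally hM' hH hf.1 hf.2.1
          hx hy) (hp.mem_cl_self hyA), Set.subset_union_left, mem_pdom.2 ⟨y, Or.inr rfl⟩⟩) (by
      intro f hf y hyA
      obtain ⟨x, hx⟩ : ∃ x, IsPartialEmb L (f ∪ {(x, y)}) := by
        by_cases hy : y ∈ H.cl (prange f)
        · obtain ⟨x, -, hxy⟩ := hC.exists_extend_of_mem_of_finLocally hH hM' hf.1.pinv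
            (hf.2.1.preimage Prod.swap_injective.injOn) (x := y) (by rwa [pdom_pinv])
          exact ⟨x, by simpa [-Set.union_singleton] using hxy.pinv⟩
        · have : ∃ x, x ∉ M.cl (pdom f) := by
            by_contra! hcon
            exact hMfg ⟨pdom f, hf.2.1.image _, Set.eq_univ_of_forall hcon⟩
          obtain ⟨x, hx⟩ := this
          exact ⟨x, hC.isPartialEmb_union_of_notMem_of_finLocally hM' hH hf.1 hf.2.1 hx hy⟩
      exact ⟨_, hadd f hf x y hx hyA, Set.subset_union_left, mem_prange.2 ⟨x, Or.inr rfl⟩⟩)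
  have hF : IsPartialEmb L (⋃₀ T) := isPartialEmb_sUnion hT fun f hf => (hTP hf).1
  have hFr : prange (⋃₀ T) ⊆ S := by
    intro y hy
    obtain ⟨x, f, hf, hxy⟩ := mem_prange.1 hy
    rw [hS]
    exact (hTP hf).2.2 (mem_prange.2 ⟨x, hxy⟩)
  obtain ⟨e, he⟩ := (hF.pcomp (isPartialEmb_graph (L := L) S.subtype).pinv).exists_equiv
    (Set.eq_univ_of_forall fun x => by
      obtain ⟨y, hy⟩ := mem_pdom.1 (hTd (Set.mem_univ x))
      exact mem_pdom.2 ⟨⟨y, hFr (mem_prange.2 ⟨x, hy⟩)⟩, y, hy, rfl⟩)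
    (Set.eq_univ_of_forall fun y => by
      obtain ⟨x, hx⟩ := mem_prange.1 (hTr (hS.subset y.2))
      exact mem_prange.2 ⟨x, y.1, hx, rfl⟩)
  have heF : ∀ x, (x, (e x).1) ∈ ⋃₀ T := fun x => by
    obtain ⟨y, hy, hye⟩ := mem_pcomp.1 ((he x _).1 rfl)
    obtain rfl : (e x).1 = y := hye
    exact hy
  refine ⟨e, isIso_of_forall_mem_iff (H' := H.restrict S) e fun X x => ?_⟩
  rw [mem_cl_restrict, ← hC.mem_cl_iff_of_finLocally hM' hH hF
    ((Set.subset_univ X).trans hTd) (heF x)]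
  suffices Subtype.val '' (e '' X) = pimage (⋃₀ T) X by rw [this]
  ext y
  constructor
  · rintro ⟨_, ⟨z, hz, rfl⟩, rfl⟩
    exact ⟨z, hz, heF z⟩
  · rintro ⟨z, hz, hzy⟩
    exact ⟨_, ⟨z, hz, rfl⟩, hF.eq_right (heF z) hzy⟩

/-- If the countable set `A` depends on a finite set, the definition applies to that set. Otherwise
`A` is infinite-dimensional and its closure is a copy of the model of dimension `ℵ₀`, by a
back-and-forth that uses only finite pieces. -/
theorem finLocally_subset_locally [IsEmpty (L.Relations 0)] (hC : IsQuasiminimalExcellent C)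
    (hinf : HasInfiniteDimensionalModel C) : finLocally C ⊆ ClStructure.locally C := by
  intro H hH
  have hp := hC.pregeometry_of_finLocally hH
  refine ⟨hH.1, hH.2.1, fun A hA => ?_⟩
  by_cases hfg : ∃ F : Set H, F.Finite ∧ A ⊆ H.cl F
  · obtain ⟨F, hF, hAF⟩ := hfg
    obtain ⟨S, hS, hSc, hSC⟩ := hC.exists_restrict_mem_of_finLocally hH hF
    exact ⟨S, hS ▸ hAF, hSc, by rw [hS, hp.idem], hSC⟩
  · push Not at hfg
    let S : L.Substructure H := ⟨H.cl A, fun {n} f x hx => by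
      obtain ⟨T, hT, -, -⟩ := hC.exists_restrict_mem_of_finLocally hH (Set.finite_range x)
      have : Structure.funMap f x ∈ T := T.fun_mem f x fun i =>
        hT.symm.subset (hp.mem_cl_self (Set.mem_range_self i))
      rw [← SetLike.mem_coe, hT] at this
      exact hp.cl_subset (Set.range_subset_iff.2 hx) this⟩
    obtain ⟨M, hM, hMdim⟩ := hC.exists_hasDim_of_infinite hinf ⊤
    have : Countable M := hC.countable_of_hasDim hM (by simp) hMdim
    obtain ⟨e, he⟩ := hC.exists_equiv_of_finLocally hH hM
      (hC.not_finGen_of_hasDim hM (by simp) hMdim) hA hfg S rfl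
    have hSc : Countable S := e.toEquiv.symm.injective.countable
    exact ⟨S, hp.subset_cl A, Set.countable_coe_iff.1 hSc, (hp.idem A).subset,
      hC.isoClosed M hM _ e he⟩

end IsQuasiminimalExcellent

/-! ## Uncountable models -/

namespace IsQuasiminimalExcellent

open FirstOrder.Language

variable {L : FirstOrder.Language.{u, v}} {C : Set (ClStructure.{u, v, w} L)}
variable {H H' : ClStructure.{u, v, w} L}

/-- The closure is covered by the countable closures of the finite subsets of `B`, and there are
only `#B` of these. -/
theorem mk_cl_le (hC : IsQuasiminimalExcellent C) (hH : H ∈ C) (B : Set H) [Infinite B] :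
    #(H.cl B) ≤ #B := by
  have hp := hC.pregeometry H hH
  have hsub : H.cl B ⊆ ⋃ F : Finset B, H.cl (Subtype.val '' (F : Set B)) := by
    intro x hx
    obtain ⟨F, hFB, hF, hxF⟩ := hp.finite_char B x hx
    refine Set.mem_iUnion.2 ⟨(hF.preimage Subtype.val_injective.injOn).toFinset, ?_⟩
    rwa [Set.Finite.coe_toFinset, Set.image_preimage_eq_of_subset (by rwa [Subtype.range_val])]
  calc #(H.cl B) ≤ #(⋃ F : Finset B, H.cl (Subtype.val '' (F : Set B))) := mk_le_mk_of_subset hsub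
    _ ≤ #(Finset B) * ⨆ F : Finset B, #(H.cl (Subtype.val '' (F : Set B))) := mk_iUnion_le _
    _ ≤ #B * ℵ₀ := by
      rw [mk_finset_of_infinite]
      gcongr
      exact ciSup_le' fun F => Cardinal.le_aleph0_iff_set_countable.2
        (hC.ccp H hH _ (F.finite_toSet.image _))
    _ = #B := mul_aleph0_eq (aleph0_le_mk B)

theorem mk_basis (hC : IsQuasiminimalExcellent C) (hH : H ∈ C) {B : Set H}
    (hB : H.cl B = Set.univ) (hH' : ℵ₀ < #H) : #B = #H := by
  have : Infinite B := by
    by_contra hcon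
    have := (hC.ccp H hH B (not_infinite_iff_finite.1 hcon))
    rw [hB, Set.countable_univ_iff, ← mk_le_aleph0_iff] at this
    exact this.not_gt hH'
  refine le_antisymm (mk_set_le B) ?_
  rw [← mk_univ, ← hB]
  exact hC.mk_cl_le hH B

theorem exists_iso_of_uncountable [IsEmpty (L.Relations 0)] (hC : IsQuasiminimalExcellent C)
    (hH : H ∈ C) (hH' : H' ∈ C) (h : ℵ₀ < #H) (hHH' : #H = #H') :
    ∃ e : H ≃[L] H', IsIso e := by
  obtain ⟨B, hB, hBu⟩ := (hC.pregeometry H hH).exists_basis_univ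
  obtain ⟨B', hB', hBu'⟩ := (hC.pregeometry H' hH').exists_basis_univ
  exact hC.exists_iso_of_hasDim hH hH' ⟨B, hB, hBu, rfl⟩
    ⟨B', hB', hBu', by rw [hC.mk_basis hH hBu h, hC.mk_basis hH' hBu' (hHH' ▸ h), hHH']⟩

/-- Classes with unions of chains contain the structures which are locally in the class. -/
theorem locally_subset_of_hasUnionsOfChains (hC : IsQuasiminimalExcellent C)
    (hU : HasUnionsOfChains C) : ClStructure.locally C ⊆ C := by
  have key : ∀ (κ : Cardinal.{w}) (H : ClStructure.{u, v, w} L), H ∈ ClStructure.locally C →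
      H.HasDim κ → H ∈ C := by
    intro κ
    induction κ using WellFoundedLT.induction with
    | _ κ ih =>
    intro H hH hdim
    rcases le_or_gt κ ℵ₀ with hκ | hκ
    · have := hC.locally.countable_of_hasDim hH hκ hdim
      exact hC.mem_of_countable hH
    have hp := hC.pregeometry_of_locally hH
    obtain ⟨B, hB, hBu, hBκ⟩ := hdim
    -- The basis is enumerated in the least order type of its size: proper initial segments then
    -- have fewer than `κ` elements, so their closures fall under the induction hypothesis. There is
    -- no last index, so every finite set of indices lies in a proper initial segment.
    let ι := κ.ord.ToType
    have hι : #ι = κ := by simp [ι]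
    have : NoMaxOrder ι := Cardinal.noMaxOrder hκ.le
    have : Nonempty ι := by
      rw [← mk_ne_zero_iff, hι]
      exact (aleph0_pos.trans hκ).ne'
    obtain ⟨b⟩ := Cardinal.eq.1 (hι.trans hBκ.symm)
    have hbI : ∀ I : Set ι, (fun i => (b i : H)) '' I ⊆ B := by
      rintro I _ ⟨i, -, rfl⟩
      exact (b i).2
    have hinj : Function.Injective fun i => (b i : H) := Subtype.val_injective.comp b.injective
    choose S hS hSC using fun i : ι =>
      hC.locally.exists_restrict_mem hH ((fun i => (b i : H)) '' Set.Iio i)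
    have hScl : ∀ i, H.cl (S i) = S i := fun i => by rw [hS, hp.idem]
    have hmono : Monotone S := by
      intro i j hij
      rw [← SetLike.coe_subset_coe, hS, hS]
      exact hp.mono _ _ (Set.image_mono (Set.Iio_subset_Iio hij))
    have hcov : ∀ X : Set ι, X.Finite → ∃ i, X ⊆ Set.Iio i := by
      intro X hX
      obtain ⟨i, hi⟩ := hX.bddAbove
      obtain ⟨j, hj⟩ := exists_gt i
      exact ⟨j, fun k hk => (hi hk).trans_lt hj⟩
    have hcovF : ∀ a : H, ∃ i, a ∈ S i := by
      intro a
      obtain ⟨F, hFB, hF, haF⟩ := hp.finite_char B a (hBu ▸ Set.mem_univ a)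
      obtain ⟨i, hi⟩ := hcov ((fun i => (b i : H)) ⁻¹' F) (hF.preimage hinj.injOn)
      refine ⟨i, ?_⟩
      rw [← SetLike.mem_coe, hS]
      refine hp.mono _ _ (fun x hx => ?_) haF
      refine ⟨b.symm ⟨x, hFB hx⟩, hi ?_, by simp⟩
      simpa using hx
    have hSmem : ∀ i, H.restrict (S i) ∈ C := by
      intro i
      refine ih #(Set.Iio i) ((mk_Iio_lt i (by simp [ι])).trans_eq hι) _ (hSC i) ?_
      rw [← mk_image_eq hinj]
      exact hp.hasDim_restrict (hS i) (hp.indep_mono hB (hbI _))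
    have := hU ι H S (fun i => (H.restrict (S i)).cl) hmono hcovF hSmem (by
      intro i j hij
      have : (Subtype.val '' {a : S j | (a : H) ∈ S i}) = S i := by
        ext x
        exact ⟨fun ⟨a, ha, hax⟩ => hax ▸ ha, fun hx => ⟨⟨x, hmono hij hx⟩, hx, rfl⟩⟩
      ext a
      change a.1 ∈ H.cl (Subtype.val '' {a : S j | (a : H) ∈ S i}) ↔ a.1 ∈ S i
      rw [this, hScl, SetLike.mem_coe])
    convert this using 1
    have hcl : H.cl = fun X => ⋃ i, (Subtype.val : S i → H) '' (H.restrict (S i)).cl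
        ((Subtype.val : S i → H) ⁻¹' X) := by
      funext X
      ext a
      constructor
      · intro ha
        obtain ⟨F, hFX, hF, haF⟩ := hp.finite_char X a ha
        have : ∃ i, insert a F ⊆ (S i : Set H) := by
          choose i hi using hcovF
          obtain ⟨k, hk⟩ := ((hF.insert a).image i).bddAbove
          exact ⟨k, fun x hx => hmono (hk (Set.mem_image_of_mem i hx)) (hi x)⟩
        obtain ⟨i, hi⟩ := this
        refine Set.mem_iUnion.2 ⟨i, ⟨a, hi (Set.mem_insert _ _)⟩, ?_, rfl⟩
        rw [mem_cl_restrict]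
        refine hp.mono _ _ (fun x hx => ?_) haF
        exact ⟨⟨x, hi (Set.mem_insert_of_mem _ hx)⟩, hFX hx, rfl⟩
      · intro ha
        obtain ⟨i, x, hx, rfl⟩ := Set.mem_iUnion.1 ha
        refine hp.mono _ _ ?_ hx
        rintro _ ⟨y, hy, rfl⟩
        exact hy
    rw [← hcl]
    rfl
  intro H hH
  obtain ⟨B, hB, hBu⟩ := (hC.pregeometry_of_locally hH).exists_basis_univ
  exact key _ H hH ⟨B, hB, hBu, rfl⟩

end IsQuasiminimalExcellent

/-! ## Directed unions -/

namespace ClStructure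

open FirstOrder.Language

variable {L : FirstOrder.Language.{u, v}}

/-- The union of a directed family of structures embedded in a set. -/
theorem exists_directed_union {ι : Type*} [Nonempty ι] {Z : Type w} (M : ι → Type w)
    [∀ i, L.Structure (M i)] (j : ∀ i, M i → Z) (hj : ∀ i, Function.Injective (j i))
    (dir : ∀ i i', ∃ k, (∃ e : M i ↪[L] M k, ∀ x, j k (e x) = j i x) ∧
      ∃ e : M i' ↪[L] M k, ∀ x, j k (e x) = j i' x) :
    ∃ (U : Type w) (_ : L.Structure U) (J : U → Z) (g : ∀ i, M i ↪[L] U),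
      Function.Injective J ∧ (∀ i x, J (g i x) = j i x) ∧ Directed (· ⊆ ·) (fun i => Set.range (g i)) ∧
      ∀ u, ∃ i x, g i x = u := by
  let U : Type w := {z : Z // ∃ i x, j i x = z}
  have hdir : Directed (· ⊆ ·) fun i => Set.range (j i) := by
    intro i i'
    obtain ⟨k, ⟨e, he⟩, e', he'⟩ := dir i i'
    refine ⟨k, ?_, ?_⟩
    · rintro _ ⟨x, rfl⟩
      exact ⟨e x, he x⟩
    · rintro _ ⟨x, rfl⟩
      exact ⟨e' x, he' x⟩
  have cov : ∀ {n} (x : Fin n → U), ∃ i, ∃ y : Fin n → M i, ∀ k, j i (y k) = x k := by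
    intro n x
    choose i hi using fun k => (x k).2
    obtain ⟨l, hl⟩ := hdir.finite_le i
    choose y hy using fun k => hl k (hi k)
    exact ⟨l, y, hy⟩
  have hfun : ∀ {n} (f : L.Functions n) {i i'} (x : Fin n → M i) (y : Fin n → M i'),
      (∀ k, j i (x k) = j i' (y k)) →
      j i (Structure.funMap f x) = j i' (Structure.funMap f y) := by
    intro n f i i' x y hxy
    obtain ⟨k, ⟨e, he⟩, e', he'⟩ := dir i i'
    have : e ∘ x = e' ∘ y := funext fun l => hj k (by simp [he, he', hxy])
    rw [← he, ← he', e.map_fun, e'.map_fun, this]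
  have hrel : ∀ {n} (r : L.Relations n) {i i'} (x : Fin n → M i) (y : Fin n → M i'),
      (∀ k, j i (x k) = j i' (y k)) →
      (Structure.RelMap r x ↔ Structure.RelMap r y) := by
    intro n r i i' x y hxy
    obtain ⟨k, ⟨e, he⟩, e', he'⟩ := dir i i'
    have : e ∘ x = e' ∘ y := funext fun l => hj k (by simp [he, he', hxy])
    rw [← e.map_rel, ← e'.map_rel, this]
  -- Functions and relations on the union are defined through a chosen member containing the
  -- arguments; `hfun` and `hrel` make the choice irrelevant.
  choose ci cy hcy using @cov
  let str : L.Structure U :=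
    { funMap := fun {n} f x => ⟨_, ci x, Structure.funMap f (cy x), rfl⟩
      RelMap := fun {n} r x => Structure.RelMap r (cy x) }
  let g : ∀ i, M i ↪[L] U := fun i =>
    { toFun := fun x => ⟨j i x, i, x, rfl⟩
      inj' := fun x y hxy => hj i (congrArg Subtype.val hxy)
      map_fun' := fun f x => Subtype.ext
        (hfun f x (cy _) fun k => (hcy (fun l => ⟨j i (x l), i, x l, rfl⟩) k).symm)
      map_rel' := fun r x => hrel r _ _ fun k => hcy _ k }
  refine ⟨U, str, Subtype.val, g, Subtype.val_injective, fun i x => rfl, ?_, ?_⟩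
  · intro i i'
    obtain ⟨k, h, h'⟩ := hdir i i'
    refine ⟨k, ?_, ?_⟩
    · rintro _ ⟨x, rfl⟩
      obtain ⟨y, hy⟩ := h ⟨x, rfl⟩
      exact ⟨y, Subtype.ext hy⟩
    · rintro _ ⟨x, rfl⟩
      obtain ⟨y, hy⟩ := h' ⟨x, rfl⟩
      exact ⟨y, Subtype.ext hy⟩
  · rintro ⟨z, i, x, hx⟩
    exact ⟨i, x, Subtype.ext hx⟩

/-- `M` is a closed substructure of `M'`, relative to maps of both into a set `Z`. -/
def ClosedLE {Z : Type w} (M M' : ClStructure.{u, v, w} L) (j : M → Z) (j' : M' → Z) : Prop :=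
  ∃ e : M ↪[L] M', (∀ x, j' (e x) = j x) ∧ M'.cl (Set.range e) ⊆ Set.range e

theorem closedLE_refl {Z : Type w} (M : ClStructure.{u, v, w} L) (j : M → Z) :
    ClosedLE M M j j :=
  ⟨Embedding.refl L M, fun _ => rfl, fun x _ => ⟨x, rfl⟩⟩

end ClStructure

namespace IsQuasiminimalExcellent

open FirstOrder.Language

variable {L : FirstOrder.Language.{u, v}} {C : Set (ClStructure.{u, v, w} L)}
variable {H H' : ClStructure.{u, v, w} L}

theorem closedLE_trans (hC : IsQuasiminimalExcellent C) {Z : Type w}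
    {M₁ M₂ M₃ : ClStructure.{u, v, w} L} {j₁ : M₁ → Z} {j₂ : M₂ → Z} {j₃ : M₃ → Z} (h₂ : M₂ ∈ C)
    (h₃ : M₃ ∈ C) (h₁₂ : ClosedLE M₁ M₂ j₁ j₂) (h₂₃ : ClosedLE M₂ M₃ j₂ j₃) :
    ClosedLE M₁ M₃ j₁ j₃ := by
  obtain ⟨e, he, hec⟩ := h₁₂
  obtain ⟨e', he', hec'⟩ := h₂₃
  refine ⟨e'.comp e, fun x => (he' _).trans (he x), ?_⟩
  have : Set.range (e'.comp e) = e' '' Set.range e := by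
    rw [← Set.range_comp]; rfl
  rw [this]
  intro y hy
  obtain ⟨z, rfl⟩ := hec' ((hC.pregeometry _ h₃).mono _ _ (Set.image_subset_range _ _) hy)
  exact ⟨z, hec ((hC.mem_cl_iff_embedding h₂ h₃ e' _ z).1 hy), rfl⟩

/-- Directed unions of models. -/
theorem exists_directed_union (hC : IsQuasiminimalExcellent C) {ι : Type*} [Nonempty ι]
    {Z : Type w} (M : ι → ClStructure.{u, v, w} L) (hM : ∀ i, M i ∈ C)
    (hMfg : ∀ i, ¬ (M i).FinGen) (j : ∀ i, M i → Z) (hj : ∀ i, Function.Injective (j i))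
    (dir : ∀ i i', ∃ k, ClosedLE (M i) (M k) (j i) (j k) ∧ ClosedLE (M i') (M k) (j i') (j k)) :
    ∃ U ∈ finLocally C, ∃ J : U → Z, Function.Injective J ∧ ¬ U.FinGen ∧
      ∀ i, ClosedLE (M i) U (j i) J := by
  obtain ⟨U, hU, J, g, hJ, hg, hgdir, hgcov⟩ := ClStructure.exists_directed_union (L := L)
    (fun i => M i) j hj fun i i' => by
      obtain ⟨k, ⟨e, he, -⟩, e', he', -⟩ := dir i i'
      exact ⟨k, ⟨e, he⟩, e', he'⟩
  have hcompat : ∀ {i k} (e : M i ↪[L] M k), (∀ x, j k (e x) = j i x) → ∀ x, g k (e x) = g i x :=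
    fun e he x => hJ (by rw [hg, hg, he])
  have himage : ∀ {i k} (e : M i ↪[L] M k), (∀ x, j k (e x) = j i x) → ∀ X,
      g i '' X = g k '' (e '' X) := fun e he X => by
    rw [Set.image_image]
    exact Set.image_congr fun x _ => (hcompat e he x).symm
  -- A point belongs to the closure of `X` if it does so in some member. By `hup` this persists in
  -- larger members.
  let V : ClStructure.{u, v, w} L :=
    ⟨U, fun X => {u | ∃ i x, g i x = u ∧ x ∈ (M i).cl (g i ⁻¹' X)}⟩
  have hup : ∀ {i k} (e : M i ↪[L] M k), (∀ x, j k (e x) = j i x) → ∀ (X : Set U) (x : M i),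
      x ∈ (M i).cl (g i ⁻¹' X) → e x ∈ (M k).cl (g k ⁻¹' X) := by
    intro i k e he X x hx
    refine (hC.pregeometry _ (hM k)).mono _ _ ?_
      ((hC.mem_cl_iff_embedding (hM i) (hM k) e _ x).2 hx)
    rintro _ ⟨y, hy, rfl⟩
    rw [Set.mem_preimage, hcompat e he]
    exact hy
  have hmem : ∀ i (X : Set (M i)) (x : M i), g i x ∈ V.cl (g i '' X) ↔ x ∈ (M i).cl X := by
    intro i X x
    constructor
    · rintro ⟨i', y, hyx, hy⟩
      obtain ⟨k, ⟨e, he, -⟩, e', he', -⟩ := dir i i'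
      have h₁ : e' y = e x := (g k).injective (by rw [hcompat e he, hcompat e' he', hyx])
      have h₂ : g k ⁻¹' (g i '' X) = e '' X := by
        rw [himage e he, (g k).injective.preimage_image]
      have := hup e' he' _ y hy
      rw [h₁, h₂] at this
      exact (hC.mem_cl_iff_embedding (hM i) (hM k) e X x).1 this
    · intro hx
      refine ⟨i, x, rfl, ?_⟩
      rwa [(g i).injective.preimage_image]
  have hclosed : ∀ i, V.cl (Set.range (g i)) ⊆ Set.range (g i) := by
    rintro i _ ⟨i', y, rfl, hy⟩
    obtain ⟨k, ⟨e, he, hec⟩, e', he', -⟩ := dir i i'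
    have h₂ : g k ⁻¹' (Set.range (g i)) = Set.range e := by
      rw [← Set.image_univ, himage e he, (g k).injective.preimage_image, Set.image_univ]
    have := hup e' he' _ y hy
    rw [h₂] at this
    obtain ⟨x, hx⟩ := hec this
    exact ⟨x, by rw [← hcompat e he, hx, hcompat e' he']⟩
  have hfin : ∀ A : Set U, A.Finite → ∃ i, A ⊆ Set.range (g i) := by
    intro A hA
    have := hA.to_subtype
    choose i x hx using fun a : A => hgcov a
    obtain ⟨k, hk⟩ := hgdir.finite_le i
    exact ⟨k, fun a ha => hk ⟨a, ha⟩ ⟨x ⟨a, ha⟩, hx ⟨a, ha⟩⟩⟩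
  refine ⟨V, ⟨?_, ?_, ?_⟩, J, hJ, ?_, fun i => ⟨g i, hg i, hclosed i⟩⟩
  · rintro X Y hXY _ ⟨i, x, rfl, hx⟩
    exact ⟨i, x, rfl, (hC.pregeometry _ (hM i)).mono _ _ (Set.preimage_mono hXY) hx⟩
  · rintro X _ ⟨i, x, rfl, hx⟩
    obtain ⟨Y, hYX, hY, hxY⟩ := (hC.pregeometry _ (hM i)).finite_char _ _ hx
    exact ⟨g i '' Y, Set.image_subset_iff.2 hYX, hY.image _, (hmem i Y x).2 hxY⟩
  · intro A hA
    obtain ⟨i, hi⟩ := hfin A hA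
    refine ⟨(g i).toHom.range, hi, hclosed i, ?_⟩
    have he : ∀ x, ((g i).equivRange x).1 = g i x := fun x => rfl
    refine hC.isoClosed (M i) (hM i) (V.restrict (g i).toHom.range) (g i).equivRange
      (isIso_of_forall_mem_iff (H' := V.restrict (g i).toHom.range) _ fun X x => ?_)
    rw [mem_cl_restrict, ← hmem, Set.image_image]
    rfl
  · rintro ⟨F, hF, hFu⟩
    obtain ⟨i, hi⟩ := hfin F hF
    refine hMfg i ⟨g i ⁻¹' F, hF.preimage (g i).injective.injOn, ?_⟩
    refine Set.eq_univ_of_forall fun x => (hmem i _ x).1 ?_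
    rw [Set.image_preimage_eq_of_subset hi, hFu]
    trivial

end IsQuasiminimalExcellent

/-! ## Models of every uncountable cardinality -/

namespace IsQuasiminimalExcellent

open FirstOrder.Language

variable {L : FirstOrder.Language.{u, v}} {C : Set (ClStructure.{u, v, w} L)}
variable {H H' : ClStructure.{u, v, w} L}

/-- The operation `locally` is idempotent, since its countable members already belong to `C`. -/
theorem mem_locally_of_mem_locally_locally (hC : IsQuasiminimalExcellent C)
    (hH : H ∈ ClStructure.locally (ClStructure.locally C)) : H ∈ ClStructure.locally C := by
  refine ⟨hH.1, hH.2.1, fun A hA => ?_⟩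
  obtain ⟨S, hAS, hSc, hcl, hS⟩ := hH.2.2 A hA
  have : Countable S := hSc.to_subtype
  exact ⟨S, hAS, hSc, hcl, hC.mem_of_countable hS⟩

/-- An infinite-dimensional model has a closed embedding into itself which is not surjective. -/
theorem exists_closed_embedding_self [IsEmpty (L.Relations 0)] (hC : IsQuasiminimalExcellent C)
    (hH : H ∈ C) (hHfg : ¬ H.FinGen) :
    ∃ e : H ↪[L] H, H.cl (Set.range e) ⊆ Set.range e ∧ ∃ b, b ∉ Set.range e := by
  have hp := hC.pregeometry H hH
  obtain ⟨B, hB, hBu⟩ := hp.exists_basis_univ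
  have hBinf : B.Infinite := fun hfin => hHfg ⟨B, hfin, hBu⟩
  obtain ⟨b, hb⟩ := hBinf.nonempty
  have : Infinite B := hBinf.to_subtype
  -- Omitting one point from an infinite basis leaves a set of the same size. It spans a proper
  -- closed substructure, isomorphic to the whole.
  have hcard : #B = #(B \ {b} : Set H) := by
    have h := Cardinal.mk_insert (s := B \ {b}) (a := b) (by simp)
    rw [Set.insert_sdiff_singleton, Set.insert_eq_of_mem hb] at h
    have hinf : ℵ₀ ≤ #(B \ {b} : Set H) :=
      Cardinal.infinite_iff.1 (hBinf.sdiff (Set.finite_singleton b)).to_subtype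
    rw [h, Cardinal.add_one_eq hinf]
  obtain ⟨F, hF, hFd, hFr⟩ := hC.exists_partialEmb_of_indep hH hH hB
    (hp.indep_mono hB Set.sdiff_subset) hcard
  obtain ⟨S, hS, -⟩ := hC.exists_restrict_mem hH (B \ {b})
  obtain ⟨e, -⟩ := (hF.pcomp (isPartialEmb_graph (L := L) S.subtype).pinv).exists_equiv
    (Set.eq_univ_of_forall fun x => by
      obtain ⟨y, hy⟩ := mem_pdom.1 ((hFd.trans hBu).symm.subset (Set.mem_univ x))
      exact mem_pdom.2 ⟨⟨y, hS.symm.subset (hFr.subset (mem_prange.2 ⟨x, hy⟩))⟩, y, hy, rfl⟩)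
    (Set.eq_univ_of_forall fun y => by
      obtain ⟨x, hx⟩ := mem_prange.1 (hFr.symm.subset (hS.subset y.2))
      exact mem_prange.2 ⟨x, y.1, hx, rfl⟩)
  have hr : Set.range (S.subtype.comp e.toEmbedding) = H.cl (B \ {b}) := by
    rw [← hS]
    ext y
    exact ⟨fun ⟨x, hx⟩ => hx ▸ (e x).2, fun hy => ⟨e.symm ⟨y, hy⟩, by
      change (e (e.symm ⟨y, hy⟩)).1 = y
      rw [e.apply_symm_apply]⟩⟩
  refine ⟨S.subtype.comp e.toEmbedding, ?_, b, ?_⟩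
  · rw [hr, hp.idem]
  · rw [hr]
    exact hB b hb

/-- Injections into a set `Z` of size `κ` bound the sizes of the models. Zorn's lemma gives a
maximal infinite-dimensional model over `Z`, and a model of size less than `κ` still has room in `Z`
for a proper closed extension. -/
theorem exists_mk_eq [IsEmpty (L.Relations 0)] (hC : IsQuasiminimalExcellent C)
    (hinf : HasInfiniteDimensionalModel C) {κ : Cardinal.{w}} (hκ : ℵ₀ < κ) :
    ∃ H ∈ ClStructure.locally C, #H = κ := by
  let Z : Type w := κ.out
  have hZ : #Z = κ := mk_out κ
  have hZinf : Infinite Z := infinite_iff.2 (hZ ▸ hκ.le)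
  have hC' := hC.locally
  have hinf' : HasInfiniteDimensionalModel (ClStructure.locally C) := by
    obtain ⟨H, hH, h⟩ := hinf
    exact ⟨H, hC.subset_locally hH, h⟩
  obtain ⟨M, hM, hMdim⟩ := hC'.exists_hasDim_of_infinite hinf' ⊤
  have hMc : Countable M := hC'.countable_of_hasDim hM (by simp) hMdim
  have hMfg := hC'.not_finGen_of_hasDim hM (by simp) hMdim
  obtain ⟨jM⟩ : Nonempty (M ↪ Z) := Cardinal.le_def _ _ |>.1 (by
    rw [hZ]; exact (mk_le_aleph0_iff.2 hMc).trans hκ.le)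
  let T := {p : Σ H : ClStructure.{u, v, w} L, H → Z // p.1 ∈ ClStructure.locally C ∧
    ¬ p.1.FinGen ∧ Function.Injective p.2}
  let r : T → T → Prop := fun p q => ClosedLE p.1.1 q.1.1 p.1.2 q.1.2
  obtain ⟨m, hm⟩ := exists_maximal_of_chains_bounded (r := r) (fun c hc => by
    rcases c.eq_empty_or_nonempty with rfl | hne
    -- The empty chain is bounded by the countable infinite-dimensional model, which shows that
    -- there is something to maximise.
    · exact ⟨⟨⟨M, jM⟩, hM, hMfg, jM.injective⟩, fun _ h => h.elim⟩
    have := hne.to_subtype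
    obtain ⟨U, hU, J, hJ, hUfg, hUle⟩ := hC'.exists_directed_union (ι := c)
      (fun p => p.1.1.1) (fun p => p.1.2.1) (fun p => p.1.2.2.1) (fun p => p.1.1.2)
      (fun p => p.1.2.2.2) (fun p q => by
        by_cases hpq : p.1 = q.1
        · obtain rfl := Subtype.ext hpq
          exact ⟨p, closedLE_refl _ _, closedLE_refl _ _⟩
        · rcases hc p.2 q.2 hpq with h | h
          · exact ⟨q, h, closedLE_refl _ _⟩
          · exact ⟨p, closedLE_refl _ _, h⟩)
    have hU' := hC.mem_locally_of_mem_locally_locally (hC'.finLocally_subset_locally hinf' hU)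
    exact ⟨⟨⟨U, J⟩, hU', hUfg, hJ⟩, fun p hp => hUle ⟨p, hp⟩⟩)
    fun {p q s} hpq hqs => hC'.closedLE_trans q.2.1 s.2.1 hpq hqs
  obtain ⟨⟨H, j⟩, hH, hHfg, hj⟩ := m
  refine ⟨H, hH, ?_⟩
  by_contra hne
  have hlt : #H < #Z := by
    rw [hZ]
    exact ((mk_le_of_injective hj).trans_eq hZ).lt_of_ne hne
  obtain ⟨e, hecl, b, hb⟩ := hC'.exists_closed_embedding_self hH hHfg
  obtain ⟨g⟩ : Nonempty (H ↪ ((Set.range j)ᶜ : Set Z)) := by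
    rw [← Cardinal.le_def, mk_compl_of_infinite _ (mk_range_le.trans_lt hlt)]
    exact hlt.le
  -- The extension is `H` itself, seen as a proper extension of its copy `Set.range e`: that copy
  -- keeps the labels given by `j`, and the other points get labels outside the range of `j`.
  let j' : H → Z := Function.extend e j fun x => g x
  have hj'e : ∀ x, j' (e x) = j x := fun x => e.injective.extend_apply _ _ x
  have hj'g : ∀ x, x ∉ Set.range e → j' x = g x := fun x hx => Function.extend_apply' _ _ _ hx
  have hj' : Function.Injective j' := by
    intro x y hxy
    by_cases hx : x ∈ Set.range e <;> by_cases hy : y ∈ Set.range e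
    · obtain ⟨x, rfl⟩ := hx
      obtain ⟨y, rfl⟩ := hy
      rw [hj'e, hj'e] at hxy
      rw [hj hxy]
    · obtain ⟨x, rfl⟩ := hx
      rw [hj'e, hj'g y hy] at hxy
      exact ((g y).2 ⟨x, hxy⟩).elim
    · obtain ⟨y, rfl⟩ := hy
      rw [hj'e, hj'g x hx] at hxy
      exact ((g x).2 ⟨y, hxy.symm⟩).elim
    · rw [hj'g x hx, hj'g y hy] at hxy
      exact g.injective (Subtype.ext hxy)
  -- By maximality the extension would embed back over `Z`, so the new label of `b` would be an old
  -- one.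
  obtain ⟨e', he', -⟩ := hm ⟨⟨H, j'⟩, hH, hHfg, hj'⟩ ⟨e, hj'e, hecl⟩
  refine (g b).2 ⟨e' b, (he' b).trans (hj'g b hb)⟩

theorem uncountablyCategorical_locally [IsEmpty (L.Relations 0)] (hC : IsQuasiminimalExcellent C)
    (hinf : HasInfiniteDimensionalModel C) : UncountablyCategorical (ClStructure.locally C) :=
  fun _ hκ => ⟨hC.exists_mk_eq hinf hκ, fun _ hH _ hH' h h' =>
    hC.locally.exists_iso_of_uncountable hH hH' (h ▸ hκ) (h.trans h'.symm)⟩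

end IsQuasiminimalExcellent

theorem mainTheorem1 {L : FirstOrder.Language.{u, v}} [Countable L.Symbols] [IsEmpty (L.Relations 0)]
    (C : Set (ClStructure.{u, v, w} L)) (hC : IsQuasiminimalExcellent C)
    (hinf : HasInfiniteDimensionalModel C) :
    -- the models `Mₙ`, the formulas `πₙ` and the Scott sentences `σₙ` exist
    (∀ n : ℕ∞, (∃ H ∈ C, H.HasDim (n : Cardinal.{w})) ∧
      ∀ H ∈ C, ∀ H' ∈ C, H.HasDim (n : Cardinal.{w}) → H'.HasDim (n : Cardinal.{w}) →
        ∃ e : H ≃[L] H', ClStructure.IsIso e) ∧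
    (∃ π : ∀ n : ℕ, LQFormula L (n + 1), DefinesClosure C π) ∧
    (∀ n : ℕ∞, ∀ H ∈ C, H.HasDim (n : Cardinal.{w}) → ∃ σ : LQFormula L 0, IsScottSentence σ H) ∧
    -- and, however they are chosen, the class of models of the resulting sentence is as claimed
    ∀ (M : ℕ∞ → ClStructure.{u, v, w} L) (π : ∀ n : ℕ, LQFormula L (n + 1))
      (σ : ℕ∞ → LQFormula L 0),
      (∀ n, M n ∈ C ∧ (M n).HasDim (n : Cardinal.{w})) →
      DefinesClosure C π →
      (∀ n, IsScottSentence (σ n) (M n)) →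
      IsQuasiminimalExcellent (modClass.{u, v, w} (classSentence σ π) π) ∧
      UncountablyCategorical (modClass.{u, v, w} (classSentence σ π) π) ∧
      C ⊆ modClass.{u, v, w} (classSentence σ π) π ∧
      (AxiomIV C → C = modClass.{u, v, w} (classSentence σ π) π) := by
  refine ⟨fun n => ⟨hC.exists_hasDim_of_infinite hinf n, fun H hH H' hH' h h' =>
    hC.exists_iso_of_hasDim hH hH' h h'⟩, hC.exists_definesClosure hinf, fun n H hH h => ?_,
    fun M π σ hM hπ hσ => ?_⟩
  · have := hC.countable_of_hasDim hH (Cardinal.ofENat_le_aleph0 n) h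
    exact hC.exists_isScottSentence hH
  -- The class of models of the sentence is `locally C`, whatever the choice of `M`, `π` and `σ`;
  -- all remaining claims are statements about `locally C`.
  · rw [(hC.modClass_subset_locally hM hπ hσ).antisymm (hC.locally_subset_modClass hM hπ hσ)]
    exact ⟨hC.locally, hC.uncountablyCategorical_locally hinf, hC.subset_locally, fun hIV =>
      hC.subset_locally.antisymm (hC.locally_subset_of_hasUnionsOfChains hIV.1)⟩
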